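/- **Setting.** Let $\lambda_1,\lambda_2,\nu>0$, $\lambda=\lambda_1+\lambda_2$, and let a service time be a random variable with values in $[0,\infty)$, with law $\mu$, mean $b$ and Laplace–Stieltjes transform $B^*(s)=\int e^{-sx}\,d\mu(x)$. Assume $\rho:=\lambda b<1$. Let $R_{B^*}\in[0,\infty]$ be the supremum of the real $t$ with $\int e^{tx}\,d\mu(x)<\infty$, and assume that $\mu$ is of type 1: $R_{B^*}>0$ and $B^*(-t)\to\infty$ as $t\uparrow R_{B^*}$. For $|z|<1$ let $h(z)$ be the unique root $w$, $|w|<1$, of $w=B^*(\lambda_1(1-w)+\lambda_2(1-z))$, and put $$f_1(z)=\frac{1-h(z)}{h(z)-z},\qquad Q(z)=(1-\rho)\exp\Big[-\frac{\lambda}{\nu}\int_z^1 f_1(x)\,dx\Big],\qquad R(z)=\frac{\lambda}{\lambda_2}f_1(z)Q(z),\qquad P_2(z)=Q(z)+R(z).$$ The *dominant singularity* of a function $f$ on the open unit disk is the number $r>0$ such that $f$ has an analytic version on $|z|<r$ and $r$ is the only point of the circle $|z|=r$ across which this version has no analytic continuation. For real $x>1$ in the closed disk of convergence, $f(x)$ is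 the sum at $x$ of the Taylor series of $f$ at $0$ (and $f_1(x)=\frac{1-h(x)}{h(x)-x}$). A relation "as $z\to r$" means that the function has an analytic continuation to a domain $\Delta=\{|z|<S,\ z\ne r,\ |\arg(z-r)|>\varphi\}$ with some $S>r$, $0<\varphi<\pi/2$, for which the relation holds as $z\to r$ in $\Delta$; powers are principal, and $f\sim g$ means that $f-g=o(g)$. **Theorem.** The function $h$ has a dominant singularity $R_h$, and its Taylor series converges there. Let $R^*$ be the smallest zero of $h(x)-x$ in $(1,R_h]$, if there is any. The functions $R$ and $P_2$ have dominant singularities, they coincide, $R_{P_2}=R_R=:r>1$, and exactly one of the following three cases occurs: (1) $r=R^*<R_h$; (2) $R^*$ does not exist and $r=R_h$; (3) $r=R^*=R_h$. As $z\to r$: 1. if $r=R^*<R_h$, then both $P_2$ and $R$ satisfy $$P_2(z)\sim \frac{\lambda}{\lambda_2}c_Q^{(1)}c_{f_1}^{(1)}(r-z)^{-1-\frac{\lambda}{\nu}c_{f_1}^{(1)}},\qquad R(z)\sim \frac{\lambda}{\lambda_2}c_Q^{(1)}c_{f_1}^{(1)}(r-z)^{-1-\frac{\lambda}{\nu}c_{f_1}^{(1)}};$$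 2. if $R^*$ does not exist and $r=R_h$, then the Taylor series of $Q,R,P_2$ converge at $r$ and $$P_2(z)=P_2(r)-\frac{\lambda}{\lambda_2}c_{f_1}^{(2)}Q(r)(r-z)^{1/2}+o\big((r-z)^{1/2}\big),\qquad R(z)=R(r)-\frac{\lambda}{\lambda_2}c_{f_1}^{(2)}Q(r)(r-z)^{1/2}+o\big((r-z)^{1/2}\big);$$ 3. if $r=R^*=R_h$, then the Taylor series of $Q$ converges at $r$ and $$P_2(z)\sim\frac{\lambda}{\lambda_2}\frac{c_{f_1}^{(3)}Q(r)}{(r-z)^{1/2}},\qquad R(z)\sim\frac{\lambda}{\lambda_2}\frac{c_{f_1}^{(3)}Q(r)}{(r-z)^{1/2}}.$$ Here $$c_{f_1}^{(1)}=\frac{(1-r)\big(1+\lambda_1 {B^*}'(\lambda(1-r))\big)}{1+\lambda {B^*}'(\lambda(1-r))},\quad c_{f_1}^{(2)}=\frac{r-1}{(h(r)-r)^2}\,c_h,\quad c_{f_1}^{(3)}=\frac{r-1}{c_h},\quad c_h=\sqrt{\frac{2\lambda_2}{\lambda_1^3{B^*}''(\lambda_1(1-h(R_h))+\lambda_2(1-R_h))}},$$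 $$c_Q^{(1)}=(1-\rho)(r-1)^{\frac{\lambda}{\nu}c_{f_1}^{(1)}}\exp\Big(-\frac{\lambda}{\nu}\int_{r}^1\Big(f_1(x)-\frac{c_{f_1}^{(1)}}{r-x}\Big)dx\Big),$$ and in case 1 the last integrand is integrable on $[1,r]$. -/

import Mathlib

open MeasureTheory ProbabilityTheory Filter Topology Asymptotics

namespace PriorityRetrial

/-! ### Power series, dominant singularities and Delta-domains -/

/-- The `n`-th coefficient of the Taylor expansion at `0` of a generating function `f`
(the generating functions considered here have real coefficients). -/
noncomputable def coeff (f : ℂ → ℂ) (n : ℕ) : ℝ :=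
  (iteratedDeriv n f 0).re / (n.factorial : ℝ)

/-- The Taylor series at `0` of the generating function `f` converges at the real point `x`. -/
def ConvergesAt (f : ℂ → ℂ) (x : ℝ) : Prop :=
  Summable fun n : ℕ => coeff f n * x ^ n

/-- The value `f(x) = ∑ fₙ xⁿ` of the generating function `f` at the real point `x`, where `x` may
lie outside the unit disk (but in the closed disk of convergence). -/
noncomputable def val (f : ℂ → ℂ) (x : ℝ) : ℝ :=
  ∑' n : ℕ, coeff f n * x ^ n

/-- `R > 0` is the dominant singularity of the function `f`, given on the open unit disk: `f`
has an analytic version `F` on the disk `|z| < R`, and among the points of the circle `|z| = R`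
the point `R` is the only one across which `F` has no analytic continuation. -/
def IsDominantSingularity (f : ℂ → ℂ) (R : ℝ) : Prop :=
  0 < R ∧ ∃ F : ℂ → ℂ,
    DifferentiableOn ℂ F (Metric.ball 0 R) ∧
    (∀ z ∈ Metric.ball (0 : ℂ) R, ‖z‖ < 1 → F z = f z) ∧
    ∀ ζ : ℂ, ‖ζ‖ = R →
      ((∃ G : ℂ → ℂ, AnalyticAt ℂ G ζ ∧ ∀ᶠ z in 𝓝[Metric.ball 0 R] ζ, G z = F z) ↔ ζ ≠ (R : ℂ))

/-- The Delta-domain at `R` with outer radius `S` and angle `φ`. -/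
def deltaDomain (R S φ : ℝ) : Set ℂ :=
  {z | ‖z‖ < S ∧ z ≠ (R : ℂ) ∧ φ < |Complex.arg (z - (R : ℂ))|}

/-- `f(z) = g(z) + o(e(z))` as `z → R`: the function `f`, given on the open unit disk, has an
analytic continuation `F` to some Delta-domain at `R`, and `F - g = o(e)` as `z → R` inside this
Delta-domain. -/
def HasDeltaExpansion (f : ℂ → ℂ) (R : ℝ) (g e : ℂ → ℂ) : Prop :=
  ∃ (S φ : ℝ) (F : ℂ → ℂ), R < S ∧ 0 < φ ∧ φ < Real.pi / 2 ∧
    DifferentiableOn ℂ F (deltaDomain R S φ) ∧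
    (∀ z ∈ deltaDomain R S φ, ‖z‖ < 1 → F z = f z) ∧
    (fun z => F z - g z) =o[𝓝[deltaDomain R S φ] (R : ℂ)] e

/-- `f(z) ∼ g(z)` as `z → R` in a Delta-domain at `R`. -/
def DeltaEquivalent (f : ℂ → ℂ) (R : ℝ) (g : ℂ → ℂ) : Prop :=
  HasDeltaExpansion f R g g

/-! ### The service time distribution `μ` -/

/-- The Laplace-Stieltjes transform `B*(s) = ∫ exp(-s x) dμ(x)`, at complex arguments. -/
noncomputable def lst (μ : Measure ℝ) (s : ℂ) : ℂ := complexMGF id μ (-s)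

/-- The Laplace-Stieltjes transform `B*(s) = ∫ exp(-s x) dμ(x)`, at real arguments. -/
noncomputable def lstReal (μ : Measure ℝ) (s : ℝ) : ℝ := mgf id μ (-s)

/-- `R_{B*} ∈ [0, ∞]`: the transform `B*(s)` of a law on `[0, ∞)` converges for
`Re s > -R_{B*}`, and `-R_{B*}` is its dominant singularity. -/
noncomputable def lstRadius (μ : Measure ℝ) : EReal :=
  ⨆ t ∈ integrableExpSet id μ, (t : EReal)

/-- Type-1 laws: `R_{B*} > 0` and `B*(-R_{B*}) = ∞`, that is, `B*(-t) → ∞` as `t ↑ R_{B*}`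
(with `R_{B*} = ∞` allowed). -/
def IsType1 (μ : Measure ℝ) : Prop :=
  0 < lstRadius μ ∧
    Tendsto (fun t : ℝ => lstReal μ (-t))
      (comap (fun t : ℝ => (t : EReal)) (𝓝[<] lstRadius μ)) atTop

/-! ### The generating functions; `l1`, `l2` are the arrival rates, `nu` the retrial rate -/

/-- The load `ρ = (λ₁ + λ₂) b`, with `b` the mean service time. -/
noncomputable def load (μ : Measure ℝ) (l1 l2 : ℝ) : ℝ := (l1 + l2) * ∫ x, x ∂μ

/-- For `|z| < 1`, `h(z)` is the unique root `w` in the open unit disk of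
`w = B*(λ₁(1-w) + λ₂(1-z))`. -/
noncomputable def h (μ : Measure ℝ) (l1 l2 : ℝ) (z : ℂ) : ℂ :=
  Classical.epsilon fun w : ℂ =>
    ‖w‖ < 1 ∧ w = lst μ ((l1 : ℂ) * (1 - w) + (l2 : ℂ) * (1 - z))

/-- `f₁(z) = (1 - h(z)) / (h(z) - z)` for `|z| < 1`. -/
noncomputable def f1 (μ : Measure ℝ) (l1 l2 : ℝ) (z : ℂ) : ℂ :=
  (1 - h μ l1 l2 z) / (h μ l1 l2 z - z)

/-- `Q(z) = (1 - ρ) exp(-(λ/ν) ∫_z^1 f₁(x) dx)` for `|z| < 1`, the integral being taken along the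
segment from `z` to `1`. -/
noncomputable def Q (μ : Measure ℝ) (l1 l2 nu : ℝ) (z : ℂ) : ℂ :=
  (1 - (load μ l1 l2 : ℂ)) *
    Complex.exp (-(((l1 + l2) / nu : ℝ) : ℂ) *
      ∫ t in (0 : ℝ)..1, f1 μ l1 l2 (z + (t : ℂ) * (1 - z)) * (1 - z))

/-- `R(z) = Q(z) (λ/λ₂) (1 - h(z)) / (h(z) - z)` for `|z| < 1`. -/
noncomputable def R (μ : Measure ℝ) (l1 l2 nu : ℝ) (z : ℂ) : ℂ :=
  Q μ l1 l2 nu z * (((l1 + l2) / l2 : ℝ) : ℂ) * f1 μ l1 l2 z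

/-- `P₂(z) = Q(z) + R(z)`. -/
noncomputable def P2 (μ : Measure ℝ) (l1 l2 nu : ℝ) (z : ℂ) : ℂ :=
  Q μ l1 l2 nu z + R μ l1 l2 nu z

/-! ### The zero `R*` and the constants -/

/-- The zeros larger than `1` of `h(z) - z`, where `Rh` is the dominant singularity of `h`;
`R*` is the smallest one, if any. -/
def zerosAboveOne (μ : Measure ℝ) (l1 l2 Rh : ℝ) : Set ℝ :=
  {x | 1 < x ∧ x ≤ Rh ∧ val (h μ l1 l2) x - x = 0}

/-- `f₁` at real points in the closed disk of convergence of `h`, possibly larger than `1`. -/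
noncomputable def f1Real (μ : Measure ℝ) (l1 l2 x : ℝ) : ℝ :=
  (1 - val (h μ l1 l2) x) / (val (h μ l1 l2) x - x)

/-- The constant `c_h`; `Rh` is the dominant singularity of `h`. -/
noncomputable def ch (μ : Measure ℝ) (l1 l2 Rh : ℝ) : ℝ :=
  Real.sqrt (2 * l2 / (l1 ^ 3 *
    iteratedDeriv 2 (lstReal μ) (l1 * (1 - val (h μ l1 l2) Rh) + l2 * (1 - Rh))))

/-- The constant `c_{f₁}^{(1)}`, with `r = R*`. -/
noncomputable def cf1 (μ : Measure ℝ) (l1 l2 r : ℝ) : ℝ :=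
  (1 - r) * (1 + l1 * deriv (lstReal μ) ((l1 + l2) * (1 - r))) /
    (1 + (l1 + l2) * deriv (lstReal μ) ((l1 + l2) * (1 - r)))

/-- The constant `c_{f₁}^{(2)}`, with `r = R_h`. -/
noncomputable def cf2 (μ : Measure ℝ) (l1 l2 r : ℝ) : ℝ :=
  (r - 1) / (val (h μ l1 l2) r - r) ^ 2 * ch μ l1 l2 r

/-- The constant `c_{f₁}^{(3)}`, with `r = R* = R_h`. -/
noncomputable def cf3 (μ : Measure ℝ) (l1 l2 r : ℝ) : ℝ :=
  (r - 1) / ch μ l1 l2 r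

/-- The function integrated in the constant `c_Q^{(1)}`, with `r = R*`. -/
noncomputable def cQ1Integrand (μ : Measure ℝ) (l1 l2 r x : ℝ) : ℝ :=
  f1Real μ l1 l2 x - cf1 μ l1 l2 r / (r - x)

/-- The constant `c_Q^{(1)}`, with `r = R*`. -/
noncomputable def cQ1 (μ : Measure ℝ) (l1 l2 nu r : ℝ) : ℝ :=
  (1 - load μ l1 l2) * (r - 1) ^ ((l1 + l2) / nu * cf1 μ l1 l2 r) *
    Real.exp (-((l1 + l2) / nu) * ∫ x in r..1, cQ1Integrand μ l1 l2 r x)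

/-- Leading term in the first case (`r = R* < R_h`):
`(λ/λ₂) c_Q^{(1)} c_{f₁}^{(1)} (r - z)^{-1 - (λ/ν) c_{f₁}^{(1)}}`. -/
noncomputable def term1 (μ : Measure ℝ) (l1 l2 nu r : ℝ) (z : ℂ) : ℂ :=
  (((l1 + l2) / l2 * cQ1 μ l1 l2 nu r * cf1 μ l1 l2 r : ℝ) : ℂ) *
    ((r : ℂ) - z) ^ ((-1 - (l1 + l2) / nu * cf1 μ l1 l2 r : ℝ) : ℂ)

/-- Singular term in the second case (`r = R_h`, no `R*`):
`(λ/λ₂) c_{f₁}^{(2)} Q(r) (r - z)^{1/2}`. -/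
noncomputable def term2 (μ : Measure ℝ) (l1 l2 nu r : ℝ) (z : ℂ) : ℂ :=
  (((l1 + l2) / l2 * cf2 μ l1 l2 r * val (Q μ l1 l2 nu) r : ℝ) : ℂ) *
    ((r : ℂ) - z) ^ (1 / 2 : ℂ)

/-- Leading term in the third case (`r = R* = R_h`):
`(λ/λ₂) c_{f₁}^{(3)} Q(r) / (r - z)^{1/2}`. -/
noncomputable def term3 (μ : Measure ℝ) (l1 l2 nu r : ℝ) (z : ℂ) : ℂ :=
  (((l1 + l2) / l2 * (cf3 μ l1 l2 r * val (Q μ l1 l2 nu) r) : ℝ) : ℂ) /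
    ((r : ℂ) - z) ^ (1 / 2 : ℂ)

end PriorityRetrial

/-! Put u = λ₁h(z) + λ₂z and A(u) = B*(λ - u). The equation for h becomes u = λ₂z + λ₁A(u) with h =
A(u), so u is an inverse of the explicit function ψ(u) = (u - λ₁A(u))/λ₂. On the real line ψ
increases up to the point τ where λ₁A'(τ) = 1; type 1 ensures that τ lies inside the domain of A,
and R_h = ψ(τ). Since A is the transform of a positive measure, |A'(u)| ≤ A'(Re u), so u ↦ λ₁A(u)
strictly contracts distances on |u| ≤ τ. This gives a unique root for every |z| ≤ R_h
(`exists_root`, `root_unique`), and Re u < τ unless z = R_h (`u_re_lt`). Hence ψ' ≠ 0 at every other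
root and u continues across the rest of the circle (`exists_continuation_u`), while the
nondegenerate critical point of ψ at τ makes u an analytic function of (R_h - z)^{1/2} near R_h
(`exists_sqrt_expansion`).

For f₁, let D be the divided difference of A at λ, where A(λ) = 1. Then λ₂(h - z) = (u - λ)(λD(u) -
1) and f₁ = λ₂D(u)/(1 - λD(u)), which also removes the singularity at z = 1. On the real line D is a
strictly increasing function d, |D(u)| ≤ d(Re u), and λd(λ) = ρ < 1. So the zeros of h(x) - x in (1,
R_h] are the points ψ(t) with λd(t) = 1; there is at most one, and the sign of λd(τ) - 1 decides
between the three cases. With t this solution, or t = τ if there is none, r = ψ(t) is the only point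
of |z| ≤ r where 1 - λD(u) can vanish or u can fail to continue.

Q is the exponential of a primitive of f₁. A simple pole of f₁ turns into a power of r - z
(`exists_Q_cpow`). In the variable s = (r - z)^{1/2}, dz = -2s ds cancels a singularity 1/s, so Q is
analytic in s when r = R_h (`exists_Q_sqrt`).

All Taylor coefficients are nonnegative (`nonnegCoeff_u_comp`, `nonnegCoeff_F1`, `nonnegCoeff_Q`).
This yields the values of the series at r by Abel's theorem and the blow-up of R and P₂ along the
real axis at a zero of h(x) - x. Finally the local expansion at r and the continuations across the
other boundary points are glued to one function on a larger slit disk (`exists_slit_extension`),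
which contains a Delta-domain. -/

namespace RetrialAnalysis

open Metric

/-! ### Continuation across boundary points of a disk -/

/-- `F`, given on the disk `|z| < R`, has an analytic continuation across `ζ`. -/
def Continues (F : ℂ → ℂ) (R : ℝ) (ζ : ℂ) : Prop :=
  ∃ G : ℂ → ℂ, AnalyticAt ℂ G ζ ∧ ∀ᶠ z in 𝓝[ball 0 R] ζ, G z = F z

theorem Continues.of_analyticAt {F : ℂ → ℂ} {R : ℝ} {ζ : ℂ} (hF : AnalyticAt ℂ F ζ) :
    Continues F R ζ :=
  ⟨F, hF, Eventually.of_forall fun _ => rfl⟩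

theorem Continues.add {F₁ F₂ : ℂ → ℂ} {R : ℝ} {ζ : ℂ} (h₁ : Continues F₁ R ζ)
    (h₂ : Continues F₂ R ζ) : Continues (fun z => F₁ z + F₂ z) R ζ := by
  obtain ⟨G₁, hG₁, e₁⟩ := h₁
  obtain ⟨G₂, hG₂, e₂⟩ := h₂
  refine ⟨fun z => G₁ z + G₂ z, hG₁.add hG₂, ?_⟩
  filter_upwards [e₁, e₂] with z h1 h2
  rw [h1, h2]

theorem Continues.mul {F₁ F₂ : ℂ → ℂ} {R : ℝ} {ζ : ℂ} (h₁ : Continues F₁ R ζ)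
    (h₂ : Continues F₂ R ζ) : Continues (fun z => F₁ z * F₂ z) R ζ := by
  obtain ⟨G₁, hG₁, e₁⟩ := h₁
  obtain ⟨G₂, hG₂, e₂⟩ := h₂
  refine ⟨fun z => G₁ z * G₂ z, hG₁.mul hG₂, ?_⟩
  filter_upwards [e₁, e₂] with z h1 h2
  rw [h1, h2]

theorem Continues.const_mul {F : ℂ → ℂ} {R : ℝ} {ζ : ℂ} (c : ℂ) (h : Continues F R ζ) :
    Continues (fun z => c * F z) R ζ :=
  (Continues.of_analyticAt analyticAt_const).mul h

/-- Two primitives of the same function on a preconnected open set differ by a constant. -/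
theorem exists_primitive_eq_add_const {s : Set ℂ} (hs : IsOpen s) (hs' : IsPreconnected s)
    {P P' f : ℂ → ℂ} (hP : ∀ z ∈ s, HasDerivAt P (f z) z) (hP' : ∀ z ∈ s, HasDerivAt P' (f z) z) :
    ∃ c, ∀ z ∈ s, P z = P' z + c := by
  have hd : ∀ z ∈ s, HasDerivAt (fun z => P z - P' z) 0 z := fun z hz => by
    simpa using! (hP z hz).sub (hP' z hz)
  obtain ⟨c, hc⟩ := hs.exists_is_const_of_deriv_eq_zero hs'
    (fun z hz => (hd z hz).differentiableAt.differentiableWithinAt) (fun z hz => (hd z hz).deriv)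
  exact ⟨c, fun z hz => by rw [← hc z hz]; ring⟩

/-- The continuation of F has a primitive on a small disk around ζ. It differs from P by a constant
on the intersection of the two disks, which is convex and hence connected. -/
theorem Continues.primitive {F P : ℂ → ℂ} {R : ℝ} {ζ : ℂ} (hF : Continues F R ζ)
    (hP : ∀ z ∈ ball (0 : ℂ) R, HasDerivAt P (F z) z) : Continues P R ζ := by
  obtain ⟨G, hG, e⟩ := hF
  obtain ⟨δ₁, hδ₁, hd⟩ := Metric.eventually_nhds_iff_ball.1 hG.eventually_analyticAt
  obtain ⟨δ₂, hδ₂, he⟩ := Metric.eventually_nhds_iff_ball.1 (eventually_nhdsWithin_iff.1 e)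
  set δ := min δ₁ δ₂
  have hδ : 0 < δ := lt_min hδ₁ hδ₂
  have hdiff : DifferentiableOn ℂ G (ball ζ δ) := fun z hz =>
    (hd z (ball_subset_ball (min_le_left _ _) hz)).differentiableAt.differentiableWithinAt
  obtain ⟨PG, hPG⟩ := hdiff.isExactOn_ball
  have hc : Convex ℝ (ball ζ δ ∩ ball (0 : ℂ) R) := (convex_ball _ _).inter (convex_ball _ _)
  obtain ⟨c, hc⟩ := exists_primitive_eq_add_const (isOpen_ball.inter isOpen_ball)
    hc.isPreconnected (P := P) (P' := PG) (f := F) (fun z hz => hP z hz.2) (fun z hz => by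
      rw [← he z (ball_subset_ball (min_le_right _ _) hz.1) hz.2]
      exact hPG z hz.1)
  refine ⟨fun z => PG z + c, ?_, ?_⟩
  · refine AnalyticAt.add ?_ analyticAt_const
    have : DifferentiableOn ℂ PG (ball ζ δ) := fun z hz =>
      (hPG z hz).differentiableAt.differentiableWithinAt
    exact this.analyticAt (ball_mem_nhds _ hδ)
  · filter_upwards [self_mem_nhdsWithin, mem_nhdsWithin_of_mem_nhds (ball_mem_nhds ζ hδ)]
      with z hz hz'
    exact (hc z ⟨hz', hz⟩).symm

theorem tendsto_ofReal_nhdsLT_nhdsWithin_ball {R : ℝ} (hR : 0 < R) :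
    Tendsto (fun x : ℝ => (x : ℂ)) (𝓝[<] R) (𝓝[ball 0 R] (R : ℂ)) := by
  refine tendsto_nhdsWithin_iff.2 ⟨?_, ?_⟩
  · exact (Complex.continuous_ofReal.tendsto R).mono_left nhdsWithin_le_nhds
  · filter_upwards [self_mem_nhdsWithin, mem_nhdsWithin_of_mem_nhds (lt_mem_nhds hR)] with x hx hx0
    rw [mem_ball_zero_iff, Complex.norm_real, Real.norm_of_nonneg (le_of_lt hx0)]
    exact hx

/-- A continuation would be continuous at R, so F would have a finite limit along the real axis. -/
theorem not_continues_of_tendsto_norm_atTop {F : ℂ → ℂ} {R : ℝ} (hR : 0 < R)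
    (hF : Tendsto (fun x : ℝ => ‖F x‖) (𝓝[<] R) atTop) : ¬ Continues F R R := by
  rintro ⟨G, hG, e⟩
  have h1 : Tendsto (fun x : ℝ => ‖G x‖) (𝓝[<] R) (𝓝 ‖G R‖) :=
    (hG.continuousAt.norm.tendsto).comp
      ((tendsto_ofReal_nhdsLT_nhdsWithin_ball hR).mono_right nhdsWithin_le_nhds)
  have h2 : Tendsto (fun x : ℝ => ‖F x‖) (𝓝[<] R) (𝓝 ‖G R‖) := by
    refine h1.congr' ?_
    filter_upwards [(tendsto_ofReal_nhdsLT_nhdsWithin_ball hR).eventually e] with x hx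
    rw [hx]
  exact not_tendsto_nhds_of_tendsto_atTop hF _ h2

/-! ### The square root `(R - z)^{1/2}` -/

/-- The principal square root of `R - z`. -/
noncomputable def rt (R : ℝ) (z : ℂ) : ℂ := ((R : ℂ) - z) ^ (1 / 2 : ℂ)

theorem rt_sq (R : ℝ) (z : ℂ) : rt R z ^ 2 = R - z := by
  rw [rt, ← Complex.cpow_nat_mul]
  norm_num

theorem rt_ofReal {R x : ℝ} (hx : x ≤ R) : rt R x = (√(R - x) : ℝ) := by
  rw [rt, Real.sqrt_eq_rpow, Complex.ofReal_cpow (by linarith)]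
  push_cast
  rfl

theorem rt_ne_zero {R : ℝ} {z : ℂ} (hz : z ≠ R) : rt R z ≠ 0 := by
  intro h
  have := rt_sq R z
  rw [h] at this
  exact hz (by linear_combination this)

theorem tendsto_rt (R : ℝ) : Tendsto (rt R) (𝓝 (R : ℂ)) (𝓝 0) := by
  rw [tendsto_zero_iff_norm_tendsto_zero]
  have h : ∀ z, ‖rt R z‖ = √‖(R : ℂ) - z‖ := fun z => by
    rw [← rt_sq, norm_pow, Real.sqrt_sq (norm_nonneg _)]
  simp_rw [h]
  have : Continuous fun z : ℂ => √‖(R : ℂ) - z‖ := by fun_prop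
  simpa using this.tendsto R

/-- The plane slit along `[R, ∞)`. -/
def slit (R : ℝ) : Set ℂ := {z | (R : ℂ) - z ∈ Complex.slitPlane}

theorem mem_slit_of_norm_lt {R : ℝ} {z : ℂ} (hz : ‖z‖ < R) : z ∈ slit R := by
  left
  have := (Complex.re_le_norm z).trans_lt hz
  simpa using this

theorem ball_subset_slit (R : ℝ) : ball (0 : ℂ) R ⊆ slit R := fun _ hz =>
  mem_slit_of_norm_lt (mem_ball_zero_iff.1 hz)

theorem ne_of_mem_slit {R : ℝ} {z : ℂ} (hz : z ∈ slit R) : z ≠ R := by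
  rintro rfl
  have h : (R : ℂ) - R ∈ Complex.slitPlane := hz
  simp [Complex.slitPlane] at h

theorem hasDerivAt_cpow_sub {R : ℝ} {z : ℂ} (hz : z ∈ slit R) (c : ℂ) :
    HasDerivAt (fun z : ℂ => ((R : ℂ) - z) ^ c) (-c * ((R : ℂ) - z) ^ (c - 1)) z := by
  have h1 : HasDerivAt (fun z : ℂ => (R : ℂ) - z) (-1) z := by
    simpa using (hasDerivAt_id z).const_sub (R : ℂ)
  convert! h1.cpow_const hz using 1
  ring

theorem hasDerivAt_rt {R : ℝ} {z : ℂ} (hz : z ∈ slit R) :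
    HasDerivAt (rt R) (-(1 / (2 * rt R z))) z := by
  convert! hasDerivAt_cpow_sub hz (1 / 2 : ℂ) using 1
  have h0 : (R : ℂ) - z ≠ 0 := Complex.slitPlane_ne_zero hz
  rw [Complex.cpow_sub _ _ h0, Complex.cpow_one]
  have h1 := rt_sq R z
  have h2 := rt_ne_zero (ne_of_mem_slit hz)
  change _ = -(1 / 2) * (rt R z / _)
  rw [← h1]
  field_simp

/-- Substitute z = R - s² with real s > 0. A continuation G would give G(R - s²) = H(s), but the
left side has derivative 0 at s = 0 and the right side has derivative c. -/
theorem not_continues_of_sqrt {F H : ℂ → ℂ} {R : ℝ} (hR : 0 < R) {c : ℂ} (hc : c ≠ 0)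
    (hH : HasDerivAt H c 0) (hF : ∀ᶠ z in 𝓝[ball 0 R] (R : ℂ), F z = H (rt R z)) :
    ¬ Continues F R R := by
  rintro ⟨G, hG, e⟩
  have hs : Tendsto (fun s : ℝ => R - s ^ 2) (𝓝[>] 0) (𝓝[<] R) := by
    refine tendsto_nhdsWithin_iff.2 ⟨?_, ?_⟩
    · have : Continuous fun s : ℝ => R - s ^ 2 := by fun_prop
      simpa using (this.tendsto 0).mono_left nhdsWithin_le_nhds
    · filter_upwards [self_mem_nhdsWithin] with s hs
      have : (0 : ℝ) < s := hs
      simp only [Set.mem_Iio]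
      nlinarith
  have hev : ∀ᶠ s : ℝ in 𝓝[>] 0, G ((R : ℂ) - (s : ℂ) ^ 2) = H s := by
    filter_upwards [((tendsto_ofReal_nhdsLT_nhdsWithin_ball hR).comp hs).eventually (e.and hF),
      self_mem_nhdsWithin] with s hs hs0
    have hs0 : (0 : ℝ) < s := hs0
    have h := hs.1.trans hs.2
    simp only [Function.comp] at h
    rw [rt_ofReal (by nlinarith)] at h
    rw [show R - (R - s ^ 2) = s ^ 2 by ring, Real.sqrt_sq hs0.le] at h
    rw [← h]; push_cast; rfl
  have hG' : HasDerivAt (fun s : ℂ => G ((R : ℂ) - s ^ 2)) 0 0 := by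
    have h1 : HasDerivAt (fun s : ℂ => (R : ℂ) - s ^ 2) 0 0 := by
      simpa using ((hasDerivAt_id (0 : ℂ)).pow 2).const_sub (R : ℂ)
    have h2 : HasDerivAt G (deriv G R) ((R : ℂ) - 0 ^ 2) := by
      simpa using hG.differentiableAt.hasDerivAt
    simpa using! h2.comp (0 : ℂ) h1
  have h0 : G ((R : ℂ) - ((0 : ℝ) : ℂ) ^ 2) = H (0 : ℝ) := by
    have t1 : Tendsto (fun s : ℝ => G ((R : ℂ) - (s : ℂ) ^ 2)) (𝓝[>] 0)
        (𝓝 (G ((R : ℂ) - ((0 : ℝ) : ℂ) ^ 2))) :=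
      (hG'.continuousAt.tendsto.comp (Complex.continuous_ofReal.tendsto' 0 0 rfl)).mono_left
        nhdsWithin_le_nhds
    have t2 : Tendsto (fun s : ℝ => H s) (𝓝[>] 0) (𝓝 (H (0 : ℝ))) :=
      (hH.continuousAt.tendsto.comp (Complex.continuous_ofReal.tendsto' 0 0 rfl)).mono_left
        nhdsWithin_le_nhds
    exact tendsto_nhds_unique (t1.congr' hev) t2
  have d1 : HasDerivWithinAt (fun s : ℝ => G ((R : ℂ) - (s : ℂ) ^ 2)) 0 (Set.Ioi 0) 0 :=
    (HasDerivAt.comp_ofReal (z := 0) (by simpa using hG')).hasDerivWithinAt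
  have d2 : HasDerivWithinAt (fun s : ℝ => H s) c (Set.Ioi 0) 0 :=
    (HasDerivAt.comp_ofReal (z := 0) (by simpa using hH)).hasDerivWithinAt
  have d3 := d2.congr_of_eventuallyEq hev h0
  exact hc (UniqueDiffWithinAt.eq_deriv _ (uniqueDiffWithinAt_Ioi 0) d3 d1)

/-! ### Extension to a slit disk -/

/-- A convex open set with an analytic function that agrees with `F` on the disk `|z| < R`. -/
structure Patch (F : ℂ → ℂ) (R : ℝ) (U : Set ℂ) (H : ℂ → ℂ) : Prop where
  isOpen : IsOpen U
  convex : Convex ℝ U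
  diff : DifferentiableOn ℂ H U
  eq_of_norm_lt : ∀ z ∈ U, ‖z‖ < R → H z = F z

/-- The point p on the circle is a limit of points of the disk, so U₁ ∩ U₂ meets the disk, where
both functions equal F. The intersection is convex, and the identity theorem spreads the equality.
Without such a p the patches could meet only outside the disk. -/
theorem Patch.eq {F H₁ H₂ : ℂ → ℂ} {R : ℝ} {U₁ U₂ : Set ℂ} (h₁ : Patch F R U₁ H₁)
    (h₂ : Patch F R U₂ H₂) (hR : 0 < R) {p z : ℂ} (hp : ‖p‖ = R) (hp₁ : p ∈ U₁) (hp₂ : p ∈ U₂)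
    (hz₁ : z ∈ U₁) (hz₂ : z ∈ U₂) : H₁ z = H₂ z := by
  have hop : IsOpen (U₁ ∩ U₂) := h₁.isOpen.inter h₂.isOpen
  have hcl : p ∈ closure (ball (0 : ℂ) R) := by
    rw [closure_ball _ hR.ne']
    simp [hp]
  obtain ⟨q, hq, hqb⟩ := mem_closure_iff.1 hcl _ hop ⟨hp₁, hp₂⟩
  have hev : H₁ =ᶠ[𝓝 q] H₂ := by
    filter_upwards [hop.mem_nhds hq, isOpen_ball.mem_nhds hqb] with w hw hwb
    have hwb := mem_ball_zero_iff.1 hwb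
    rw [h₁.eq_of_norm_lt w hw.1 hwb, h₂.eq_of_norm_lt w hw.2 hwb]
  exact AnalyticOnNhd.eqOn_of_preconnected_of_eventuallyEq
    ((h₁.diff.mono Set.inter_subset_left).analyticOnNhd hop)
    ((h₂.diff.mono Set.inter_subset_right).analyticOnNhd hop)
    (h₁.convex.inter h₂.convex).isPreconnected hq hev ⟨hz₁, hz₂⟩

/-- The radial projection to the circle `|z| = R`. -/
noncomputable def radialProj (R : ℝ) (z : ℂ) : ℂ := ((R / ‖z‖ : ℝ) : ℂ) * z

theorem norm_radialProj {R : ℝ} (hR : 0 < R) {z : ℂ} (hz : z ≠ 0) : ‖radialProj R z‖ = R := by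
  have : ‖z‖ ≠ 0 := norm_ne_zero_iff.2 hz
  rw [radialProj, norm_mul, Complex.norm_real, Real.norm_of_nonneg (by positivity)]
  field_simp

theorem continuousAt_radialProj (R : ℝ) {z : ℂ} (hz : z ≠ 0) : ContinuousAt (radialProj R) z := by
  unfold radialProj
  have : ‖z‖ ≠ 0 := norm_ne_zero_iff.2 hz
  refine ContinuousAt.mul ?_ continuousAt_id
  exact Complex.continuous_ofReal.continuousAt.comp
    (continuousAt_const.div continuous_norm.continuousAt this)

theorem radialProj_of_norm_eq {R : ℝ} (hR : 0 < R) {z : ℂ} (hz : ‖z‖ = R) :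
    radialProj R z = z := by
  simp [radialProj, hz, hR.ne']

/-- A function on a disk that has an analytic continuation across all points of the boundary
circle but `R`, and to a slit neighbourhood of `R`, extends to a larger slit disk. -/
theorem exists_slit_extension {F G₀ : ℂ → ℂ} {R ε : ℝ} (hR : 0 < R) (hε : 0 < ε)
    (hF : DifferentiableOn ℂ F (ball 0 R))
    (hζ : ∀ ζ : ℂ, ‖ζ‖ = R → ζ ≠ R → Continues F R ζ)
    (hG₀ : DifferentiableOn ℂ G₀ (ball (R : ℂ) ε ∩ slit R))
    (hG₀F : ∀ z ∈ ball (R : ℂ) ε, ‖z‖ < R → G₀ z = F z) :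
    ∃ S, R < S ∧ ∃ F' : ℂ → ℂ, (∀ z ∈ slit R, ‖z‖ < S → DifferentiableAt ℂ F' z) ∧
      (∀ z, ‖z‖ < R → F' z = F z) ∧ ∀ᶠ z in 𝓝[slit R] (R : ℂ), F' z = G₀ z := by
  classical
  -- A patch may be used at z only if it also contains the radial projection of z to the circle. Two
  -- patches used at z then share a boundary point, which is what `Patch.eq` needs, so the extension
  -- does not depend on the choice of patch.
  let good : ℂ → (Set ℂ × (ℂ → ℂ)) → Prop := fun z UH =>
    Patch F R UH.1 UH.2 ∧ z ∈ UH.1 ∧ radialProj R z ∈ UH.1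
  have hne : ∀ z : ℂ, R ≤ ‖z‖ → z ≠ 0 := fun z hz h => by
    rw [h, norm_zero] at hz; linarith
  -- the patches at `R`
  have hup : ∀ σ : ℝ, σ ≠ 0 → Patch F R (ball (R : ℂ) ε ∩ {z | 0 < σ * z.im}) G₀ := by
    intro σ hσ
    refine ⟨isOpen_ball.inter (isOpen_lt continuous_const (by fun_prop)), ?_, ?_, ?_⟩
    · refine (convex_ball _ _).inter ?_
      exact convex_halfSpace_gt (f := fun z : ℂ => σ * z.im)
        ⟨fun x y => by simp [mul_add], fun c x => by simp; ring⟩ 0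
    · refine hG₀.mono fun z hz => ⟨hz.1, ?_⟩
      right
      have h2 : 0 < σ * z.im := hz.2
      simp only [Complex.sub_im, Complex.ofReal_im, zero_sub, ne_eq, neg_eq_zero]
      rintro h
      rw [h] at h2
      simp at h2
    · exact fun z hz hz' => hG₀F z hz.1 hz'
  have himproj : ∀ z : ℂ, R ≤ ‖z‖ → ∀ σ : ℝ, 0 < σ * z.im → 0 < σ * (radialProj R z).im := by
    intro z hz σ hσ
    have h0 : 0 < R / ‖z‖ := div_pos hR (hR.trans_le hz)
    have : σ * (radialProj R z).im = (R / ‖z‖) * (σ * z.im) := by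
      rw [radialProj, Complex.im_ofReal_mul]; ring
    rw [this]
    positivity
  -- Outside the disk and near R the slit removes all real points, so z lies in an open upper or
  -- lower half disk. The half disks are convex, unlike the slit disk.
  have him : ∀ z ∈ slit R, R ≤ ‖z‖ → 0 < z.re → z.im ≠ 0 := by
    intro z hz hz' hre him
    rcases hz with h | h
    · have h1 : z.re < R := by simpa using h
      have h2 : z = (z.re : ℂ) := Complex.ext rfl (by simp [him])
      rw [h2, Complex.norm_real, Real.norm_of_nonneg hre.le] at hz'
      linarith
    · exact h (by simp [him])
  have hnear : ∀ᶠ z in 𝓝 (R : ℂ), z ∈ slit R → R ≤ ‖z‖ → ∃ U, good z (U, G₀) := by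
    have hRne : (R : ℂ) ≠ 0 := by exact_mod_cast hR.ne'
    have hpR : radialProj R R = R := radialProj_of_norm_eq hR (by simp [hR.le])
    have h1 : ∀ᶠ z in 𝓝 (R : ℂ), radialProj R z ∈ ball (R : ℂ) ε :=
      (continuousAt_radialProj R hRne).eventually_mem
        (by rw [hpR]; exact ball_mem_nhds _ hε)
    have h2 : ∀ᶠ z : ℂ in 𝓝 (R : ℂ), 0 < z.re :=
      Complex.continuous_re.continuousAt.eventually (lt_mem_nhds (by simpa using hR))
    filter_upwards [h1, h2, ball_mem_nhds (R : ℂ) hε] with z hz1 hz2 hz3 hz4 hz5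
    have hi := him z hz4 hz5 hz2
    have hpos : 0 < z.im * z.im := mul_self_pos.2 hi
    exact ⟨_, hup z.im hi, ⟨hz3, hpos⟩, ⟨hz1, himproj z hz5 _ hpos⟩⟩
  -- the set covered by patches
  let W : Set ℂ := {z | ‖z‖ < R ∨ (z ∈ slit R → ∃ UH, good z UH)}
  have hW : closedBall (0 : ℂ) R ⊆ interior W := by
    intro ζ hζb
    rw [mem_interior_iff_mem_nhds]
    rcases lt_or_eq_of_le (mem_closedBall_zero_iff.1 hζb) with hlt | heq
    · filter_upwards [continuous_norm.continuousAt.eventually (gt_mem_nhds hlt)] with z hz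
      exact Or.inl hz
    · by_cases hζR : ζ = R
      · rw [hζR]
        filter_upwards [hnear] with z hz
        rcases lt_or_ge ‖z‖ R with h | h
        · exact Or.inl h
        · refine Or.inr fun hs => ?_
          obtain ⟨U, hU⟩ := hz hs h
          exact ⟨_, hU⟩
      · obtain ⟨G, hG, e⟩ := hζ ζ heq hζR
        obtain ⟨δ₁, hδ₁, hd⟩ := Metric.eventually_nhds_iff_ball.1 hG.eventually_analyticAt
        obtain ⟨δ₂, hδ₂, he⟩ := Metric.eventually_nhds_iff_ball.1 (eventually_nhdsWithin_iff.1 e)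
        have hδ : 0 < min δ₁ δ₂ := lt_min hδ₁ hδ₂
        have hpatch : Patch F R (ball ζ (min δ₁ δ₂)) G := by
          refine ⟨isOpen_ball, convex_ball _ _, fun z hz => ?_, fun z hz hz' => ?_⟩
          · exact (hd z (ball_subset_ball (min_le_left _ _) hz)).differentiableAt
              |>.differentiableWithinAt
          · exact he z (ball_subset_ball (min_le_right _ _) hz) (mem_ball_zero_iff.2 hz')
        have hζ0 : ζ ≠ 0 := hne ζ heq.ge
        have h1 : ∀ᶠ z in 𝓝 ζ, radialProj R z ∈ ball ζ (min δ₁ δ₂) :=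
          (continuousAt_radialProj R hζ0).eventually_mem
            (by rw [radialProj_of_norm_eq hR heq]; exact ball_mem_nhds _ hδ)
        filter_upwards [h1, ball_mem_nhds ζ hδ] with z hz1 hz2
        exact Or.inr fun _ => ⟨(_, G), hpatch, hz2, hz1⟩
  -- Compactness of the closed disk turns the pointwise neighbourhoods into a uniform margin δ.
  obtain ⟨δ, hδ, hδW⟩ := (isCompact_closedBall (0 : ℂ) R).exists_thickening_subset_open
    isOpen_interior hW
  rw [thickening_closedBall hδ hR.le] at hδW
  let F' : ℂ → ℂ := fun z =>
    if ‖z‖ < R then F z else if hz : ∃ UH, good z UH then (Classical.choose hz).2 z else 0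
  have hF'lt : ∀ z, ‖z‖ < R → F' z = F z := fun z hz => if_pos hz
  have hF'eq : ∀ z U H, R ≤ ‖z‖ → good z (U, H) → F' z = H z := by
    intro z U H hz hg
    have hex : ∃ UH, good z UH := ⟨_, hg⟩
    have h1 : F' z = (Classical.choose hex).2 z := by
      simp only [F', if_neg (not_lt.2 hz), dif_pos hex]
    have h2 := Classical.choose_spec hex
    rw [h1]
    exact h2.1.eq hg.1 hR (norm_radialProj hR (hne z hz)) h2.2.2 hg.2.2 h2.2.1 hg.2.1
  refine ⟨δ + R, by linarith, F', ?_, hF'lt, ?_⟩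
  · intro z hz hzS
    rcases lt_or_ge ‖z‖ R with h | h
    · have hzb : z ∈ ball (0 : ℂ) R := mem_ball_zero_iff.2 h
      refine (hF.differentiableAt (isOpen_ball.mem_nhds hzb)).congr_of_eventuallyEq ?_
      filter_upwards [isOpen_ball.mem_nhds hzb] with w hw
      exact hF'lt w (mem_ball_zero_iff.1 hw)
    · have hzW : z ∈ W := interior_subset (hδW (mem_ball_zero_iff.2 hzS))
      obtain ⟨⟨U, H⟩, hg⟩ := hzW.resolve_left (not_lt.2 h) hz
      refine (hg.1.diff.differentiableAt (hg.1.isOpen.mem_nhds hg.2.1)).congr_of_eventuallyEq ?_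
      filter_upwards [hg.1.isOpen.mem_nhds hg.2.1,
        (continuousAt_radialProj R (hne z h)).eventually_mem (hg.1.isOpen.mem_nhds hg.2.2)]
        with w hw hw'
      rcases lt_or_ge ‖w‖ R with h' | h'
      · rw [hF'lt w h']
        exact (hg.1.eq_of_norm_lt w hw h').symm
      · exact hF'eq w U H h' ⟨hg.1, hw, hw'⟩
  · filter_upwards [self_mem_nhdsWithin, mem_nhdsWithin_of_mem_nhds hnear,
      mem_nhdsWithin_of_mem_nhds (ball_mem_nhds (R : ℂ) hε)] with z hz hz' hzb
    rcases lt_or_ge ‖z‖ R with h | h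
    · rw [hF'lt z h, hG₀F z hzb h]
    · obtain ⟨U, hU⟩ := hz' hz h
      exact hF'eq z U G₀ h hU

/-- On the removed ray z - R is a nonnegative real number, whose argument 0 does not exceed φ. -/
theorem deltaDomain_subset_slit {R S φ : ℝ} (hφ : 0 < φ) :
    PriorityRetrial.deltaDomain R S φ ⊆ slit R := by
  rintro z ⟨-, hzR, hφz⟩
  by_contra h
  have h' : ¬ ((R : ℂ) - z ∈ Complex.slitPlane) := h
  rw [Complex.mem_slitPlane_iff] at h'
  push Not at h'
  obtain ⟨h1, h2⟩ := h'
  have h3 : z - R = ((z.re - R : ℝ) : ℂ) := by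
    apply Complex.ext
    · simp
    · simpa using h2
  rw [h3, Complex.arg_ofReal_of_nonneg (by simpa using h1), abs_zero] at hφz
  linarith

/-- Local form of a relation in a Delta-domain. -/
theorem hasDeltaExpansion_of_local {f F G₀ g e : ℂ → ℂ} {R ε : ℝ} (hR : 1 < R) (hε : 0 < ε)
    (hF : DifferentiableOn ℂ F (ball 0 R)) (hFf : ∀ z, ‖z‖ < 1 → F z = f z)
    (hζ : ∀ ζ : ℂ, ‖ζ‖ = R → ζ ≠ R → Continues F R ζ)
    (hG₀ : DifferentiableOn ℂ G₀ (ball (R : ℂ) ε ∩ slit R))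
    (hG₀F : ∀ z ∈ ball (R : ℂ) ε, ‖z‖ < R → G₀ z = F z)
    (ho : (fun z => G₀ z - g z) =o[𝓝[slit R] (R : ℂ)] e) :
    PriorityRetrial.HasDeltaExpansion f R g e := by
  obtain ⟨S, hS, F', hd, hlt, hev⟩ := exists_slit_extension (by linarith) hε hF hζ hG₀ hG₀F
  -- Any angle in (0, π/2) would do: the extension lives on the whole slit disk.
  have hφ : 0 < Real.pi / 4 := by positivity
  have hsub := deltaDomain_subset_slit (R := R) (S := S) hφ
  refine ⟨S, Real.pi / 4, F', hS, hφ, by linarith [Real.pi_pos], ?_, ?_, ?_⟩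
  · exact fun z hz => (hd z (hsub hz) hz.1).differentiableWithinAt
  · exact fun z _ hz => (hlt z (by linarith)).trans (hFf z hz)
  · refine IsLittleO.mono ?_ (nhdsWithin_mono _ hsub)
    exact ho.congr' (by filter_upwards [hev] with z hz; rw [hz]) EventuallyEq.rfl

/-- A dominant singularity from continuation across all other points of the circle. -/
theorem isDominantSingularity_of_continues {f F : ℂ → ℂ} {R : ℝ} (hR : 0 < R)
    (hF : DifferentiableOn ℂ F (ball 0 R)) (hFf : ∀ z, ‖z‖ < 1 → F z = f z)
    (hζ : ∀ ζ : ℂ, ‖ζ‖ = R → ζ ≠ R → Continues F R ζ) (hRR : ¬ Continues F R R) :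
    PriorityRetrial.IsDominantSingularity f R := by
  refine ⟨hR, F, hF, fun z _ hz => hFf z hz, fun ζ h => ⟨?_, fun hne => hζ ζ h hne⟩⟩
  rintro hc rfl
  exact hRR hc

open scoped ComplexOrder

/-! ### Nonnegative Taylor coefficients -/

/-- The Taylor coefficients of `f` at `0` up to the order `N` are real and nonnegative. -/
def NonnegCoeff (f : ℂ → ℂ) (N : ℕ) : Prop := ∀ n ≤ N, 0 ≤ iteratedDeriv n f 0

theorem NonnegCoeff.congr {f g : ℂ → ℂ} {N : ℕ} (hf : NonnegCoeff f N) (h : f =ᶠ[𝓝 0] g) :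
    NonnegCoeff g N := fun n hn => by
  rw [← h.iteratedDeriv_eq n]
  exact hf n hn

theorem NonnegCoeff.mono {f : ℂ → ℂ} {N M : ℕ} (hf : NonnegCoeff f N) (h : M ≤ N) :
    NonnegCoeff f M := fun n hn => hf n (hn.trans h)

theorem nonnegCoeff_const {c : ℂ} (hc : 0 ≤ c) (N : ℕ) : NonnegCoeff (fun _ => c) N := by
  intro n _
  rw [iteratedDeriv_const]
  split_ifs
  · exact hc
  · exact le_rfl

theorem nonnegCoeff_of_deriv {f : ℂ → ℂ} {N : ℕ} (h0 : 0 ≤ f 0) (h : NonnegCoeff (deriv f) N) :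
    NonnegCoeff f (N + 1) := by
  intro n hn
  cases n with
  | zero => simpa using h0
  | succ n => rw [iteratedDeriv_succ']; exact h n (by omega)

theorem NonnegCoeff.add {f g : ℂ → ℂ} {N : ℕ} (hf : NonnegCoeff f N) (hg : NonnegCoeff g N)
    (af : AnalyticAt ℂ f 0) (ag : AnalyticAt ℂ g 0) : NonnegCoeff (fun z => f z + g z) N := by
  intro n hn
  rw [iteratedDeriv_fun_add af.contDiffAt ag.contDiffAt]
  exact add_nonneg (hf n hn) (hg n hn)

theorem NonnegCoeff.mul {f g : ℂ → ℂ} {N : ℕ} (hf : NonnegCoeff f N) (hg : NonnegCoeff g N)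
    (af : AnalyticAt ℂ f 0) (ag : AnalyticAt ℂ g 0) : NonnegCoeff (fun z => f z * g z) N := by
  intro n hn
  rw [iteratedDeriv_fun_mul af.contDiffAt ag.contDiffAt]
  refine Finset.sum_nonneg fun i hi => ?_
  have hi := Finset.mem_range.1 hi
  exact mul_nonneg (mul_nonneg (by positivity) (hf i (by omega))) (hg (n - i) (by omega))

theorem NonnegCoeff.const_mul {f : ℂ → ℂ} {N : ℕ} {c : ℂ} (hc : 0 ≤ c) (hf : NonnegCoeff f N)
    (af : AnalyticAt ℂ f 0) : NonnegCoeff (fun z => c * f z) N :=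
  (nonnegCoeff_const hc N).mul hf analyticAt_const af

/-- If `G = p + g G` with nonnegative coefficients of `p` and `g` and `g(0) < 1`, then `G` has
nonnegative coefficients. -/
theorem nonnegCoeff_of_eq_add_mul {G p g : ℂ → ℂ} {N : ℕ} (hp : NonnegCoeff p N)
    (hg : NonnegCoeff g N) (hg0 : g 0 < 1) (aG : AnalyticAt ℂ G 0) (ap : AnalyticAt ℂ p 0)
    (ag : AnalyticAt ℂ g 0) (h : G =ᶠ[𝓝 0] fun z => p z + g z * G z) : NonnegCoeff G N := by
  intro n
  induction n using Nat.strong_induction_on with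
  | _ n ih =>
    intro hn
    have e := h.iteratedDeriv_eq n
    have agG : AnalyticAt ℂ (fun z => g z * G z) 0 := ag.mul aG
    rw [iteratedDeriv_fun_add ap.contDiffAt agG.contDiffAt,
      iteratedDeriv_fun_mul ag.contDiffAt aG.contDiffAt, Finset.sum_range_succ'] at e
    have hs : 0 ≤ ∑ k ∈ Finset.range n, (n.choose (k + 1) : ℂ) * iteratedDeriv (k + 1) g 0 *
        iteratedDeriv (n - (k + 1)) G 0 := by
      refine Finset.sum_nonneg fun i hi => ?_
      have hi := Finset.mem_range.1 hi
      exact mul_nonneg (mul_nonneg (by positivity) (hg _ (by omega)))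
        (ih _ (by omega) (by omega))
    simp only [Nat.choose_zero_right, Nat.cast_one, iteratedDeriv_zero, one_mul,
      Nat.sub_zero] at e
    have h1 : 0 < 1 - g 0 := sub_pos.2 hg0
    -- In the Leibniz formula the term with the undifferentiated g contains G⁽ⁿ⁾(0) itself; moved to
    -- the left it gives the factor 1 - g(0), and only lower derivatives of G remain.
    have e' : iteratedDeriv n G 0 = (iteratedDeriv n p 0 +
        ∑ k ∈ Finset.range n, (n.choose (k + 1) : ℂ) * iteratedDeriv (k + 1) g 0 *
        iteratedDeriv (n - (k + 1)) G 0) * (1 - g 0)⁻¹ := by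
      rw [eq_mul_inv_iff_mul_eq₀ h1.ne']
      linear_combination e
    rw [e']
    have h2 : (1 - g 0)⁻¹ = (((1 - g 0).re)⁻¹ : ℝ) := by
      have h3 : 1 - g 0 = ((1 - g 0).re : ℂ) :=
        Complex.eq_re_of_ofReal_le (r := 0) (by rw [Complex.ofReal_zero]; exact h1.le)
      rw [Complex.ofReal_inv, ← h3]
    have h4 : 0 ≤ (1 - g 0)⁻¹ := by
      rw [h2]
      exact_mod_cast inv_nonneg.2 (Complex.nonneg_iff.1 h1.le).1
    exact mul_nonneg (add_nonneg (hp n hn) hs) h4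

/-- A solution of `G' = g G` has nonnegative coefficients if `G(0)` and those of `g` are. -/
theorem nonnegCoeff_of_deriv_eq_mul {G g : ℂ → ℂ} (hg : ∀ N, NonnegCoeff g N) (hG0 : 0 ≤ G 0)
    (aG : AnalyticAt ℂ G 0) (ag : AnalyticAt ℂ g 0) (h : deriv G =ᶠ[𝓝 0] fun z => g z * G z)
    (N : ℕ) : NonnegCoeff G N := by
  induction N with
  | zero => intro n hn; obtain rfl := Nat.le_zero.1 hn; simpa using hG0
  | succ N ih => exact nonnegCoeff_of_deriv hG0 (((hg N).mul ih ag aG).congr h.symm)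

/-! ### Values of power series with nonnegative coefficients -/

theorem coeff_congr {f g : ℂ → ℂ} (h : f =ᶠ[𝓝 0] g) (n : ℕ) :
    PriorityRetrial.coeff f n = PriorityRetrial.coeff g n := by
  rw [PriorityRetrial.coeff, PriorityRetrial.coeff, h.iteratedDeriv_eq n]

theorem coeff_nonneg {f : ℂ → ℂ} (h : ∀ N, NonnegCoeff f N) (n : ℕ) :
    0 ≤ PriorityRetrial.coeff f n :=
  div_nonneg (Complex.nonneg_iff.1 (h n n le_rfl)).1 (by positivity)

/-- `0 ≤ c` in the complex order forces c to be real, so the real part taken in `coeff` loses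
nothing. -/
theorem hasSum_coeff_complex {f : ℂ → ℂ} {r x : ℝ} (hf : DifferentiableOn ℂ f (ball 0 r))
    (h : ∀ N, NonnegCoeff f N) (hx : 0 ≤ x) (hxr : x < r) :
    HasSum (fun n => ((PriorityRetrial.coeff f n * x ^ n : ℝ) : ℂ)) (f x) := by
  have hxb : (x : ℂ) ∈ ball (0 : ℂ) r := by
    rw [mem_ball_zero_iff, Complex.norm_real, Real.norm_of_nonneg hx]; exact hxr
  refine (Complex.hasSum_taylorSeries_on_ball hf hxb).congr_fun fun n => ?_
  have h1 : iteratedDeriv n f 0 = ((iteratedDeriv n f 0).re : ℂ) :=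
    Complex.eq_re_of_ofReal_le (r := 0) (by simpa using h n n le_rfl)
  rw [PriorityRetrial.coeff, h1]
  push_cast
  simp only [Complex.ofReal_re, sub_zero, smul_eq_mul]
  ring

theorem hasSum_coeff {f : ℂ → ℂ} {r x : ℝ} (hf : DifferentiableOn ℂ f (ball 0 r))
    (h : ∀ N, NonnegCoeff f N) (hx : 0 ≤ x) (hxr : x < r) :
    HasSum (fun n => PriorityRetrial.coeff f n * x ^ n) (f x).re := by
  have := Complex.hasSum_re (hasSum_coeff_complex hf h hx hxr)
  simpa only [Complex.ofReal_re] using this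

theorem eq_ofReal_of_nonnegCoeff {f : ℂ → ℂ} {r x : ℝ} (hf : DifferentiableOn ℂ f (ball 0 r))
    (h : ∀ N, NonnegCoeff f N) (hx : 0 ≤ x) (hxr : x < r) : f x = ((f x).re : ℂ) := by
  have h1 := (hasSum_coeff_complex hf h hx hxr).unique
    (Complex.hasSum_ofReal.2 (hasSum_coeff hf h hx hxr))
  exact h1

theorem re_nonneg_of_nonnegCoeff {f : ℂ → ℂ} {r x : ℝ} (hf : DifferentiableOn ℂ f (ball 0 r))
    (h : ∀ N, NonnegCoeff f N) (hx : 0 ≤ x) (hxr : x < r) : 0 ≤ (f x).re :=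
  (hasSum_coeff hf h hx hxr).nonneg fun n => mul_nonneg (coeff_nonneg h n) (by positivity)

theorem val_eq_re {f : ℂ → ℂ} {r x : ℝ} (hf : DifferentiableOn ℂ f (ball 0 r))
    (h : ∀ N, NonnegCoeff f N) (hx : 0 ≤ x) (hxr : x < r) : PriorityRetrial.val f x = (f x).re :=
  (hasSum_coeff hf h hx hxr).tsum_eq

/-- Abel's theorem for nonnegative coefficients. -/
theorem hasSum_coeff_of_tendsto {f : ℂ → ℂ} {r L : ℝ} (hr : 0 < r)
    (hf : DifferentiableOn ℂ f (ball 0 r)) (h : ∀ N, NonnegCoeff f N)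
    (hL : Tendsto (fun x : ℝ => (f x).re) (𝓝[<] r) (𝓝 L)) :
    HasSum (fun n => PriorityRetrial.coeff f n * r ^ n) L := by
  have h0 : ∀ᶠ x : ℝ in 𝓝[<] r, 0 ≤ x ∧ x < r := by
    filter_upwards [self_mem_nhdsWithin, mem_nhdsWithin_of_mem_nhds (lt_mem_nhds hr)] with x hx hx'
    exact ⟨le_of_lt hx', hx⟩
  have hterm : ∀ n, 0 ≤ PriorityRetrial.coeff f n * r ^ n := fun n =>
    mul_nonneg (coeff_nonneg h n) (by positivity)
  -- A finite partial sum passes to the limit x ↑ r and is at most the full sum f(x) for each x.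
  -- Conversely each f(x) is at most the series at r by monotonicity of xⁿ.
  have hpart : ∀ s : Finset ℕ, ∑ n ∈ s, PriorityRetrial.coeff f n * r ^ n ≤ L := by
    intro s
    have h1 : Tendsto (fun x : ℝ => ∑ n ∈ s, PriorityRetrial.coeff f n * x ^ n) (𝓝[<] r)
        (𝓝 (∑ n ∈ s, PriorityRetrial.coeff f n * r ^ n)) := by
      have : Continuous fun x : ℝ => ∑ n ∈ s, PriorityRetrial.coeff f n * x ^ n := by fun_prop
      exact (this.tendsto r).mono_left nhdsWithin_le_nhds
    refine le_of_tendsto_of_tendsto h1 hL ?_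
    filter_upwards [h0] with x hx
    exact sum_le_hasSum _ (fun n _ => mul_nonneg (coeff_nonneg h n) (pow_nonneg hx.1 n))
      (hasSum_coeff hf h hx.1 hx.2)
  have hsum : Summable fun n => PriorityRetrial.coeff f n * r ^ n :=
    summable_of_sum_le hterm hpart
  have hle : ∑' n, PriorityRetrial.coeff f n * r ^ n ≤ L := hsum.tsum_le_of_sum_le hpart
  have hge : L ≤ ∑' n, PriorityRetrial.coeff f n * r ^ n := by
    refine le_of_tendsto hL ?_
    filter_upwards [h0] with x hx
    refine hasSum_le (fun n => ?_) (hasSum_coeff hf h hx.1 hx.2) hsum.hasSum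
    exact mul_le_mul_of_nonneg_left (pow_le_pow_left₀ hx.1 hx.2.le n) (coeff_nonneg h n)
  rw [← le_antisymm hle hge]
  exact hsum.hasSum

/-- If `h` has nonnegative coefficients with partial sums at most `1`, then `(1 - h(z)) / (1 - z)`
has nonnegative coefficients. -/
theorem nonnegCoeff_tail {h η : ℂ → ℂ} (ah : AnalyticAt ℂ h 0) (aη : AnalyticAt ℂ η 0)
    (e : η =ᶠ[𝓝 0] fun z => (1 - h z) + z * η z) (hh : ∀ N, NonnegCoeff h N)
    (hsum : ∀ n, ∑ k ∈ Finset.range (n + 1), PriorityRetrial.coeff h k ≤ 1) (N : ℕ) :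
    NonnegCoeff η N := by
  -- Dividing by 1 - z sums coefficients: the n-th one of η is 1 minus the n-th partial sum of those
  -- of h.
  have key : ∀ n, iteratedDeriv n η 0 =
      (n.factorial : ℂ) * ((1 - ∑ k ∈ Finset.range (n + 1), PriorityRetrial.coeff h k : ℝ) : ℂ) := by
    have hc : ∀ n, iteratedDeriv n h 0 = (n.factorial : ℂ) * (PriorityRetrial.coeff h n : ℂ) := by
      intro n
      have h1 : iteratedDeriv n h 0 = ((iteratedDeriv n h 0).re : ℂ) :=
        Complex.eq_re_of_ofReal_le (r := 0) (by simpa using hh n n le_rfl)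
      have h2 : (n.factorial : ℂ) ≠ 0 := by exact_mod_cast n.factorial_ne_zero
      rw [PriorityRetrial.coeff]
      push_cast
      rw [← h1]
      field_simp
    intro n
    induction n with
    | zero =>
      have h1 := e.eq_of_nhds
      have h2 := hc 0
      simp only [iteratedDeriv_zero, Nat.factorial_zero, Nat.cast_one, one_mul] at h2
      rw [zero_mul, add_zero] at h1
      simp [h1, h2]
    | succ n ih =>
      have e1 := e.iteratedDeriv_eq (n + 1)
      have ac : AnalyticAt ℂ (fun z => 1 - h z) 0 := analyticAt_const.sub ah
      have aη' : AnalyticAt ℂ (fun z => z * η z) 0 := analyticAt_id.mul aη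
      rw [iteratedDeriv_fun_add ac.contDiffAt aη'.contDiffAt,
        iteratedDeriv_fun_mul (f := fun z : ℂ => z) analyticAt_id.contDiffAt aη.contDiffAt,
        iteratedDeriv_const_sub (by omega)] at e1
      simp only [iteratedDeriv_fun_id_zero, iteratedDeriv_neg] at e1
      rw [Finset.sum_eq_single 1 (fun i _ hi => by simp [hi]) (by simp)] at e1
      simp only [Nat.choose_one_right, if_true, mul_one, Nat.add_sub_cancel] at e1
      rw [e1, ih, hc, Finset.sum_range_succ _ (n + 1), Nat.factorial_succ]
      push_cast
      ring
  intro n _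
  rw [key n]
  exact mul_nonneg (by positivity) (by exact_mod_cast sub_nonneg.2 (hsum n))

/-- A transform `A` (with real values `a` and derivatives `a1`, `a2` on the real line), analytic on
the half plane `Re u < σ`, together with the rates `l1`, `l2` and the critical point `τ`, at which
`l1 A'(τ) = 1`. -/
structure BusyKernel where
  A : ℂ → ℂ
  a : ℝ → ℝ
  a1 : ℝ → ℝ
  a2 : ℝ → ℝ
  l1 : ℝ
  l2 : ℝ
  σ : ℝ
  τ : ℝ
  l1_pos : 0 < l1
  l2_pos : 0 < l2
  lam_lt_tau : l1 + l2 < τ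
  tau_lt : τ < σ
  diff : DifferentiableOn ℂ A {u | u.re < σ}
  iter_nonneg : ∀ (n : ℕ) (x : ℝ), x < σ → 0 ≤ iteratedDeriv n A x
  ofReal : ∀ x : ℝ, x < σ → A x = a x
  deriv_ofReal : ∀ x : ℝ, x < σ → deriv A x = a1 x
  norm_le : ∀ u : ℂ, u.re < σ → ‖A u‖ ≤ a u.re
  norm_deriv_le : ∀ u : ℂ, u.re < σ → ‖deriv A u‖ ≤ a1 u.re
  a_deriv : ∀ x < σ, HasDerivAt a (a1 x) x
  a1_deriv : ∀ x < σ, HasDerivAt a1 (a2 x) x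
  a_pos : ∀ x < σ, 0 < a x
  a1_pos : ∀ x < σ, 0 < a1 x
  a2_pos : ∀ x < σ, 0 < a2 x
  a_lam : a (l1 + l2) = 1
  a1_lam : (l1 + l2) * a1 (l1 + l2) < 1
  a1_tau : l1 * a1 τ = 1

/-! ### The kernel A: monotonicity and segment integrals of A' -/

namespace BusyKernel

variable (K : BusyKernel)

/-- The total rate. -/
def lam : ℝ := K.l1 + K.l2

theorem lam_pos : 0 < K.lam := add_pos K.l1_pos K.l2_pos

theorem lam_lt_tau' : K.lam < K.τ := K.lam_lt_tau

theorem tau_pos : 0 < K.τ := K.lam_pos.trans K.lam_lt_tau'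

theorem lam_lt_sigma : K.lam < K.σ := K.lam_lt_tau'.trans K.tau_lt

theorem isOpen_half : IsOpen {u : ℂ | u.re < K.σ} :=
  isOpen_lt Complex.continuous_re continuous_const

theorem analyticAt_A {u : ℂ} (hu : u.re < K.σ) : AnalyticAt ℂ K.A u :=
  K.diff.analyticAt (K.isOpen_half.mem_nhds hu)

theorem hasDerivAt_A {u : ℂ} (hu : u.re < K.σ) : HasDerivAt K.A (deriv K.A u) u :=
  (K.analyticAt_A hu).differentiableAt.hasDerivAt

theorem strictMonoOn_a : StrictMonoOn K.a (Set.Iio K.σ) := by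
  refine strictMonoOn_of_deriv_pos (convex_Iio _)
    (fun x hx => (K.a_deriv x hx).continuousAt.continuousWithinAt) fun x hx => ?_
  rw [interior_Iio] at hx
  rw [(K.a_deriv x hx).deriv]
  exact K.a1_pos x hx

theorem strictMonoOn_a1 : StrictMonoOn K.a1 (Set.Iio K.σ) := by
  refine strictMonoOn_of_deriv_pos (convex_Iio _)
    (fun x hx => (K.a1_deriv x hx).continuousAt.continuousWithinAt) fun x hx => ?_
  rw [interior_Iio] at hx
  rw [(K.a1_deriv x hx).deriv]
  exact K.a2_pos x hx

theorem re_segment {u v : ℂ} {s : ℝ} (hu : u.re < s) (hv : v.re < s) {t : ℝ}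
    (ht : t ∈ Set.Icc (0 : ℝ) 1) : (v + t • (u - v)).re < s := by
  have := (convex_halfSpace_re_lt s).add_smul_sub_mem (x := v) (y := u) hv hu ht
  exact this

theorem continuousOn_deriv_segment {u v : ℂ} (hu : u.re < K.σ) (hv : v.re < K.σ) :
    ContinuousOn (fun t : ℝ => deriv K.A (v + t • (u - v))) (Set.Icc 0 1) := by
  intro t ht
  have h1 : ContinuousAt (deriv K.A) (v + t • (u - v)) :=
    (K.analyticAt_A (re_segment hu hv ht)).deriv.continuousAt
  have h2 : ContinuousAt (fun t : ℝ => v + t • (u - v)) t := by fun_prop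
  exact (ContinuousAt.comp (f := fun t : ℝ => v + t • (u - v)) h1 h2).continuousWithinAt

theorem continuousOn_a1_segment {x y : ℝ} (hx : x < K.σ) (hy : y < K.σ) :
    ContinuousOn (fun t : ℝ => K.a1 (y + t * (x - y))) (Set.Icc 0 1) := by
  intro t ht
  have h0 : y + t * (x - y) < K.σ :=
    (convex_Iio K.σ).add_smul_sub_mem (x := y) (y := x) hy hx ht
  have h1 : ContinuousAt K.a1 (y + t * (x - y)) := (K.a1_deriv _ h0).continuousAt
  have h2 : ContinuousAt (fun t : ℝ => y + t * (x - y)) t := by fun_prop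
  exact (ContinuousAt.comp (f := fun t : ℝ => y + t * (x - y)) h1 h2).continuousWithinAt

theorem A_sub_A {u v : ℂ} (hu : u.re < K.σ) (hv : v.re < K.σ) :
    K.A u - K.A v = (u - v) * ∫ t in (0 : ℝ)..1, deriv K.A (v + t • (u - v)) := by
  have := intervalIntegral.integral_unitInterval_deriv_eq_sub (f := K.A) (f' := deriv K.A)
    (K.continuousOn_deriv_segment hu hv)
    fun t ht => K.hasDerivAt_A (re_segment hu hv ht)
  rw [smul_eq_mul] at this
  rw [this]
  congr 2
  ring

theorem norm_integral_deriv_le {u v : ℂ} (hu : u.re < K.σ) (hv : v.re < K.σ) :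
    ‖∫ t in (0 : ℝ)..1, deriv K.A (v + t • (u - v))‖ ≤
      ∫ t in (0 : ℝ)..1, K.a1 (v.re + t * (u.re - v.re)) := by
  refine (intervalIntegral.norm_integral_le_integral_norm zero_le_one).trans ?_
  refine intervalIntegral.integral_mono_on zero_le_one ?_ ?_ fun t ht => ?_
  · exact ((K.continuousOn_deriv_segment hu hv).norm).intervalIntegrable_of_Icc zero_le_one
  · exact (K.continuousOn_a1_segment hu hv).intervalIntegrable_of_Icc zero_le_one
  · have h := K.norm_deriv_le _ (re_segment hu hv ht)
    simpa using h

/-- The integral is the mean of the increasing function A' over a segment to the left of τ. -/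
theorem integral_a1_lt {x y : ℝ} (hx : x ≤ K.τ) (hy : y ≤ K.τ) (hxy : x < K.τ ∨ y < K.τ) :
    ∫ t in (0 : ℝ)..1, K.a1 (y + t * (x - y)) < K.a1 K.τ := by
  have hc : ∫ _ in (0 : ℝ)..1, K.a1 K.τ = K.a1 K.τ := by simp
  rw [← hc]
  have hσ := K.tau_lt
  refine intervalIntegral.integral_lt_integral_of_continuousOn_of_le_of_exists_lt zero_lt_one
    (K.continuousOn_a1_segment (hx.trans_lt hσ) (hy.trans_lt hσ)) continuousOn_const ?_ ?_
  · intro t ht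
    have h0 : y + t * (x - y) ≤ K.τ :=
      (convex_Iic K.τ).add_smul_sub_mem (x := y) (y := x) hy hx ⟨ht.1.le, ht.2⟩
    exact K.strictMonoOn_a1.monotoneOn (h0.trans_lt hσ) hσ h0
  -- The midpoint is strictly left of τ as soon as one endpoint is.
  · refine ⟨1 / 2, by norm_num, ?_⟩
    have h0 : y + 1 / 2 * (x - y) < K.τ := by
      rcases hxy with h | h <;> linarith
    exact K.strictMonoOn_a1 (h0.trans hσ) hσ h0

/-! ### The fixed point equation u = λ₂z + λ₁A(u) in the disk |u| ≤ τ -/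

theorem re_le_tau {u : ℂ} (hu : ‖u‖ ≤ K.τ) : u.re ≤ K.τ := (Complex.re_le_norm u).trans hu

theorem re_lt_sigma {u : ℂ} (hu : ‖u‖ ≤ K.τ) : u.re < K.σ := (K.re_le_tau hu).trans_lt K.tau_lt

theorem eq_ofReal_of_norm_le_re {u : ℂ} {t : ℝ} (hu : ‖u‖ ≤ t) (ht : t ≤ u.re) : u = t := by
  have h1 : u.re = t := le_antisymm ((Complex.re_le_norm u).trans hu) ht
  have h2 : |u.re| = ‖u‖ := by
    refine le_antisymm (Complex.abs_re_le_norm u) ?_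
    exact hu.trans (ht.trans (le_abs_self _))
  have h3 : u.im = 0 := Complex.abs_re_eq_norm.1 h2
  exact Complex.ext (by simp [h1]) (by simp [h3])

/-- The map `u ↦ l1 A(u)` strictly contracts distances in the disk `|u| ≤ τ`. -/
theorem norm_sub_lt {u v : ℂ} (hu : ‖u‖ ≤ K.τ) (hv : ‖v‖ ≤ K.τ) (huv : u ≠ v) :
    K.l1 * ‖K.A u - K.A v‖ < ‖u - v‖ := by
  -- The only point of the disk with real part τ is τ itself, so two distinct points cannot both
  -- have it.
  have h0 : u.re < K.τ ∨ v.re < K.τ := by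
    by_contra h
    push Not at h
    exact huv ((eq_ofReal_of_norm_le_re hu h.1).trans (eq_ofReal_of_norm_le_re hv h.2).symm)
  have h1 := (K.norm_integral_deriv_le (K.re_lt_sigma hu) (K.re_lt_sigma hv)).trans_lt
    (K.integral_a1_lt (K.re_le_tau hu) (K.re_le_tau hv) h0)
  have h2 : 0 < ‖u - v‖ := norm_pos_iff.2 (sub_ne_zero.2 huv)
  rw [K.A_sub_A (K.re_lt_sigma hu) (K.re_lt_sigma hv), norm_mul]
  calc _ < K.l1 * (‖u - v‖ * K.a1 K.τ) := by
        have := K.l1_pos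
        gcongr
    _ = (K.l1 * K.a1 K.τ) * ‖u - v‖ := by ring
    _ = ‖u - v‖ := by rw [K.a1_tau, one_mul]

/-- The map T(u) = λ₂z + λ₁A(u) sends the disk |u| ≤ s to itself because |A(u)| ≤ a(s) there. For s
= τ the contraction is strict but not uniform, since λ₁A'(τ) = 1, so Banach's theorem does not
apply. Instead |T(u) - u| is minimised over the compact disk; at a minimiser that is not fixed, T(u)
would give a smaller value. -/
theorem exists_root {s : ℝ} (hs0 : 0 ≤ s) (hs : s ≤ K.τ) {z : ℂ}
    (hz : K.l2 * ‖z‖ + K.l1 * K.a s ≤ s) :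
    ∃ u : ℂ, ‖u‖ ≤ s ∧ u = K.l2 * z + K.l1 * K.A u := by
  let T : ℂ → ℂ := fun u => K.l2 * z + K.l1 * K.A u
  have hsσ : s < K.σ := hs.trans_lt K.tau_lt
  have hre : ∀ u : ℂ, ‖u‖ ≤ s → u.re < K.σ := fun u hu => K.re_lt_sigma (hu.trans hs)
  have hT : ∀ u, ‖u‖ ≤ s → ‖T u‖ ≤ s := by
    intro u hu
    have h1 : ‖K.A u‖ ≤ K.a s := (K.norm_le u (hre u hu)).trans
      (K.strictMonoOn_a.monotoneOn (hre u hu) hsσ ((Complex.re_le_norm u).trans hu))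
    have h2 : K.l1 * ‖K.A u‖ ≤ K.l1 * K.a s := mul_le_mul_of_nonneg_left h1 K.l1_pos.le
    calc ‖T u‖ ≤ ‖(K.l2 : ℂ) * z‖ + ‖(K.l1 : ℂ) * K.A u‖ := norm_add_le _ _
      _ = K.l2 * ‖z‖ + K.l1 * ‖K.A u‖ := by
        rw [norm_mul, norm_mul, Complex.norm_real, Complex.norm_real,
          Real.norm_of_nonneg K.l1_pos.le, Real.norm_of_nonneg K.l2_pos.le]
      _ ≤ s := by linarith
  have hcont : ContinuousOn (fun u => ‖T u - u‖) (closedBall 0 s) := by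
    intro u hu
    have := (K.analyticAt_A (hre u (mem_closedBall_zero_iff.1 hu))).continuousAt
    exact ((continuousAt_const.add (continuousAt_const.mul this)).sub
      continuousAt_id).norm.continuousWithinAt
  obtain ⟨u, hu, hmin⟩ := (isCompact_closedBall (0 : ℂ) s).exists_isMinOn
    ⟨0, mem_closedBall_self hs0⟩ hcont
  have hu' := mem_closedBall_zero_iff.1 hu
  refine ⟨u, hu', ?_⟩
  by_contra hne
  have h1 : ‖T u - u‖ ≤ ‖T (T u) - T u‖ := hmin (mem_closedBall_zero_iff.2 (hT u hu'))
  have h2 := K.norm_sub_lt ((hT u hu').trans hs) (hu'.trans hs) (fun h => hne h.symm)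
  have h3 : T (T u) - T u = K.l1 * (K.A (T u) - K.A u) := by simp only [T]; ring
  rw [h3, norm_mul, Complex.norm_real, Real.norm_of_nonneg K.l1_pos.le] at h1
  linarith

theorem root_unique {u v z : ℂ} (hu : ‖u‖ ≤ K.τ) (hv : ‖v‖ ≤ K.τ)
    (eu : u = K.l2 * z + K.l1 * K.A u) (ev : v = K.l2 * z + K.l1 * K.A v) : u = v := by
  by_contra huv
  have h1 := K.norm_sub_lt hu hv huv
  have h2 : u - v = K.l1 * (K.A u - K.A v) := by linear_combination eu - ev
  have h3 := congrArg norm h2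
  rw [norm_mul, Complex.norm_real, Real.norm_of_nonneg K.l1_pos.le] at h3
  linarith

/-- The real inverse function `ψ(u) = (u - l1 A(u)) / l2`. -/
noncomputable def psi (x : ℝ) : ℝ := (x - K.l1 * K.a x) / K.l2

/-- The dominant singularity of the busy period transform. -/
noncomputable def Rh : ℝ := K.psi K.τ

theorem hasDerivAt_psi {x : ℝ} (hx : x < K.σ) :
    HasDerivAt K.psi ((1 - K.l1 * K.a1 x) / K.l2) x := by
  exact ((hasDerivAt_id x).sub ((K.a_deriv x hx).const_mul K.l1)).div_const K.l2

theorem l1_mul_a1_lt {x : ℝ} (hx : x < K.τ) : K.l1 * K.a1 x < 1 := by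
  rw [← K.a1_tau]
  exact mul_lt_mul_of_pos_left (K.strictMonoOn_a1 (hx.trans K.tau_lt) K.tau_lt hx) K.l1_pos

theorem strictMonoOn_psi : StrictMonoOn K.psi (Set.Iic K.τ) := by
  refine strictMonoOn_of_deriv_pos (convex_Iic _)
    (fun x hx => (K.hasDerivAt_psi (lt_of_le_of_lt hx K.tau_lt)).continuousAt.continuousWithinAt)
    fun x hx => ?_
  rw [interior_Iic] at hx
  rw [(K.hasDerivAt_psi (lt_trans hx K.tau_lt)).deriv]
  exact div_pos (sub_pos.2 (K.l1_mul_a1_lt hx)) K.l2_pos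

theorem psi_lam : K.psi K.lam = 1 := by
  have := K.l2_pos.ne'
  rw [psi, lam, K.a_lam]
  field_simp
  ring

theorem psi_mul (x : ℝ) : K.l2 * K.psi x + K.l1 * K.a x = x := by
  have := K.l2_pos.ne'
  rw [psi]
  field_simp
  ring

theorem one_lt_psi {t : ℝ} (h : K.lam < t) (ht : t ≤ K.τ) : 1 < K.psi t := by
  rw [← K.psi_lam]
  exact K.strictMonoOn_psi K.lam_lt_tau'.le ht h

theorem psi_le_Rh {t : ℝ} (ht : t ≤ K.τ) : K.psi t ≤ K.Rh :=
  K.strictMonoOn_psi.monotoneOn ht (Set.mem_Iic.2 le_rfl) ht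

theorem one_lt_Rh : 1 < K.Rh := K.one_lt_psi K.lam_lt_tau' le_rfl

theorem Rh_pos : 0 < K.Rh := zero_lt_one.trans K.one_lt_Rh

/-- The root `u` of `u = l2 z + l1 A(u)` in the disk `|u| ≤ τ`, for `|z| ≤ R_h`. -/
noncomputable def u (z : ℂ) : ℂ :=
  Classical.epsilon fun u : ℂ => ‖u‖ ≤ K.τ ∧ u = K.l2 * z + K.l1 * K.A u

theorem u_spec {z : ℂ} (hz : ‖z‖ ≤ K.Rh) :
    ‖K.u z‖ ≤ K.τ ∧ K.u z = K.l2 * z + K.l1 * K.A (K.u z) := by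
  refine Classical.epsilon_spec (p := fun u : ℂ => ‖u‖ ≤ K.τ ∧ u = K.l2 * z + K.l1 * K.A u) ?_
  refine K.exists_root K.tau_pos.le le_rfl ?_
  have h1 := K.psi_mul K.τ
  have h2 := mul_le_mul_of_nonneg_left hz K.l2_pos.le
  have : K.Rh = K.psi K.τ := rfl
  rw [this] at h2
  linarith

theorem u_eq_of_root {z w : ℂ} (hz : ‖z‖ ≤ K.Rh) (hw : ‖w‖ ≤ K.τ)
    (e : w = K.l2 * z + K.l1 * K.A w) : K.u z = w :=
  K.root_unique (K.u_spec hz).1 hw (K.u_spec hz).2 e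

/-- The disk |u| ≤ t already contains a root, and roots are unique in the larger disk |u| ≤ τ. -/
theorem norm_u_le {z : ℂ} {t : ℝ} (ht0 : 0 ≤ t) (ht : t ≤ K.τ) (hz : ‖z‖ ≤ K.psi t) :
    ‖K.u z‖ ≤ t := by
  have hzR := hz.trans (K.psi_le_Rh ht)
  have h1 := K.psi_mul t
  have h2 := mul_le_mul_of_nonneg_left hz K.l2_pos.le
  obtain ⟨w, hw, e⟩ := K.exists_root ht0 ht (z := z) (by linarith)
  rw [K.u_eq_of_root hzR (hw.trans ht) e]
  exact hw

theorem u_re_lt_sigma {z : ℂ} (hz : ‖z‖ ≤ K.Rh) : (K.u z).re < K.σ :=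
  K.re_lt_sigma (K.u_spec hz).1

theorem u_injOn {z w : ℂ} (hz : ‖z‖ ≤ K.Rh) (hw : ‖w‖ ≤ K.Rh) (h : K.u z = K.u w) : z = w := by
  have h1 := (K.u_spec hz).2
  have h2 := (K.u_spec hw).2
  rw [h] at h1
  have h3 : (K.l2 : ℂ) ≠ 0 := by exact_mod_cast K.l2_pos.ne'
  exact mul_left_cancel₀ h3 (by linear_combination h2 - h1)

theorem u_psi {t : ℝ} (ht0 : K.lam ≤ t) (ht : t ≤ K.τ) : K.u (K.psi t) = t := by
  have h0 := K.lam_pos.trans_le ht0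
  have h1 : 0 < K.psi t := by
    rcases ht0.eq_or_lt with rfl | h
    · rw [K.psi_lam]; exact one_pos
    · exact zero_lt_one.trans (K.one_lt_psi h ht)
  refine K.u_eq_of_root ?_ ?_ ?_
  · rw [Complex.norm_real, Real.norm_of_nonneg h1.le]
    exact K.psi_le_Rh ht
  · rw [Complex.norm_real, Real.norm_of_nonneg h0.le]
    exact ht
  · rw [K.ofReal t (ht.trans_lt K.tau_lt)]
    exact_mod_cast (K.psi_mul t).symm

/-- The intermediate value theorem for ψ on [0, τ]; y is positive because ψ(0) < 0. -/
theorem exists_u_ofReal {x : ℝ} (hx0 : 0 ≤ x) (hx : x ≤ K.Rh) :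
    ∃ y : ℝ, 0 < y ∧ y ≤ K.τ ∧ K.psi y = x ∧ K.u x = y := by
  have hc : ContinuousOn K.psi (Set.Icc 0 K.τ) := fun y hy =>
    (K.hasDerivAt_psi (hy.2.trans_lt K.tau_lt)).continuousAt.continuousWithinAt
  have h0 : K.psi 0 < 0 := by
    have h1 := K.a_pos 0 (K.tau_pos.trans K.tau_lt)
    have h2 := mul_pos K.l1_pos h1
    rw [psi]
    exact div_neg_of_neg_of_pos (by linarith) K.l2_pos
  obtain ⟨y, hy, hyx⟩ := intermediate_value_Icc K.tau_pos.le hc ⟨h0.le.trans hx0, hx⟩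
  have hy0 : 0 < y := by
    rcases hy.1.eq_or_lt with h | h
    · rw [← h] at hyx; linarith
    · exact h
  refine ⟨y, hy0, hy.2, hyx, K.u_eq_of_root ?_ ?_ ?_⟩
  · rwa [Complex.norm_real, Real.norm_of_nonneg hx0]
  · rw [Complex.norm_real, Real.norm_of_nonneg hy0.le]; exact hy.2
  · rw [K.ofReal y (hy.2.trans_lt K.tau_lt), ← hyx]
    exact_mod_cast (K.psi_mul y).symm

/-- With |u(z)| ≤ t, a real part of at least t forces u(z) = t = u(ψ(t)), and u is injective. This
singles out the positive real point on each circle |z| = ψ(t). -/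
theorem u_re_lt {z : ℂ} {t : ℝ} (ht0 : K.lam ≤ t) (ht : t ≤ K.τ) (hz : ‖z‖ ≤ K.psi t)
    (hne : z ≠ K.psi t) : (K.u z).re < t := by
  by_contra! h
  have h1 := eq_ofReal_of_norm_le_re (K.norm_u_le (K.lam_pos.le.trans ht0) ht hz) h
  rw [← K.u_psi ht0 ht] at h1
  refine hne (K.u_injOn (hz.trans (K.psi_le_Rh ht)) ?_ h1)
  rw [Complex.norm_real, Real.norm_of_nonneg ((norm_nonneg z).trans hz)]
  exact K.psi_le_Rh ht

/-- The values stay in a compact disk, and by continuity of ψ every cluster point at z₀ is a root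
for z₀, hence equals u(z₀). This covers z₀ = R_h, where the implicit function theorem fails. -/
theorem continuousOn_u : ContinuousOn K.u (closedBall 0 K.Rh) := by
  intro z₀ hz₀
  have hz₀' := mem_closedBall_zero_iff.1 hz₀
  refine (isCompact_closedBall (0 : ℂ) K.τ).tendsto_nhds_of_unique_mapClusterPt ?_ ?_
  · filter_upwards [self_mem_nhdsWithin] with z hz
    exact mem_closedBall_zero_iff.2 (K.u_spec (mem_closedBall_zero_iff.1 hz)).1
  · intro w hw hcl
    have hw' := mem_closedBall_zero_iff.1 hw
    refine (K.u_eq_of_root hz₀' hw' ?_).symm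
    have hl2 : (K.l2 : ℂ) ≠ 0 := by exact_mod_cast K.l2_pos.ne'
    let Ψ : ℂ → ℂ := fun u => (u - K.l1 * K.A u) / K.l2
    have hΨ : ContinuousAt Ψ w := by
      have := (K.analyticAt_A (K.re_lt_sigma hw')).continuousAt
      exact (continuousAt_id.sub (continuousAt_const.mul this)).div_const _
    have h1 : MapClusterPt (Ψ w) (𝓝[closedBall 0 K.Rh] z₀) (Ψ ∘ K.u) := hcl.continuousAt_comp hΨ
    have h2 : Tendsto (Ψ ∘ K.u) (𝓝[closedBall 0 K.Rh] z₀) (𝓝 z₀) := by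
      have h3 : Tendsto (fun z : ℂ => z) (𝓝[closedBall 0 K.Rh] z₀) (𝓝 z₀) :=
        tendsto_id.mono_left nhdsWithin_le_nhds
      refine h3.congr' ?_
      filter_upwards [self_mem_nhdsWithin] with z hz
      have h4 := (K.u_spec (mem_closedBall_zero_iff.1 hz)).2
      simp only [Ψ, Function.comp]
      rw [eq_div_iff hl2]
      linear_combination -h4
    have h5 : Ψ w = z₀ := by
      by_contra hne
      have := h1.neBot
      have hd := disjoint_nhds_nhds.2 hne
      have h6 : 𝓝 (Ψ w) ⊓ map (Ψ ∘ K.u) (𝓝[closedBall 0 K.Rh] z₀) ≤ ⊥ :=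
        (inf_le_inf_left _ h2).trans hd.le_bot
      exact this.ne (le_bot_iff.1 h6)
    simp only [Ψ] at h5
    rw [div_eq_iff hl2] at h5
    linear_combination h5

/-! ### Continuation of u by local inversion of ψ -/

theorem norm_deriv_lt {w : ℂ} (hw : w.re < K.τ) : K.l1 * ‖deriv K.A w‖ < 1 :=
  (mul_le_mul_of_nonneg_left (K.norm_deriv_le w (hw.trans K.tau_lt)) K.l1_pos.le).trans_lt
    (K.l1_mul_a1_lt hw)

/-- The derivative of `ψ` does not vanish to the left of `τ`. -/
theorem one_sub_deriv_ne_zero {w : ℂ} (hw : w.re < K.τ) : 1 - K.l1 * deriv K.A w ≠ 0 := by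
  intro h
  have h1 : (K.l1 : ℂ) * deriv K.A w = 1 := by linear_combination -h
  have h2 := congrArg norm h1
  rw [norm_mul, Complex.norm_real, Real.norm_of_nonneg K.l1_pos.le, norm_one] at h2
  exact (K.norm_deriv_lt hw).ne h2

/-- Since Re u(ζ) < τ, the derivative of ψ at u(ζ) is nonzero and ψ has an analytic local inverse at
ζ. Continuity of u on the closed disk keeps u(z) in the range where this inverse undoes ψ, so the
two agree. -/
theorem exists_continuation_u {ζ : ℂ} (hζ : ‖ζ‖ ≤ K.Rh) (hne : ζ ≠ K.Rh) :
    ∃ g : ℂ → ℂ, AnalyticAt ℂ g ζ ∧ g ζ = K.u ζ ∧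
      ∀ᶠ z in 𝓝[closedBall 0 K.Rh] ζ, g z = K.u z := by
  have hre : (K.u ζ).re < K.τ := K.u_re_lt K.lam_lt_tau'.le le_rfl hζ hne
  have hl2 : (K.l2 : ℂ) ≠ 0 := by exact_mod_cast K.l2_pos.ne'
  let Ψ : ℂ → ℂ := fun u => (u - K.l1 * K.A u) / K.l2
  have hA := K.analyticAt_A (hre.trans K.tau_lt)
  have hΨ : AnalyticAt ℂ Ψ (K.u ζ) :=
    (analyticAt_id.sub (analyticAt_const.mul hA)).div analyticAt_const hl2
  have hd : deriv Ψ (K.u ζ) = (1 - K.l1 * deriv K.A (K.u ζ)) / K.l2 := by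
    have h := ((hasDerivAt_id (K.u ζ)).sub
      ((K.hasDerivAt_A (hre.trans K.tau_lt)).const_mul (K.l1 : ℂ))).div_const (K.l2 : ℂ)
    exact h.deriv
  have hd0 : deriv Ψ (K.u ζ) ≠ 0 := by
    rw [hd]
    exact div_ne_zero (K.one_sub_deriv_ne_zero hre) hl2
  have hroot : ∀ z : ℂ, ‖z‖ ≤ K.Rh → Ψ (K.u z) = z := by
    intro z hz
    have h4 := (K.u_spec hz).2
    simp only [Ψ]
    rw [div_eq_iff hl2]
    linear_combination h4
  have hg := hΨ.analyticAt_localInverse hd0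
  have hleft := HasStrictDerivAt.eventually_left_inverse hΨ.hasStrictDerivAt hd0
  refine ⟨_, hroot ζ hζ ▸ hg, ?_, ?_⟩
  · have := hleft.self_of_nhds
    rwa [hroot ζ hζ] at this
  · have hcont : Tendsto K.u (𝓝[closedBall 0 K.Rh] ζ) (𝓝 (K.u ζ)) :=
      K.continuousOn_u ζ (mem_closedBall_zero_iff.2 hζ)
    filter_upwards [hcont.eventually hleft, self_mem_nhdsWithin] with z hz hzb
    rwa [hroot z (mem_closedBall_zero_iff.1 hzb)] at hz

theorem analyticAt_u {z : ℂ} (hz : ‖z‖ < K.Rh) : AnalyticAt ℂ K.u z := by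
  have hne : z ≠ K.Rh := by
    rintro rfl
    rw [Complex.norm_real, Real.norm_of_nonneg K.Rh_pos.le] at hz
    exact lt_irrefl _ hz
  obtain ⟨g, hg, -, e⟩ := K.exists_continuation_u hz.le hne
  refine hg.congr ?_
  rwa [nhdsWithin_eq_nhds.2 (closedBall_mem_nhds_of_mem (mem_ball_zero_iff.2 hz))] at e

theorem hasDerivAt_u {z : ℂ} (hz : ‖z‖ < K.Rh) (hre : (K.u z).re < K.τ) :
    HasDerivAt K.u (K.l2 / (1 - K.l1 * deriv K.A (K.u z))) z := by
  have h1 := (K.analyticAt_u hz).differentiableAt.hasDerivAt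
  have h2 : HasDerivAt (fun z => K.l2 * z + K.l1 * K.A (K.u z))
      (K.l2 + K.l1 * (deriv K.A (K.u z) * deriv K.u z)) z := by
    have h3 := (K.hasDerivAt_A (K.u_re_lt_sigma hz.le)).comp z h1
    simpa using! ((hasDerivAt_id z).const_mul (K.l2 : ℂ)).add (h3.const_mul (K.l1 : ℂ))
  have h3 : HasDerivAt K.u (K.l2 + K.l1 * (deriv K.A (K.u z) * deriv K.u z)) z := by
    refine h2.congr_of_eventuallyEq ?_
    filter_upwards [isOpen_ball.mem_nhds (mem_ball_zero_iff.2 hz)] with w hw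
    exact (K.u_spec (mem_ball_zero_iff.1 hw).le).2
  have h4 := h1.unique h3
  have h5 := K.one_sub_deriv_ne_zero hre
  convert! h1 using 1
  rw [div_eq_iff h5]
  linear_combination -h4

theorem u_re_lt_tau {z : ℂ} (hz : ‖z‖ < K.Rh) : (K.u z).re < K.τ := by
  refine K.u_re_lt K.lam_lt_tau'.le le_rfl hz.le fun h => ?_
  change z = K.Rh at h
  rw [h, Complex.norm_real, Real.norm_of_nonneg K.Rh_pos.le] at hz
  exact lt_irrefl _ hz

end BusyKernel

namespace BusyKernel

variable (K : BusyKernel)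

/-! ### Nonnegative coefficients of `u` -/

theorem norm_zero_lt_Rh : ‖(0 : ℂ)‖ < K.Rh := by simpa using K.Rh_pos

theorem analyticAt_iteratedDeriv {w : ℂ} (hw : w.re < K.σ) (k : ℕ) :
    AnalyticAt ℂ (iteratedDeriv k K.A) w := by
  induction k with
  | zero => simpa using K.analyticAt_A hw
  | succ k ih => rw [iteratedDeriv_succ]; exact ih.deriv

theorem analyticAt_iteratedDeriv_comp_u (k : ℕ) :
    AnalyticAt ℂ (fun z => iteratedDeriv k K.A (K.u z)) 0 :=
  (K.analyticAt_iteratedDeriv (K.u_re_lt_sigma K.norm_zero_lt_Rh.le) k).comp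
    (K.analyticAt_u K.norm_zero_lt_Rh)

theorem exists_u_zero : ∃ y : ℝ, 0 < y ∧ y < K.σ ∧ K.u 0 = y := by
  obtain ⟨y, hy, hyτ, -, e⟩ := K.exists_u_ofReal le_rfl K.Rh_pos.le
  exact ⟨y, hy, hyτ.trans_lt K.tau_lt, by simpa using e⟩

/-- The induction must treat u and all A⁽ᵏ⁾(u) together: u' = λ₂/(1 - λ₁A'(u)) and (A⁽ᵏ⁾(u))' =
A⁽ᵏ⁺¹⁾(u)u' each express order N + 1 through order N of the others. The quotient is handled as the
solution of G = 1 + λ₁A'(u)G. -/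
theorem nonnegCoeff_u_comp (N : ℕ) :
    NonnegCoeff K.u N ∧ ∀ k, NonnegCoeff (fun z => iteratedDeriv k K.A (K.u z)) N := by
  obtain ⟨y, hy, hyσ, e⟩ := K.exists_u_zero
  have hl1 : (0 : ℂ) ≤ K.l1 := by exact_mod_cast K.l1_pos.le
  have hl2 : (0 : ℂ) ≤ K.l2 := by exact_mod_cast K.l2_pos.le
  induction N with
  | zero =>
    refine ⟨fun n hn => ?_, fun k n hn => ?_⟩ <;> obtain rfl := Nat.le_zero.1 hn
    · simp only [iteratedDeriv_zero, e]
      exact_mod_cast hy.le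
    · simp only [iteratedDeriv_zero, e]
      exact K.iter_nonneg k y hyσ
  | succ N ih =>
    have hre : ∀ᶠ z in 𝓝 (0 : ℂ), ‖z‖ < K.Rh := continuous_norm.continuousAt.eventually
      (gt_mem_nhds K.norm_zero_lt_Rh)
    have hu0 : 0 ≤ K.u 0 := by rw [e]; exact_mod_cast hy.le
    have hdA : ∀ᶠ z in 𝓝 (0 : ℂ), 1 - K.l1 * deriv K.A (K.u z) ≠ 0 := by
      filter_upwards [hre] with z hz using K.one_sub_deriv_ne_zero (K.u_re_lt_tau hz)
    have aA := K.analyticAt_iteratedDeriv_comp_u 1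
    have nA := ih.2 1
    simp only [iteratedDeriv_one] at aA nA
    have ag : AnalyticAt ℂ (fun z => K.l1 * deriv K.A (K.u z)) 0 := analyticAt_const.mul aA
    have ng : NonnegCoeff (fun z => K.l1 * deriv K.A (K.u z)) N := nA.const_mul hl1 aA
    have aG : AnalyticAt ℂ (fun z => (1 - K.l1 * deriv K.A (K.u z))⁻¹) 0 :=
      (analyticAt_const.sub ag).inv hdA.self_of_nhds
    have hg0 : (K.l1 : ℂ) * deriv K.A (K.u 0) < 1 := by
      have h1 := K.l1_mul_a1_lt (x := y) (by
        have := K.u_re_lt_tau K.norm_zero_lt_Rh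
        rw [e] at this
        simpa using this)
      rw [e, K.deriv_ofReal y hyσ]
      exact_mod_cast h1
    have nG : NonnegCoeff (fun z => (1 - K.l1 * deriv K.A (K.u z))⁻¹) N := by
      refine nonnegCoeff_of_eq_add_mul (nonnegCoeff_const zero_le_one N) ng hg0 aG
        analyticAt_const ag ?_
      filter_upwards [hdA] with z hz
      field_simp
      ring
    have ndu : NonnegCoeff (deriv K.u) N := by
      refine (nG.const_mul hl2 aG).congr ?_
      filter_upwards [hre] with z hz
      rw [(K.hasDerivAt_u hz (K.u_re_lt_tau hz)).deriv, div_eq_mul_inv]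
    refine ⟨nonnegCoeff_of_deriv hu0 ndu, fun k => nonnegCoeff_of_deriv ?_ ?_⟩
    · rw [e]; exact K.iter_nonneg k y hyσ
    · refine ((ih.2 (k + 1)).mul ndu (K.analyticAt_iteratedDeriv_comp_u (k + 1))
        (K.analyticAt_u K.norm_zero_lt_Rh).deriv).congr ?_
      filter_upwards [hre] with z hz
      have h1 := (K.analyticAt_iteratedDeriv (K.u_re_lt_sigma hz.le) k).differentiableAt.hasDerivAt
      have h2 := h1.comp z (K.analyticAt_u hz).differentiableAt.hasDerivAt
      rw [iteratedDeriv_succ]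
      exact h2.deriv.symm

/-- The busy period transform `h = A ∘ u`. -/
noncomputable def hh (z : ℂ) : ℂ := K.A (K.u z)

theorem nonnegCoeff_hh (N : ℕ) : NonnegCoeff K.hh N := by
  simpa using! (K.nonnegCoeff_u_comp N).2 0

theorem analyticAt_hh {z : ℂ} (hz : ‖z‖ < K.Rh) : AnalyticAt ℂ K.hh z :=
  (K.analyticAt_A (K.u_re_lt_sigma hz.le)).comp (K.analyticAt_u hz)

theorem differentiableOn_hh : DifferentiableOn ℂ K.hh (ball 0 K.Rh) := fun _ hz =>
  (K.analyticAt_hh (mem_ball_zero_iff.1 hz)).differentiableAt.differentiableWithinAt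

theorem hh_mul {z : ℂ} (hz : ‖z‖ ≤ K.Rh) : K.l1 * K.hh z = K.u z - K.l2 * z := by
  have := (K.u_spec hz).2
  rw [hh]
  linear_combination -this

theorem hh_ofReal {t : ℝ} (ht0 : K.lam ≤ t) (ht : t ≤ K.τ) : K.hh (K.psi t) = K.a t := by
  rw [hh, K.u_psi ht0 ht, K.ofReal t (ht.trans_lt K.tau_lt)]

theorem hh_one : K.hh 1 = 1 := by
  have h := K.hh_ofReal le_rfl K.lam_lt_tau'.le
  rw [K.psi_lam] at h
  simpa [lam, K.a_lam] using h

/-! ### h as the fixed point in the open unit disk -/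

theorem norm_le_Rh_of_lt_one {z : ℂ} (hz : ‖z‖ < 1) : ‖z‖ < K.Rh := hz.trans K.one_lt_Rh

theorem u_re_lt_lam {z : ℂ} (hz : ‖z‖ < 1) : (K.u z).re < K.lam := by
  refine K.u_re_lt le_rfl K.lam_lt_tau'.le (by rw [K.psi_lam]; exact hz.le) ?_
  rintro rfl
  rw [K.psi_lam] at hz
  simp at hz

theorem norm_hh_lt_one {z : ℂ} (hz : ‖z‖ < 1) : ‖K.hh z‖ < 1 := by
  have h := K.u_re_lt_lam hz
  have h1 := K.norm_le (K.u z) (h.trans K.lam_lt_sigma)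
  have h2 := K.strictMonoOn_a (h.trans K.lam_lt_sigma) K.lam_lt_sigma h
  rw [lam, K.a_lam] at h2
  exact h1.trans_lt h2

theorem hh_fixed {z : ℂ} (hz : ‖z‖ < 1) : K.hh z = K.A (K.l1 * K.hh z + K.l2 * z) := by
  rw [K.hh_mul (K.norm_le_Rh_of_lt_one hz).le, sub_add_cancel]
  rfl

/-- The number λ₁w + λ₂z has modulus at most λ < τ and solves the equation for u, whose root is
unique. -/
theorem eq_hh_of_fixed {z w : ℂ} (hz : ‖z‖ < 1) (hw : ‖w‖ < 1)
    (e : w = K.A (K.l1 * w + K.l2 * z)) : w = K.hh z := by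
  have h1 : ‖(K.l1 : ℂ) * w + K.l2 * z‖ ≤ K.τ := by
    refine (norm_add_le _ _).trans ?_
    rw [norm_mul, norm_mul, Complex.norm_real, Complex.norm_real,
      Real.norm_of_nonneg K.l1_pos.le, Real.norm_of_nonneg K.l2_pos.le]
    have h2 := K.lam_lt_tau
    have h3 := mul_le_mul_of_nonneg_left hw.le K.l1_pos.le
    have h4 := mul_le_mul_of_nonneg_left hz.le K.l2_pos.le
    linarith
  have h2 := K.u_eq_of_root (K.norm_le_Rh_of_lt_one hz).le h1 (by
    rw [← e]; ring)
  rw [hh, h2]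
  exact e

/-! ### The divided difference `D` of `A` at `λ` -/

/-- The divided difference of `A` at the total rate. -/
noncomputable def D : ℂ → ℂ := dslope K.A (K.lam : ℂ)

/-- The divided difference of `a` at the total rate. -/
noncomputable def d (x : ℝ) : ℝ := ∫ t in (0 : ℝ)..1, K.a1 (K.lam + t * (x - K.lam))

theorem A_lam : K.A (K.lam : ℂ) = 1 := by
  rw [K.ofReal _ K.lam_lt_sigma, lam, K.a_lam, Complex.ofReal_one]

theorem analyticAt_D {w : ℂ} (hw : w.re < K.σ) : AnalyticAt ℂ K.D w := by
  have h1 : DifferentiableOn ℂ K.D {u : ℂ | u.re < K.σ} :=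
    (Complex.differentiableOn_dslope
      (K.isOpen_half.mem_nhds (by simpa using K.lam_lt_sigma))).2 K.diff
  exact h1.analyticAt (K.isOpen_half.mem_nhds hw)

theorem sub_mul_D (w : ℂ) : (w - K.lam) * K.D w = K.A w - 1 := by
  rw [← K.A_lam, D, ← smul_eq_mul]
  exact sub_smul_dslope _ _ _

/-- The integral form shows D as a mean of A', from which its bound by d(Re w), positivity and
monotonicity follow. -/
theorem D_eq_integral {w : ℂ} (hw : w.re < K.σ) :
    K.D w = ∫ t in (0 : ℝ)..1, deriv K.A ((K.lam : ℂ) + t • (w - K.lam)) := by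
  rcases eq_or_ne w K.lam with rfl | hne
  · simp [D]
  · have h1 := K.A_sub_A (v := K.lam) hw (by simpa using K.lam_lt_sigma)
    have h2 := K.sub_mul_D w
    rw [← K.A_lam, h1] at h2
    exact mul_left_cancel₀ (sub_ne_zero.2 hne) h2

theorem norm_D_le {w : ℂ} (hw : w.re < K.σ) : ‖K.D w‖ ≤ K.d w.re := by
  rw [K.D_eq_integral hw]
  simpa [d] using K.norm_integral_deriv_le (v := K.lam) hw (by simpa using K.lam_lt_sigma)

theorem D_ofReal {x : ℝ} (hx : x < K.σ) : K.D x = K.d x := by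
  rw [K.D_eq_integral (by simpa using hx), d, ← intervalIntegral.integral_ofReal]
  refine intervalIntegral.integral_congr fun t ht => ?_
  rw [Set.uIcc_of_le zero_le_one] at ht
  have h0 : K.lam + t * (x - K.lam) < K.σ :=
    (convex_Iio K.σ).add_smul_sub_mem (x := K.lam) (y := x) K.lam_lt_sigma hx ht
  rw [← K.deriv_ofReal _ h0]
  congr 1
  simp

theorem strictMonoOn_d : StrictMonoOn K.d (Set.Iio K.σ) := by
  intro x hx y hy hxy
  have hm : ∀ x < K.σ, ∀ t ∈ Set.Icc (0 : ℝ) 1, K.lam + t * (x - K.lam) < K.σ :=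
    fun x hx t ht =>
      (convex_Iio K.σ).add_smul_sub_mem (x := K.lam) (y := x) K.lam_lt_sigma hx ht
  refine intervalIntegral.integral_lt_integral_of_continuousOn_of_le_of_exists_lt zero_lt_one
    (K.continuousOn_a1_segment hx K.lam_lt_sigma) (K.continuousOn_a1_segment hy K.lam_lt_sigma)
    (fun t ht => ?_) ⟨1, by simp, ?_⟩
  · have ht' : t ∈ Set.Icc (0 : ℝ) 1 := ⟨ht.1.le, ht.2⟩
    refine K.strictMonoOn_a1.monotoneOn (hm x hx t ht') (hm y hy t ht') ?_
    have := mul_le_mul_of_nonneg_left hxy.le ht'.1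
    linarith
  · refine K.strictMonoOn_a1 (hm x hx 1 (by simp)) (hm y hy 1 (by simp)) ?_
    linarith

theorem d_lam : K.d K.lam = K.a1 K.lam := by simp [d]

/-- This is the stability condition ρ < 1, since d(λ) = A'(λ) is the mean service time when A comes
from a law. -/
theorem lam_mul_d_lam : K.lam * K.d K.lam < 1 := by
  rw [d_lam]; exact K.a1_lam

theorem d_pos {x : ℝ} (hx : x < K.σ) : 0 < K.d x := by
  refine intervalIntegral.intervalIntegral_pos_of_pos_on
    ((K.continuousOn_a1_segment hx K.lam_lt_sigma).intervalIntegrable_of_Icc zero_le_one)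
    (fun t ht => ?_) zero_lt_one
  exact K.a1_pos _ ((convex_Iio K.σ).add_smul_sub_mem (x := K.lam) (y := x) K.lam_lt_sigma hx
    ⟨ht.1.le, ht.2.le⟩)

theorem continuousOn_d : ContinuousOn K.d (Set.Iio K.σ) := by
  intro x hx
  have h1 : ContinuousAt (fun x : ℝ => (K.D x).re) x :=
    Complex.continuous_re.continuousAt.comp
      ((K.analyticAt_D (w := (x : ℂ)) (by simpa using hx)).continuousAt.comp
        Complex.continuous_ofReal.continuousAt)
  refine (h1.congr ?_).continuousWithinAt
  filter_upwards [Iio_mem_nhds hx] with y hy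
  rw [K.D_ofReal hy, Complex.ofReal_re]

/-- `h(z) - z` in terms of the divided difference. -/
theorem hh_sub {z : ℂ} (hz : ‖z‖ ≤ K.Rh) :
    K.l2 * (K.hh z - z) = (K.u z - K.lam) * (K.lam * K.D (K.u z) - 1) := by
  have h1 := K.hh_mul hz
  have h2 := K.sub_mul_D (K.u z)
  have h3 : K.hh z = K.A (K.u z) := rfl
  have h4 : (K.lam : ℂ) = K.l1 + K.l2 := by simp [lam]
  rw [← h3] at h2
  linear_combination -h1 - K.lam * h2 - K.hh z * h4

end BusyKernel

namespace BusyKernel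

variable (K : BusyKernel)

/-! ### The function `f₁` -/

/-- The function `f₁ = (1 - h) / (h - z)`, without the removable singularity at `1`. -/
noncomputable def F1 (z : ℂ) : ℂ := K.l2 * K.D (K.u z) / (1 - K.lam * K.D (K.u z))

theorem hh_sub_mul_F1 {z : ℂ} (hz : ‖z‖ ≤ K.Rh) (hD : 1 - K.lam * K.D (K.u z) ≠ 0) :
    (K.hh z - z) * K.F1 z = 1 - K.hh z := by
  have hl2 : (K.l2 : ℂ) ≠ 0 := by exact_mod_cast K.l2_pos.ne'
  have h1 := K.hh_sub hz
  have h2 := K.sub_mul_D (K.u z)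
  have h3 : K.hh z = K.A (K.u z) := rfl
  rw [← h3] at h2
  rw [F1, mul_div_assoc', div_eq_iff hD]
  linear_combination K.D (K.u z) * h1 - (1 - K.lam * K.D (K.u z)) * h2

/-- In the factorisation of h - z the factor u - λ vanishes only at z = 1, by injectivity of u and
u(1) = λ. -/
theorem hh_ne {z : ℂ} (hz : ‖z‖ ≤ K.Rh) (hz1 : z ≠ 1) (hD : 1 - K.lam * K.D (K.u z) ≠ 0) :
    K.hh z - z ≠ 0 := by
  intro h
  have h1 := K.hh_sub hz
  rw [h, mul_zero] at h1
  rcases mul_eq_zero.1 h1.symm with h2 | h2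
  · refine hz1 (K.u_injOn hz ?_ ?_)
    · simpa using K.one_lt_Rh.le
    · have := K.u_psi le_rfl K.lam_lt_tau'.le
      rw [K.psi_lam, Complex.ofReal_one] at this
      rw [this]
      exact sub_eq_zero.1 h2
  · exact hD (by linear_combination -h2)

theorem F1_eq {z : ℂ} (hz : ‖z‖ ≤ K.Rh) (hz1 : z ≠ 1) (hD : 1 - K.lam * K.D (K.u z) ≠ 0) :
    K.F1 z = (1 - K.hh z) / (K.hh z - z) := by
  rw [eq_div_iff (K.hh_ne hz hz1 hD), mul_comm]
  exact K.hh_sub_mul_F1 hz hD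

/-- |λD(w)| ≤ λd(Re w) < λd(t) ≤ 1: as long as λd(t) ≤ 1, the denominator of f₁ has no zero left of
t. -/
theorem norm_lam_mul_D_lt {t : ℝ} (ht : t ≤ K.τ) (hd : K.lam * K.d t ≤ 1)
    {w : ℂ} (hw : w.re < t) : ‖K.lam * K.D w‖ < 1 := by
  have hσ := ht.trans_lt K.tau_lt
  rw [norm_mul, Complex.norm_real, Real.norm_of_nonneg K.lam_pos.le]
  calc K.lam * ‖K.D w‖ ≤ K.lam * K.d w.re :=
        mul_le_mul_of_nonneg_left (K.norm_D_le (hw.trans hσ)) K.lam_pos.le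
    _ < K.lam * K.d t := mul_lt_mul_of_pos_left (K.strictMonoOn_d (hw.trans hσ) hσ hw) K.lam_pos
    _ ≤ 1 := hd

theorem one_sub_ne_zero_of_norm_lt {w : ℂ} (h : ‖w‖ < 1) : 1 - w ≠ 0 := by
  intro h0
  rw [sub_eq_zero.1 h0 |>.symm, norm_one] at h
  exact lt_irrefl _ h

theorem one_sub_lam_D_ne_zero {t : ℝ} (ht0 : K.lam ≤ t) (ht : t ≤ K.τ) (hd : K.lam * K.d t ≤ 1)
    {z : ℂ} (hz : ‖z‖ ≤ K.psi t) (hne : z ≠ K.psi t) : 1 - K.lam * K.D (K.u z) ≠ 0 :=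
  one_sub_ne_zero_of_norm_lt (K.norm_lam_mul_D_lt ht hd (K.u_re_lt ht0 ht hz hne))

theorem one_sub_lam_D_ne_zero_of_lt_one {z : ℂ} (hz : ‖z‖ < 1) :
    1 - K.lam * K.D (K.u z) ≠ 0 :=
  one_sub_ne_zero_of_norm_lt (K.norm_lam_mul_D_lt K.lam_lt_tau'.le K.lam_mul_d_lam.le
    (K.u_re_lt_lam hz))

theorem F1_eq_of_lt_one {z : ℂ} (hz : ‖z‖ < 1) : K.F1 z = (1 - K.hh z) / (K.hh z - z) := by
  refine K.F1_eq (K.norm_le_Rh_of_lt_one hz).le ?_ (K.one_sub_lam_D_ne_zero_of_lt_one hz)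
  rintro rfl
  simp at hz

theorem analyticAt_F1_of_ne {z : ℂ} (hz : ‖z‖ < K.Rh) (hD : 1 - K.lam * K.D (K.u z) ≠ 0) :
    AnalyticAt ℂ K.F1 z := by
  have h1 : AnalyticAt ℂ (fun z => K.D (K.u z)) z :=
    (K.analyticAt_D (K.u_re_lt_sigma hz.le)).comp (K.analyticAt_u hz)
  exact (analyticAt_const.mul h1).div (analyticAt_const.sub (analyticAt_const.mul h1)) hD

/-- With η = (1 - h)/(1 - z) one has h - z = (1 - z)(1 - η), so f₁ = η/(1 - η), that is f₁ = η +
ηf₁. The coefficients of η are nonnegative because those of h sum to h(1) = 1, and η(0) = 1 - h(0) <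
1. -/
theorem nonnegCoeff_F1 (N : ℕ) : NonnegCoeff K.F1 N := by
  let η : ℂ → ℂ := fun z => (1 - K.hh z) / (1 - z)
  have ah := K.analyticAt_hh K.norm_zero_lt_Rh
  have aη : AnalyticAt ℂ η 0 := (analyticAt_const.sub ah).div (analyticAt_const.sub analyticAt_id)
    (by simp)
  have hnear : ∀ᶠ z : ℂ in 𝓝 0, ‖z‖ < 1 :=
    continuous_norm.continuousAt.eventually (gt_mem_nhds (by simp))
  have nη : ∀ N, NonnegCoeff η N := by
    refine nonnegCoeff_tail ah aη ?_ K.nonnegCoeff_hh fun n => ?_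
    · filter_upwards [hnear] with z hz
      have := one_sub_ne_zero_of_norm_lt hz
      simp only [η]
      field_simp
      ring
    · have h1 := hasSum_coeff K.differentiableOn_hh K.nonnegCoeff_hh zero_le_one K.one_lt_Rh
      have h2 := sum_le_hasSum (Finset.range (n + 1))
        (fun k _ => mul_nonneg (coeff_nonneg K.nonnegCoeff_hh k) (by positivity)) h1
      simpa [K.hh_one] using h2
  have aF : AnalyticAt ℂ K.F1 0 := K.analyticAt_F1_of_ne K.norm_zero_lt_Rh
    (K.one_sub_lam_D_ne_zero_of_lt_one (by simp))
  refine nonnegCoeff_of_eq_add_mul (nη N) (nη N) ?_ aF aη aη ?_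
  · obtain ⟨y, hy, hyσ, e⟩ := K.exists_u_zero
    have h1 : K.hh 0 = (K.a y : ℂ) := by rw [hh, e, K.ofReal y hyσ]
    have h2 := K.a_pos y hyσ
    simp only [η, h1]
    have h3 : ((1 : ℂ) - K.a y) / (1 - 0) = ((1 - K.a y : ℝ) : ℂ) := by simp
    rw [h3]
    exact_mod_cast (by linarith : 1 - K.a y < 1)
  · filter_upwards [hnear] with z hz
    have h1 := one_sub_ne_zero_of_norm_lt hz
    have h2 := K.hh_sub_mul_F1 (K.norm_le_Rh_of_lt_one hz).le
      (K.one_sub_lam_D_ne_zero_of_lt_one hz)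
    simp only [η]
    field_simp
    linear_combination h2

end BusyKernel

/-- A kernel with a point `t`, for which `ψ(t)` will be the dominant singularity, the factor
`c = λ/ν` and the value `q0` of `Q` at `1`. -/
structure Stage extends BusyKernel where
  t : ℝ
  c : ℝ
  q0 : ℝ
  lam_lt_t : toBusyKernel.lam < t
  t_le : t ≤ τ
  d_le : toBusyKernel.lam * toBusyKernel.d t ≤ 1
  c_pos : 0 < c
  q0_pos : 0 < q0

/-! ### The functions Q, R and P₂ on the disk |z| < r -/

namespace Stage

variable (S : Stage)

/-- The dominant singularity of `R` and `P₂`. -/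
noncomputable def r : ℝ := S.psi S.t

theorem one_lt_r : 1 < S.r := S.one_lt_psi S.lam_lt_t S.t_le

theorem r_pos : 0 < S.r := zero_lt_one.trans S.one_lt_r

theorem r_le : S.r ≤ S.Rh := S.psi_le_Rh S.t_le

theorem t_lt_sigma : S.t < S.σ := S.t_le.trans_lt S.tau_lt

theorem u_r : S.u S.r = S.t := S.u_psi S.lam_lt_t.le S.t_le

theorem norm_r : ‖(S.r : ℂ)‖ = S.r := by
  rw [Complex.norm_real, Real.norm_of_nonneg S.r_pos.le]

theorem ne_r {z : ℂ} (hz : ‖z‖ < S.r) : z ≠ S.r := by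
  rintro rfl
  rw [S.norm_r] at hz
  exact lt_irrefl _ hz

theorem one_sub_ne {z : ℂ} (hz : ‖z‖ ≤ S.r) (hne : z ≠ S.r) :
    1 - S.lam * S.D (S.u z) ≠ 0 :=
  S.one_sub_lam_D_ne_zero S.lam_lt_t.le S.t_le S.d_le hz hne

theorem analyticAt_F1 {z : ℂ} (hz : ‖z‖ < S.r) : AnalyticAt ℂ S.F1 z :=
  S.analyticAt_F1_of_ne (hz.trans_le S.r_le) (S.one_sub_ne hz.le (S.ne_r hz))

theorem differentiableOn_F1 : DifferentiableOn ℂ S.F1 (ball 0 S.r) := fun _ hz =>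
  (S.analyticAt_F1 (mem_ball_zero_iff.1 hz)).differentiableAt.differentiableWithinAt

/-- The formula for f₁ in terms of u is applied to the continuation of u; its denominator is nonzero
at ζ because r is the only candidate on the circle. -/
theorem continues_F1 {ζ : ℂ} (hζ : ‖ζ‖ = S.r) (hne : ζ ≠ S.r) : Continues S.F1 S.r ζ := by
  have hζR : ‖ζ‖ ≤ S.Rh := hζ.le.trans S.r_le
  have hneR : ζ ≠ S.Rh := by
    rintro rfl
    rw [Complex.norm_real, Real.norm_of_nonneg S.Rh_pos.le] at hζ
    exact hne (by rw [hζ])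
  obtain ⟨g, hg, hgζ, e⟩ := S.exists_continuation_u hζR hneR
  have h1 : AnalyticAt ℂ (fun z => S.D (g z)) ζ := by
    refine AnalyticAt.fun_comp ?_ hg
    rw [hgζ]
    exact S.analyticAt_D (S.u_re_lt_sigma hζR)
  refine ⟨fun z => S.l2 * S.D (g z) / (1 - S.lam * S.D (g z)),
    (analyticAt_const.mul h1).div (analyticAt_const.sub (analyticAt_const.mul h1)) ?_, ?_⟩
  · rw [hgζ]
    exact S.one_sub_ne hζ.le hne
  · have hsub : ball (0 : ℂ) S.r ⊆ closedBall 0 S.Rh :=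
      (ball_subset_ball S.r_le).trans ball_subset_closedBall
    filter_upwards [nhdsWithin_mono _ hsub e] with z hz
    rw [hz, BusyKernel.F1]

theorem exists_primitive :
    ∃ P : ℂ → ℂ, P 0 = 0 ∧ ∀ z ∈ ball (0 : ℂ) S.r, HasDerivAt P (S.F1 z) z := by
  obtain ⟨P, h⟩ := S.differentiableOn_F1.isExactOn_ball
  refine ⟨fun z => P z - P 0, sub_self _, fun z hz => ?_⟩
  simpa using! (h z hz).sub_const (P 0)

/-- The primitive of `f₁` that vanishes at `0`. -/
noncomputable def P : ℂ → ℂ := Classical.choose S.exists_primitive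

theorem P_zero : S.P 0 = 0 := (Classical.choose_spec S.exists_primitive).1

theorem hasDerivAt_P {z : ℂ} (hz : ‖z‖ < S.r) : HasDerivAt S.P (S.F1 z) z :=
  (Classical.choose_spec S.exists_primitive).2 z (mem_ball_zero_iff.2 hz)

theorem differentiableOn_P : DifferentiableOn ℂ S.P (ball 0 S.r) := fun _ hz =>
  (S.hasDerivAt_P (mem_ball_zero_iff.1 hz)).differentiableAt.differentiableWithinAt

theorem norm_zero_lt : ‖(0 : ℂ)‖ < S.r := by simpa using S.r_pos

theorem eventually_norm_lt {z : ℂ} (hz : ‖z‖ < S.r) : ∀ᶠ w in 𝓝 z, ‖w‖ < S.r :=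
  continuous_norm.continuousAt.eventually (gt_mem_nhds hz)

theorem nonnegCoeff_P (N : ℕ) : NonnegCoeff S.P N := by
  have h : NonnegCoeff (deriv S.P) N := by
    refine (S.nonnegCoeff_F1 N).congr ?_
    filter_upwards [S.eventually_norm_lt S.norm_zero_lt] with z hz
    exact (S.hasDerivAt_P hz).deriv.symm
  exact (nonnegCoeff_of_deriv (by rw [S.P_zero]) h).mono (Nat.le_succ N)

theorem P_one : S.P 1 = ((S.P 1).re : ℂ) := by
  have := eq_ofReal_of_nonnegCoeff S.differentiableOn_P S.nonnegCoeff_P zero_le_one S.one_lt_r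
  rwa [Complex.ofReal_one] at this

/-- The function `Q`. -/
noncomputable def Q (z : ℂ) : ℂ := S.q0 * Complex.exp (S.c * (S.P z - S.P 1))

/-- The function `R`. -/
noncomputable def R (z : ℂ) : ℂ := (S.lam / S.l2 : ℝ) * (S.F1 z * S.Q z)

/-- The function `P₂`. -/
noncomputable def P2 (z : ℂ) : ℂ := S.Q z + S.R z

theorem hasDerivAt_Q {z : ℂ} (hz : ‖z‖ < S.r) : HasDerivAt S.Q (S.c * S.F1 z * S.Q z) z := by
  have h := ((((S.hasDerivAt_P hz).sub_const (S.P 1)).const_mul (S.c : ℂ)).cexp).const_mul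
    (S.q0 : ℂ)
  refine h.congr_deriv ?_
  rw [Q]
  ring

theorem differentiableOn_Q : DifferentiableOn ℂ S.Q (ball 0 S.r) := fun _ hz =>
  (S.hasDerivAt_Q (mem_ball_zero_iff.1 hz)).differentiableAt.differentiableWithinAt

theorem differentiableOn_R : DifferentiableOn ℂ S.R (ball 0 S.r) :=
  (S.differentiableOn_F1.mul S.differentiableOn_Q).const_mul _

theorem differentiableOn_P2 : DifferentiableOn ℂ S.P2 (ball 0 S.r) :=
  S.differentiableOn_Q.add S.differentiableOn_R

theorem analyticAt_Q_zero : AnalyticAt ℂ S.Q 0 :=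
  S.differentiableOn_Q.analyticAt (ball_mem_nhds _ S.r_pos)

theorem analyticAt_R_zero : AnalyticAt ℂ S.R 0 :=
  S.differentiableOn_R.analyticAt (ball_mem_nhds _ S.r_pos)

/-- Q solves Q' = c f₁Q with Q(0) > 0. The constant P(1) has to be real for Q(0) to be real. -/
theorem nonnegCoeff_Q (N : ℕ) : NonnegCoeff S.Q N := by
  have aF := S.analyticAt_F1 S.norm_zero_lt
  have hc : (0 : ℂ) ≤ S.c := by exact_mod_cast S.c_pos.le
  refine nonnegCoeff_of_deriv_eq_mul (g := fun z => S.c * S.F1 z)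
    (fun N => (S.nonnegCoeff_F1 N).const_mul hc aF) ?_ S.analyticAt_Q_zero
    (analyticAt_const.mul aF) ?_ N
  · rw [Q, S.P_zero, S.P_one]
    have h : (S.q0 : ℂ) * Complex.exp (S.c * (0 - ((S.P 1).re : ℂ))) =
        ((S.q0 * Real.exp (S.c * (0 - (S.P 1).re)) : ℝ) : ℂ) := by push_cast; rfl
    rw [h]
    have := S.q0_pos
    exact_mod_cast (by positivity : (0 : ℝ) ≤ S.q0 * Real.exp (S.c * (0 - (S.P 1).re)))
  · filter_upwards [S.eventually_norm_lt S.norm_zero_lt] with z hz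
    exact (S.hasDerivAt_Q hz).deriv

theorem ratio_pos : 0 < S.lam / S.l2 := div_pos S.lam_pos S.l2_pos

theorem nonnegCoeff_R (N : ℕ) : NonnegCoeff S.R N := by
  have aF := S.analyticAt_F1 S.norm_zero_lt
  have hc : (0 : ℂ) ≤ (S.lam / S.l2 : ℝ) := by exact_mod_cast S.ratio_pos.le
  exact ((S.nonnegCoeff_F1 N).mul (S.nonnegCoeff_Q N) aF S.analyticAt_Q_zero).const_mul hc
    (aF.mul S.analyticAt_Q_zero)

theorem nonnegCoeff_P2 (N : ℕ) : NonnegCoeff S.P2 N :=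
  (S.nonnegCoeff_Q N).add (S.nonnegCoeff_R N) S.analyticAt_Q_zero S.analyticAt_R_zero

theorem continues_Q {ζ : ℂ} (hζ : ‖ζ‖ = S.r) (hne : ζ ≠ S.r) : Continues S.Q S.r ζ := by
  obtain ⟨G, hG, e⟩ := (S.continues_F1 hζ hne).primitive (P := S.P)
    fun z hz => S.hasDerivAt_P (mem_ball_zero_iff.1 hz)
  refine ⟨fun z => S.q0 * Complex.exp (S.c * (G z - S.P 1)), ?_, ?_⟩
  · exact analyticAt_const.mul (analyticAt_const.mul (hG.sub analyticAt_const)).cexp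
  · filter_upwards [e] with z hz
    rw [hz, Q]

theorem continues_R {ζ : ℂ} (hζ : ‖ζ‖ = S.r) (hne : ζ ≠ S.r) : Continues S.R S.r ζ :=
  ((S.continues_F1 hζ hne).mul (S.continues_Q hζ hne)).const_mul _

theorem continues_P2 {ζ : ℂ} (hζ : ‖ζ‖ = S.r) (hne : ζ ≠ S.r) : Continues S.P2 S.r ζ :=
  (S.continues_Q hζ hne).add (S.continues_R hζ hne)

/-! ### Behaviour at `r` when `λ d(t) = 1` -/

theorem eventually_nhdsLT : ∀ᶠ x : ℝ in 𝓝[<] S.r, 0 ≤ x ∧ x < S.r := by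
  filter_upwards [self_mem_nhdsWithin,
    mem_nhdsWithin_of_mem_nhds (lt_mem_nhds S.r_pos)] with x hx hx'
  exact ⟨le_of_lt hx', hx⟩

theorem tendsto_u : Tendsto (fun x : ℝ => S.u x) (𝓝[<] S.r) (𝓝 (S.t : ℂ)) := by
  have h1 : Tendsto S.u (𝓝[ball 0 S.r] (S.r : ℂ)) (𝓝 (S.u S.r)) := by
    have hsub : ball (0 : ℂ) S.r ⊆ closedBall 0 S.Rh :=
      (ball_subset_ball S.r_le).trans ball_subset_closedBall
    exact (S.continuousOn_u S.r (mem_closedBall_zero_iff.2 (S.norm_r.le.trans S.r_le))).mono_left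
      (nhdsWithin_mono _ hsub)
  rw [S.u_r] at h1
  exact h1.comp (tendsto_ofReal_nhdsLT_nhdsWithin_ball S.r_pos)

theorem tendsto_D : Tendsto (fun x : ℝ => S.D (S.u x)) (𝓝[<] S.r) (𝓝 (S.d S.t : ℂ)) := by
  rw [← S.D_ofReal S.t_lt_sigma]
  exact (S.analyticAt_D (by simpa using S.t_lt_sigma)).continuousAt.tendsto.comp S.tendsto_u

/-- The numerator of f₁ tends to λ₂d(t) > 0 and the denominator to 0. On [0, r) nonnegative
coefficients make f₁ real and nonnegative, so its modulus is its real part. -/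
theorem tendsto_F1_re (h : S.lam * S.d S.t = 1) :
    Tendsto (fun x : ℝ => (S.F1 x).re) (𝓝[<] S.r) atTop := by
  have hn : Tendsto (fun x : ℝ => ‖S.F1 x‖) (𝓝[<] S.r) atTop := by
    have h1 : Tendsto (fun x : ℝ => ‖(S.l2 : ℂ) * S.D (S.u x)‖) (𝓝[<] S.r)
        (𝓝 ‖(S.l2 : ℂ) * S.d S.t‖) := (S.tendsto_D.const_mul _).norm
    have h2 : Tendsto (fun x : ℝ => ‖1 - (S.lam : ℂ) * S.D (S.u x)‖) (𝓝[<] S.r) (𝓝[>] 0) := by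
      refine tendsto_nhdsWithin_iff.2 ⟨?_, ?_⟩
      · have h3 := (S.tendsto_D.const_mul (S.lam : ℂ)).const_sub 1 |>.norm
        have h4 : (S.lam : ℂ) * S.d S.t = 1 := by exact_mod_cast h
        simpa [h4] using h3
      · filter_upwards [S.eventually_nhdsLT] with x hx
        have hxn : ‖(x : ℂ)‖ < S.r := by
          rw [Complex.norm_real, Real.norm_of_nonneg hx.1]; exact hx.2
        exact norm_pos_iff.2 (S.one_sub_ne hxn.le (S.ne_r hxn))
    have h5 : 0 < ‖(S.l2 : ℂ) * S.d S.t‖ := by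
      refine norm_pos_iff.2 (mul_ne_zero ?_ ?_)
      · exact_mod_cast S.l2_pos.ne'
      · exact_mod_cast (S.d_pos S.t_lt_sigma).ne'
    have h6 := h1.pos_mul_atTop h5 h2.inv_tendsto_nhdsGT_zero
    refine h6.congr fun x => ?_
    rw [BusyKernel.F1, norm_div, div_eq_mul_inv]
    rfl
  refine hn.congr' ?_
  filter_upwards [S.eventually_nhdsLT] with x hx
  rw [eq_ofReal_of_nonnegCoeff S.differentiableOn_F1 S.nonnegCoeff_F1 hx.1 hx.2, Complex.norm_real,
    Real.norm_of_nonneg (re_nonneg_of_nonnegCoeff S.differentiableOn_F1 S.nonnegCoeff_F1 hx.1 hx.2),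
    Complex.ofReal_re]

/-- P is nonnegative on [0, r), so Q stays away from 0 there and the blow-up of f₁ passes to R =
(λ/λ₂)f₁Q. -/
theorem norm_Q_ge {x : ℝ} (hx : 0 ≤ x) (hxr : x < S.r) :
    S.q0 * Real.exp (-(S.c * (S.P 1).re)) ≤ ‖S.Q x‖ := by
  have h1 := re_nonneg_of_nonnegCoeff S.differentiableOn_P S.nonnegCoeff_P hx hxr
  have h2 := S.q0_pos
  rw [Q, norm_mul, Complex.norm_real, Real.norm_of_nonneg h2.le, Complex.norm_exp]
  have h3 : (S.c * (S.P x - S.P 1)).re = S.c * ((S.P x).re - (S.P 1).re) := by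
    rw [Complex.re_ofReal_mul, Complex.sub_re]
  rw [h3]
  have h4 := mul_nonneg S.c_pos.le h1
  gcongr
  linarith

theorem tendsto_norm_R (h : S.lam * S.d S.t = 1) :
    Tendsto (fun x : ℝ => ‖S.R x‖) (𝓝[<] S.r) atTop := by
  have h1 : 0 < S.lam / S.l2 * (S.q0 * Real.exp (-(S.c * (S.P 1).re))) :=
    mul_pos S.ratio_pos (mul_pos S.q0_pos (Real.exp_pos _))
  refine tendsto_atTop_mono' _ ?_ ((S.tendsto_F1_re h).const_mul_atTop h1)
  filter_upwards [S.eventually_nhdsLT] with x hx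
  rw [R, norm_mul, norm_mul, Complex.norm_real, Real.norm_of_nonneg S.ratio_pos.le, mul_assoc]
  have h2 := S.norm_Q_ge hx.1 hx.2
  have h3 := S.ratio_pos
  have h4 : (S.F1 x).re ≤ ‖S.F1 x‖ := Complex.re_le_norm _
  have h5 := re_nonneg_of_nonnegCoeff S.differentiableOn_F1 S.nonnegCoeff_F1 hx.1 hx.2
  rw [mul_comm ‖S.F1 x‖]
  gcongr

theorem tendsto_norm_P2 (h : S.lam * S.d S.t = 1) :
    Tendsto (fun x : ℝ => ‖S.P2 x‖) (𝓝[<] S.r) atTop := by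
  refine tendsto_atTop_mono' _ ?_ (S.tendsto_norm_R h)
  filter_upwards [S.eventually_nhdsLT] with x hx
  have e1 := eq_ofReal_of_nonnegCoeff S.differentiableOn_R S.nonnegCoeff_R hx.1 hx.2
  have e2 := re_nonneg_of_nonnegCoeff S.differentiableOn_R S.nonnegCoeff_R hx.1 hx.2
  have e3 := re_nonneg_of_nonnegCoeff S.differentiableOn_Q S.nonnegCoeff_Q hx.1 hx.2
  refine le_trans ?_ (Complex.re_le_norm _)
  rw [P2, Complex.add_re, e1, Complex.norm_real, Real.norm_of_nonneg e2, Complex.ofReal_re]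
  linarith

end Stage

/-! ### The square root singularity of `u` at `R_h` -/

theorem analyticAt_dslope {f : ℂ → ℂ} {c : ℂ} (hf : AnalyticAt ℂ f c) :
    AnalyticAt ℂ (dslope f c) c := by
  obtain ⟨p, hp⟩ := hf
  exact ⟨_, hp.has_fpower_series_dslope_fslope⟩

theorem eq_sub_mul_dslope {f : ℂ → ℂ} {c : ℂ} (h0 : f c = 0) (w : ℂ) :
    f w = (w - c) * dslope f c w := by
  have := sub_smul_dslope f c w
  rw [h0, sub_zero, smul_eq_mul] at this
  exact this.symm

/-- A function with a double zero. -/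
theorem exists_sq_factor {θ : ℂ → ℂ} {c : ℂ} (hθ : AnalyticAt ℂ θ c) (h0 : θ c = 0)
    (h1 : deriv θ c = 0) :
    ∃ χ : ℂ → ℂ, AnalyticAt ℂ χ c ∧ (∀ w, θ w = (w - c) ^ 2 * χ w) ∧
      χ c = deriv (deriv θ) c / 2 := by
  have a1 := analyticAt_dslope hθ
  have h2 : dslope θ c c = 0 := by rw [dslope_same, h1]
  have a2 := analyticAt_dslope a1
  have e1 := eq_sub_mul_dslope h0
  have e2 := eq_sub_mul_dslope h2
  refine ⟨_, a2, fun w => ?_, ?_⟩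
  · rw [e1 w, e2 w]; ring
  · have hd : deriv θ =ᶠ[𝓝 c] fun w => dslope θ c w + (w - c) * deriv (dslope θ c) w := by
      filter_upwards [a1.eventually_analyticAt] with w hw
      have h3 : HasDerivAt (fun w => (w - c) * dslope θ c w)
          (1 * dslope θ c w + (w - c) * deriv (dslope θ c) w) w :=
        ((hasDerivAt_id w).sub_const c).mul hw.differentiableAt.hasDerivAt
      have h4 : θ = fun w => (w - c) * dslope θ c w := funext e1
      conv_lhs => rw [h4]
      rw [h3.deriv, one_mul]
    have h5 : HasDerivAt (fun w => dslope θ c w + (w - c) * deriv (dslope θ c) w)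
        (deriv (dslope θ c) c + (1 * deriv (dslope θ c) c + (c - c) * deriv (deriv (dslope θ c)) c))
        c :=
      a1.differentiableAt.hasDerivAt.add
        (((hasDerivAt_id c).sub_const c).mul a1.deriv.differentiableAt.hasDerivAt)
    rw [hd.deriv_eq, h5.deriv, dslope_same]
    ring

namespace BusyKernel

variable (K : BusyKernel)

theorem hasDerivAt_deriv_A {x : ℝ} (hx : x < K.σ) : HasDerivAt (deriv K.A) (K.a2 x) x := by
  have h1 := (K.analyticAt_A (u := (x : ℂ)) (by simpa using hx)).deriv.differentiableAt.hasDerivAt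
  have h2 : HasDerivAt (fun y : ℝ => deriv K.A y) (K.a2 x : ℂ) x := by
    refine (K.a1_deriv x hx).ofReal_comp.congr_of_eventuallyEq ?_
    filter_upwards [Iio_mem_nhds hx] with y hy
    exact K.deriv_ofReal y hy
  rw [← h1.comp_ofReal.unique h2]
  exact h1

/-- At τ the function R_h - ψ(w) has a double zero, so it equals (w - τ)²χ(w) with χ(τ) =
λ₁A''(τ)/(2λ₂) > 0. Its square root g = (τ - w)χ^{1/2} is a local coordinate and G is the inverse of
g. The sign of Re g on the real axis left of τ is recorded to identify the branch later. -/
theorem exists_sqrt_chart :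
    ∃ G g : ℂ → ℂ, AnalyticAt ℂ G 0 ∧ G 0 = K.τ ∧
      HasDerivAt G (-(√(2 * K.l2 / (K.l1 * K.a2 K.τ)) : ℝ)) 0 ∧
      ∀ᶠ w in 𝓝 (K.τ : ℂ), G (g w) = w ∧ ContinuousAt g w ∧
        g w ^ 2 = K.Rh - (w - K.l1 * K.A w) / K.l2 ∧
        ∀ y : ℝ, w = y → y < K.τ → 0 < (g w).re := by
  have hl1 := K.l1_pos
  have hl2 := K.l2_pos
  have ha2 := K.a2_pos K.τ K.tau_lt
  have hl2' : (K.l2 : ℂ) ≠ 0 := by exact_mod_cast hl2.ne'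
  have hτ : ((K.τ : ℂ)).re < K.σ := by simpa using K.tau_lt
  let θ : ℂ → ℂ := fun w => K.Rh - (w - K.l1 * K.A w) / K.l2
  have hθ : AnalyticAt ℂ θ K.τ := analyticAt_const.sub
    ((analyticAt_id.sub (analyticAt_const.mul (K.analyticAt_A hτ))).div analyticAt_const hl2')
  have h0 : θ K.τ = 0 := by
    simp only [θ, Rh, psi, K.ofReal K.τ K.tau_lt]
    push_cast
    ring
  have hdθ : ∀ w : ℂ, w.re < K.σ → deriv θ w = -((1 - K.l1 * deriv K.A w) / K.l2) := by
    intro w hw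
    have h := (((hasDerivAt_id w).sub
      ((K.hasDerivAt_A hw).const_mul (K.l1 : ℂ))).div_const (K.l2 : ℂ)).const_sub (K.Rh : ℂ)
    exact h.deriv
  have h1 : deriv θ K.τ = 0 := by
    rw [hdθ _ hτ, K.deriv_ofReal _ K.tau_lt]
    have : (K.l1 : ℂ) * K.a1 K.τ = 1 := by exact_mod_cast K.a1_tau
    rw [this]
    simp
  have h2 : deriv (deriv θ) K.τ = K.l1 * K.a2 K.τ / K.l2 := by
    have he : deriv θ =ᶠ[𝓝 (K.τ : ℂ)] fun w => -((1 - K.l1 * deriv K.A w) / K.l2) := by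
      filter_upwards [K.isOpen_half.mem_nhds hτ] with w hw using hdθ w hw
    rw [he.deriv_eq]
    have h := ((((K.hasDerivAt_deriv_A K.tau_lt).const_mul (K.l1 : ℂ)).const_sub 1).div_const
      (K.l2 : ℂ)).neg
    refine (HasDerivAt.deriv h).trans ?_
    ring
  obtain ⟨χ, aχ, eχ, vχ⟩ := exists_sq_factor hθ h0 h1
  let s : ℝ := K.l1 * K.a2 K.τ / (2 * K.l2)
  have hs : 0 < s := by positivity
  have vχ' : χ K.τ = (s : ℂ) := by
    rw [vχ, h2]
    simp only [s]
    push_cast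
    field_simp
  have hslit : χ K.τ ∈ Complex.slitPlane := by
    rw [vχ']
    exact Complex.ofReal_mem_slitPlane.2 hs
  let q : ℂ → ℂ := fun w => χ w ^ (1 / 2 : ℂ)
  have aq : AnalyticAt ℂ q K.τ := aχ.cpow analyticAt_const hslit
  have vq : q K.τ = (√s : ℝ) := by
    simp only [q, vχ']
    rw [Real.sqrt_eq_rpow, Complex.ofReal_cpow hs.le]
    push_cast
    rfl
  have hq2 : ∀ w, q w ^ 2 = χ w := fun w => by
    simp only [q]
    rw [← Complex.cpow_nat_mul]
    norm_num
  let g : ℂ → ℂ := fun w => (K.τ - w) * q w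
  have ag : AnalyticAt ℂ g K.τ := (analyticAt_const.sub analyticAt_id).mul aq
  have hg' : HasDerivAt g (-(√s : ℝ)) K.τ := by
    have h := ((hasDerivAt_id (K.τ : ℂ)).const_sub (K.τ : ℂ)).mul aq.differentiableAt.hasDerivAt
    refine h.congr_deriv ?_
    simp [vq]
  have hsq : 0 < √s := Real.sqrt_pos.2 hs
  have hd0 : deriv g K.τ ≠ 0 := by
    rw [hg'.deriv]
    exact neg_ne_zero.2 (by exact_mod_cast hsq.ne')
  have hgτ : g K.τ = 0 := by simp [g]
  have hG := ag.analyticAt_localInverse hd0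
  have hGd := (HasStrictDerivAt.to_localInverse ag.hasStrictDerivAt hd0).hasDerivAt
  have hleft := HasStrictDerivAt.eventually_left_inverse ag.hasStrictDerivAt hd0
  have hval := hleft.self_of_nhds
  rw [hgτ] at hG hGd hval
  refine ⟨_, g, hG, hval, ?_, ?_⟩
  · refine hGd.congr_deriv ?_
    rw [hg'.deriv, ← neg_inv]
    congr 1
    rw [← Complex.ofReal_inv, ← Real.sqrt_inv]
    congr 2
    simp only [s]
    field_simp
  · have hre : ∀ᶠ w in 𝓝 (K.τ : ℂ), 0 < (q w).re := by
      refine (Complex.continuous_re.continuousAt.comp aq.continuousAt).eventually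
        (lt_mem_nhds ?_)
      simpa [vq] using hsq
    filter_upwards [hleft, ag.eventually_analyticAt, hre] with w hw1 hw2 hw3
    refine ⟨hw1, hw2.continuousAt, ?_, ?_⟩
    · have := eχ w
      simp only [θ] at this
      rw [this, ← hq2]
      simp only [g]
      ring
    · rintro y rfl hy
      simp only [g]
      rw [← Complex.ofReal_sub, Complex.re_ofReal_mul]
      exact mul_pos (sub_pos.2 hy) hw3

/-- The square root expansion of `u` at `R_h`. -/
theorem exists_sqrt_expansion :
    ∃ G : ℂ → ℂ, AnalyticAt ℂ G 0 ∧ G 0 = K.τ ∧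
      HasDerivAt G (-(√(2 * K.l2 / (K.l1 * K.a2 K.τ)) : ℝ)) 0 ∧
      ∀ᶠ z in 𝓝[ball 0 K.Rh] (K.Rh : ℂ), K.u z = G (rt K.Rh z) := by
  obtain ⟨G, g, hG, hG0, hG', hev⟩ := K.exists_sqrt_chart
  refine ⟨G, hG, hG0, hG', ?_⟩
  have hl2 : (K.l2 : ℂ) ≠ 0 := by exact_mod_cast K.l2_pos.ne'
  have huR : K.u K.Rh = K.τ := K.u_psi K.lam_lt_tau'.le le_rfl
  have hRn : ‖(K.Rh : ℂ)‖ = K.Rh := by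
    rw [Complex.norm_real, Real.norm_of_nonneg K.Rh_pos.le]
  have hcont : Tendsto K.u (𝓝[ball 0 K.Rh] (K.Rh : ℂ)) (𝓝 (K.τ : ℂ)) := by
    rw [← huR]
    exact (K.continuousOn_u K.Rh (mem_closedBall_zero_iff.2 hRn.le)).mono_left
      (nhdsWithin_mono _ ball_subset_closedBall)
  obtain ⟨ε, hε, hb⟩ := Metric.eventually_nhds_iff_ball.1
    (eventually_nhdsWithin_iff.1 (hcont.eventually hev))
  set U : Set ℂ := ball (K.Rh : ℂ) ε ∩ ball 0 K.Rh
  have hUconn : IsPreconnected U := ((convex_ball _ _).inter (convex_ball _ _)).isPreconnected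
  have hUn : ∀ z ∈ U, ‖z‖ < K.Rh := fun z hz => mem_ball_zero_iff.1 hz.2
  have hUs : ∀ z ∈ U, z ∈ slit K.Rh := fun z hz => ball_subset_slit _ hz.2
  -- a real point of `U`
  obtain ⟨x, hx0, hxR, hxU⟩ : ∃ x : ℝ, 0 ≤ x ∧ x < K.Rh ∧ (x : ℂ) ∈ U := by
    have h1 : ∀ᶠ x : ℝ in 𝓝[<] K.Rh, (x : ℂ) ∈ U :=
      (tendsto_ofReal_nhdsLT_nhdsWithin_ball K.Rh_pos).eventually
        (Filter.inter_mem (mem_nhdsWithin_of_mem_nhds (ball_mem_nhds _ hε)) self_mem_nhdsWithin)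
    have h2 : ∀ᶠ x : ℝ in 𝓝[<] K.Rh, 0 < x := mem_nhdsWithin_of_mem_nhds (lt_mem_nhds K.Rh_pos)
    have h3 : ∀ᶠ x : ℝ in 𝓝[<] K.Rh, x < K.Rh := self_mem_nhdsWithin
    obtain ⟨x, hx, hx1, hx2⟩ := (h1.and (h2.and h3)).exists
    exact ⟨x, hx1.le, hx2, hx⟩
  have hf : ContinuousOn (fun z => g (K.u z)) U := fun z hz =>
    ((hb z hz.1 hz.2).2.1.comp (K.analyticAt_u (hUn z hz)).continuousAt).continuousWithinAt
  have hrt : ContinuousOn (rt K.Rh) U := fun z hz =>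
    (hasDerivAt_rt (hUs z hz)).continuousAt.continuousWithinAt
  have hsq : Set.EqOn ((fun z => g (K.u z)) ^ 2) (rt K.Rh ^ 2) U := by
    intro z hz
    have h1 := (hb z hz.1 hz.2).2.2.1
    have h2 := (K.u_spec (hUn z hz).le).2
    simp only [Pi.pow_apply]
    rw [h1, rt_sq]
    congr 1
    rw [div_eq_iff hl2]
    linear_combination h2
  -- Both functions are continuous square roots of R_h - z on the connected set U, and the second
  -- has no zero, so they differ by one global sign. At the real point x < R_h both have nonnegative
  -- real part, which excludes the minus sign.
  have key : Set.EqOn (fun z => g (K.u z)) (rt K.Rh) U := by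
    rcases hUconn.eq_or_eq_neg_of_sq_eq hf hrt hsq
      (fun {z} hz => rt_ne_zero (ne_of_mem_slit (hUs z hz))) with h | h
    · exact h
    · exfalso
      obtain ⟨y, hy0, hyτ, hyx, hux⟩ := K.exists_u_ofReal hx0 hxR.le
      have hyτ' : y < K.τ := by
        refine lt_of_le_of_ne hyτ ?_
        rintro rfl
        exact hxR.ne' hyx
      have h1 := (hb x hxU.1 hxU.2).2.2.2 y hux hyτ'
      have h2 := h hxU
      simp only [Pi.neg_apply] at h2
      rw [h2, rt_ofReal hxR.le, Complex.neg_re, Complex.ofReal_re] at h1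
      linarith [Real.sqrt_nonneg (K.Rh - x)]
  filter_upwards [self_mem_nhdsWithin, mem_nhdsWithin_of_mem_nhds (ball_mem_nhds _ hε)]
    with z hz hz'
  rw [← key ⟨hz', hz⟩]
  exact (hb z hz' hz).1.symm

end BusyKernel

/-! ### Transfer between functions of `(R - z)^{1/2}` and functions of `z` -/

theorem tendsto_rt_slit (R : ℝ) : Tendsto (rt R) (𝓝[slit R] (R : ℂ)) (𝓝[≠] 0) :=
  tendsto_nhdsWithin_iff.2 ⟨(tendsto_rt R).mono_left nhdsWithin_le_nhds, by
    filter_upwards [self_mem_nhdsWithin] with z hz using rt_ne_zero (ne_of_mem_slit hz)⟩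

theorem tendsto_rt_ball (R : ℝ) : Tendsto (rt R) (𝓝[ball 0 R] (R : ℂ)) (𝓝[≠] 0) :=
  (tendsto_rt_slit R).mono_left (nhdsWithin_mono _ (ball_subset_slit R))

/-- An expansion in powers of `(R - z)^{1/2}` gives a relation in a Delta-domain. -/
theorem hasDeltaExpansion_of_sqrt {f F H g e : ℂ → ℂ} {R : ℝ} (hR : 1 < R)
    (hF : DifferentiableOn ℂ F (ball 0 R)) (hFf : ∀ z, ‖z‖ < 1 → F z = f z)
    (hζ : ∀ ζ : ℂ, ‖ζ‖ = R → ζ ≠ R → Continues F R ζ)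
    (hH : ∀ᶠ s in 𝓝[≠] (0 : ℂ), AnalyticAt ℂ H s)
    (hFH : ∀ᶠ z in 𝓝[ball 0 R] (R : ℂ), F z = H (rt R z))
    (ho : (fun s => H s - g s) =o[𝓝[≠] 0] e) :
    PriorityRetrial.HasDeltaExpansion f R (fun z => g (rt R z)) (fun z => e (rt R z)) := by
  obtain ⟨ε₁, hε₁, h₁⟩ := Metric.eventually_nhds_iff_ball.1
    (eventually_nhdsWithin_iff.1 ((tendsto_rt_slit R).eventually hH))
  obtain ⟨ε₂, hε₂, h₂⟩ := Metric.eventually_nhds_iff_ball.1 (eventually_nhdsWithin_iff.1 hFH)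
  refine hasDeltaExpansion_of_local (G₀ := fun z => H (rt R z)) (ε := min ε₁ ε₂) hR
    (lt_min hε₁ hε₂) hF hFf hζ ?_ ?_ (ho.comp_tendsto (tendsto_rt_slit R))
  · intro z hz
    exact ((h₁ z (ball_subset_ball (min_le_left _ _) hz.1) hz.2).differentiableAt.comp z
      (hasDerivAt_rt hz.2).differentiableAt).differentiableWithinAt
  · intro z hz hzR
    exact (h₂ z (ball_subset_ball (min_le_right _ _) hz) (mem_ball_zero_iff.2 hzR)).symm

theorem tendsto_of_sqrt {F H : ℂ → ℂ} {R : ℝ} (hR : 0 < R) (hH : ContinuousAt H 0)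
    (hFH : ∀ᶠ z in 𝓝[ball 0 R] (R : ℂ), F z = H (rt R z)) :
    Tendsto (fun x : ℝ => F x) (𝓝[<] R) (𝓝 (H 0)) := by
  have h1 : Tendsto (fun z => H (rt R z)) (𝓝[ball 0 R] (R : ℂ)) (𝓝 (H 0)) :=
    hH.tendsto.comp ((tendsto_rt_ball R).mono_right nhdsWithin_le_nhds)
  have h2 : Tendsto F (𝓝[ball 0 R] (R : ℂ)) (𝓝 (H 0)) :=
    h1.congr' (by filter_upwards [hFH] with z hz using hz.symm)
  exact h2.comp (tendsto_ofReal_nhdsLT_nhdsWithin_ball hR)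

/-- Abel's theorem for nonnegative coefficients, with a complex limit. -/
theorem convergesAt_of_tendsto {F : ℂ → ℂ} {R : ℝ} {L : ℂ} (hR : 0 < R)
    (hF : DifferentiableOn ℂ F (ball 0 R)) (h : ∀ N, NonnegCoeff F N)
    (hL : Tendsto (fun x : ℝ => F x) (𝓝[<] R) (𝓝 L)) :
    PriorityRetrial.ConvergesAt F R ∧ (PriorityRetrial.val F R : ℂ) = L := by
  have hre : Tendsto (fun x : ℝ => (F x).re) (𝓝[<] R) (𝓝 L.re) :=
    (Complex.continuous_re.tendsto L).comp hL
  have hs := hasSum_coeff_of_tendsto hR hF h hre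
  refine ⟨hs.summable, ?_⟩
  have hv : PriorityRetrial.val F R = L.re := hs.tsum_eq
  rw [hv]
  have h1 : Tendsto (fun x : ℝ => ((F x).re : ℂ)) (𝓝[<] R) (𝓝 (L.re : ℂ)) :=
    (Complex.continuous_ofReal.tendsto _).comp hre
  refine tendsto_nhds_unique h1 (hL.congr' ?_)
  have h2 : ∀ᶠ x : ℝ in 𝓝[<] R, 0 < x := mem_nhdsWithin_of_mem_nhds (lt_mem_nhds hR)
  filter_upwards [h2, self_mem_nhdsWithin] with x hx hxR
  exact eq_ofReal_of_nonnegCoeff hF h hx.le hxR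

theorem isLittleO_sub_linear {H : ℂ → ℂ} {c : ℂ} (hc : c ≠ 0) (hH : HasDerivAt H (-c) 0) :
    (fun s => H s - (H 0 - c * s)) =o[𝓝[≠] 0] fun s => c * s := by
  have h1 := hasDerivAt_iff_isLittleO.1 hH
  refine IsLittleO.mono (l' := 𝓝 (0 : ℂ)) ?_ nhdsWithin_le_nhds
  refine ((isLittleO_const_mul_right_iff hc).2 h1).congr (fun s => ?_) (fun s => ?_)
  · simp only [sub_zero, smul_eq_mul]; ring
  · rw [sub_zero]

/-- m(s) - m(0) tends to 0, which is negligible against the nonzero constant m(0); both are then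
divided by s. -/
theorem isLittleO_div_sub {m : ℂ → ℂ} (hm : ContinuousAt m 0) (h0 : m 0 ≠ 0) :
    (fun s => m s / s - m 0 / s) =o[𝓝[≠] 0] fun s => m 0 / s := by
  have h1 : (fun s => m s - m 0) =o[𝓝[≠] 0] fun _ => m 0 := by
    rw [isLittleO_const_iff h0]
    have : Tendsto (fun s => m s - m 0) (𝓝 0) (𝓝 0) := by
      simpa using hm.tendsto.sub_const (m 0)
    exact this.mono_left nhdsWithin_le_nhds
  refine (h1.mul_isBigO (isBigO_refl (fun s : ℂ => s⁻¹) (𝓝[≠] 0))).congr (fun s => ?_) (fun s => ?_)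
  · rw [← sub_div, div_eq_mul_inv]
  · rw [div_eq_mul_inv]

namespace BusyKernel

variable (K : BusyKernel)

/-! ### The function `h` at `R_h` -/

theorem tendsto_u_Rh : Tendsto K.u (𝓝[ball 0 K.Rh] (K.Rh : ℂ)) (𝓝 (K.τ : ℂ)) := by
  have huR : K.u K.Rh = K.τ := K.u_psi K.lam_lt_tau'.le le_rfl
  rw [← huR]
  refine (K.continuousOn_u K.Rh (mem_closedBall_zero_iff.2 ?_)).mono_left
    (nhdsWithin_mono _ ball_subset_closedBall)
  rw [Complex.norm_real, Real.norm_of_nonneg K.Rh_pos.le]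

theorem hasSum_hh_Rh : PriorityRetrial.ConvergesAt K.hh K.Rh ∧
    (PriorityRetrial.val K.hh K.Rh : ℂ) = K.a K.τ := by
  refine convergesAt_of_tendsto K.Rh_pos K.differentiableOn_hh K.nonnegCoeff_hh ?_
  rw [← K.ofReal K.τ K.tau_lt]
  exact (K.analyticAt_A (by simpa using K.tau_lt)).continuousAt.tendsto.comp
    (K.tendsto_u_Rh.comp (tendsto_ofReal_nhdsLT_nhdsWithin_ball K.Rh_pos))

/-- Inside the disk the series has the value of the function; the endpoint t = τ comes from Abel's
theorem. -/
theorem val_hh {t : ℝ} (ht0 : K.lam ≤ t) (ht : t ≤ K.τ) :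
    PriorityRetrial.val K.hh (K.psi t) = K.a t := by
  rcases ht.eq_or_lt with rfl | h
  · exact_mod_cast K.hasSum_hh_Rh.2
  · have h1 : 0 ≤ K.psi t := by
      have := K.strictMonoOn_psi.monotoneOn K.lam_lt_tau'.le ht ht0
      rw [K.psi_lam] at this
      linarith
    have h2 : K.psi t < K.Rh := K.strictMonoOn_psi ht (Set.mem_Iic.2 le_rfl) h
    rw [val_eq_re K.differentiableOn_hh K.nonnegCoeff_hh h1 h2, K.hh_ofReal ht0 ht,
      Complex.ofReal_re]

/-- The coefficient of the square root in the expansion of `h` at `R_h`. -/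
noncomputable def ch : ℝ := √(2 * K.l2 / (K.l1 ^ 3 * K.a2 K.τ))

theorem ch_pos : 0 < K.ch := by
  have h1 := K.l1_pos
  have h2 := K.l2_pos
  have h3 := K.a2_pos K.τ K.tau_lt
  exact Real.sqrt_pos.2 (by positivity)

/-- Composition of A with the expansion of u. The chain rule contributes A'(τ) = 1/λ₁, which turns
λ₁ under the root into λ₁³. -/
theorem exists_hh_sqrt : ∃ w : ℂ → ℂ, AnalyticAt ℂ w 0 ∧ w 0 = K.a K.τ ∧
    HasDerivAt w (-(K.ch : ℂ)) 0 ∧ ∀ᶠ z in 𝓝[ball 0 K.Rh] (K.Rh : ℂ), K.hh z = w (rt K.Rh z) := by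
  obtain ⟨G, hG, hG0, hG', hev⟩ := K.exists_sqrt_expansion
  have hτ : ((K.τ : ℂ)).re < K.σ := by simpa using K.tau_lt
  refine ⟨fun s => K.A (G s), ?_, ?_, ?_, ?_⟩
  · refine AnalyticAt.fun_comp ?_ hG
    rw [hG0]
    exact K.analyticAt_A hτ
  · simp only [hG0]
    exact K.ofReal K.τ K.tau_lt
  · have h1 : HasDerivAt K.A (K.a1 K.τ) (G 0) := by
      rw [hG0, ← K.deriv_ofReal K.τ K.tau_lt]
      exact K.hasDerivAt_A hτ
    refine (h1.comp (0 : ℂ) hG').congr_deriv ?_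
    have h2 := K.l1_pos
    have h3 : K.a1 K.τ = 1 / K.l1 := by
      rw [eq_div_iff h2.ne', mul_comm]; exact K.a1_tau
    have h4 : K.ch = √(2 * K.l2 / (K.l1 * K.a2 K.τ)) / K.l1 := by
      have h5 : 2 * K.l2 / (K.l1 ^ 3 * K.a2 K.τ) =
          2 * K.l2 / (K.l1 * K.a2 K.τ) / K.l1 ^ 2 := by
        rw [div_div]; congr 1; ring
      rw [ch, h5, Real.sqrt_div' _ (by positivity), Real.sqrt_sq h2.le]
    rw [h3, h4]
    push_cast
    ring
  · filter_upwards [hev] with z hz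
    rw [hh, hz]

theorem continues_hh {ζ : ℂ} (hζ : ‖ζ‖ = K.Rh) (hne : ζ ≠ K.Rh) : Continues K.hh K.Rh ζ := by
  obtain ⟨g, hg, hgζ, e⟩ := K.exists_continuation_u hζ.le hne
  refine ⟨fun z => K.A (g z), ?_, ?_⟩
  · refine AnalyticAt.fun_comp ?_ hg
    rw [hgζ]
    exact K.analyticAt_A (K.u_re_lt_sigma hζ.le)
  · filter_upwards [nhdsWithin_mono _ ball_subset_closedBall e] with z hz
    rw [hz, hh]

theorem not_continues_hh : ¬ Continues K.hh K.Rh K.Rh := by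
  obtain ⟨w, -, -, hw', hev⟩ := K.exists_hh_sqrt
  exact not_continues_of_sqrt K.Rh_pos (neg_ne_zero.2 (by exact_mod_cast K.ch_pos.ne')) hw' hev

end BusyKernel

namespace Stage

variable (S : Stage)

/-! ### Local expansions at `r = R_h` -/

theorem r_eq (ht : S.t = S.τ) : S.r = S.Rh := by rw [r, ht]; rfl

/-- If `f₁(z) = k(s) / s` with `s = (r - z)^{1/2}`, then `Q` is an analytic function of `s`. -/
theorem exists_Q_sqrt {k : ℂ → ℂ} (hk : AnalyticAt ℂ k 0)
    (h : ∀ᶠ z in 𝓝[ball 0 S.r] (S.r : ℂ), S.F1 z = k (rt S.r z) / rt S.r z) :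
    ∃ q : ℂ → ℂ, AnalyticAt ℂ q 0 ∧ q 0 ≠ 0 ∧ HasDerivAt q (-2 * S.c * k 0 * q 0) 0 ∧
      ∀ᶠ z in 𝓝[ball 0 S.r] (S.r : ℂ), S.Q z = q (rt S.r z) := by
  obtain ⟨δ, hδ, hd⟩ := Metric.eventually_nhds_iff_ball.1 hk.eventually_analyticAt
  -- From z = r - s² follows dz = -2s ds, so f₁dz = (k/s)(-2s)ds = -2k ds has an analytic primitive
  -- in s.
  have hdiff : DifferentiableOn ℂ (fun s => -2 * k s) (ball 0 δ) := fun s hs =>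
    ((hd s hs).differentiableAt.const_mul _).differentiableWithinAt
  obtain ⟨Ψ, hΨ⟩ := hdiff.isExactOn_ball
  have aΨ : AnalyticAt ℂ Ψ 0 := by
    have : DifferentiableOn ℂ Ψ (ball 0 δ) := fun s hs =>
      (hΨ s hs).differentiableAt.differentiableWithinAt
    exact this.analyticAt (ball_mem_nhds _ hδ)
  have hmem : ∀ᶠ z in 𝓝[ball 0 S.r] (S.r : ℂ), rt S.r z ∈ ball (0 : ℂ) δ :=
    ((tendsto_rt_ball S.r).mono_right nhdsWithin_le_nhds).eventually (ball_mem_nhds _ hδ)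
  obtain ⟨ε, hε, hb⟩ := Metric.eventually_nhds_iff_ball.1
    (eventually_nhdsWithin_iff.1 (h.and hmem))
  obtain ⟨C, hC⟩ := exists_primitive_eq_add_const (s := ball (S.r : ℂ) ε ∩ ball 0 S.r)
    (isOpen_ball.inter isOpen_ball) ((convex_ball _ _).inter (convex_ball _ _)).isPreconnected
    (P := S.P) (P' := fun z => Ψ (rt S.r z)) (f := S.F1)
    (fun z hz => S.hasDerivAt_P (mem_ball_zero_iff.1 hz.2)) (fun z hz => by
      have hz' := hb z hz.1 hz.2
      have h1 := hasDerivAt_rt (ball_subset_slit _ hz.2)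
      have h2 := rt_ne_zero (ne_of_mem_slit (ball_subset_slit _ hz.2))
      refine ((hΨ _ hz'.2).comp z h1).congr_deriv ?_
      rw [hz'.1]
      field_simp)
  refine ⟨fun s => S.q0 * Complex.exp (S.c * (Ψ s + C - S.P 1)), ?_, ?_, ?_, ?_⟩
  · exact analyticAt_const.mul
      (analyticAt_const.mul ((aΨ.add analyticAt_const).sub analyticAt_const)).cexp
  · exact mul_ne_zero (by exact_mod_cast S.q0_pos.ne') (Complex.exp_ne_zero _)
  · have h1 := (((((hΨ 0 (mem_ball_self hδ)).add_const C).sub_const (S.P 1)).const_mul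
      (S.c : ℂ)).cexp).const_mul (S.q0 : ℂ)
    refine h1.congr_deriv ?_
    ring
  · filter_upwards [self_mem_nhdsWithin, mem_nhdsWithin_of_mem_nhds (ball_mem_nhds _ hε)]
      with z hz hz'
    rw [Q, hC z ⟨hz', hz⟩]

theorem convergesAt_Q_of_sqrt {q : ℂ → ℂ} (aq : AnalyticAt ℂ q 0)
    (hq : ∀ᶠ z in 𝓝[ball 0 S.r] (S.r : ℂ), S.Q z = q (rt S.r z)) :
    PriorityRetrial.ConvergesAt S.Q S.r ∧ (PriorityRetrial.val S.Q S.r : ℂ) = q 0 :=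
  convergesAt_of_tendsto S.r_pos S.differentiableOn_Q S.nonnegCoeff_Q
    (tendsto_of_sqrt S.r_pos aq.continuousAt hq)

/-- The expansion of `f₁` at `r = R_h`. -/
theorem exists_F1_sqrt (ht : S.t = S.τ) : ∃ w : ℂ → ℂ, AnalyticAt ℂ w 0 ∧ w 0 = S.a S.τ ∧
    HasDerivAt w (-(S.ch : ℂ)) 0 ∧ ∀ᶠ z in 𝓝[ball 0 S.r] (S.r : ℂ),
      S.F1 z = (1 - w (rt S.r z)) / (w (rt S.r z) - S.r + rt S.r z ^ 2) := by
  obtain ⟨w, aw, w0, w', hev⟩ := S.exists_hh_sqrt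
  rw [← S.r_eq ht] at hev
  refine ⟨w, aw, w0, w', ?_⟩
  have hne : ∀ᶠ z in 𝓝[ball 0 S.r] (S.r : ℂ), z ≠ 1 := by
    refine mem_nhdsWithin_of_mem_nhds (isOpen_ne.mem_nhds ?_)
    have : (S.r : ℂ) ≠ 1 := by exact_mod_cast S.one_lt_r.ne'
    exact this
  filter_upwards [hev, hne, self_mem_nhdsWithin] with z hz hz1 hzb
  have hzn := mem_ball_zero_iff.1 hzb
  rw [S.F1_eq (hzn.le.trans S.r_le) hz1 (S.one_sub_ne hzn.le (S.ne_r hzn)), hz, rt_sq]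
  congr 1
  ring

theorem a_tau_sub_r (ht : S.t = S.τ) :
    S.l2 * (S.a S.τ - S.r) = (S.τ - S.lam) * (S.lam * S.d S.τ - 1) := by
  have h1 := S.hh_sub (z := S.Rh) (by rw [Complex.norm_real, Real.norm_of_nonneg S.Rh_pos.le])
  have h2 := S.hh_ofReal S.lam_lt_tau'.le le_rfl
  have h3 := S.u_psi S.lam_lt_tau'.le le_rfl
  have h4 : S.psi S.τ = S.Rh := rfl
  rw [h4] at h2 h3
  rw [h2, h3, S.D_ofReal S.tau_lt] at h1
  rw [S.r_eq ht]
  exact_mod_cast h1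

/-- The expansions at `r = R_h` if `h(x) - x` has no zero in `(1, R_h]`. -/
theorem sqrt_expansion (ht : S.t = S.τ) (hd : S.lam * S.d S.τ < 1) :
    PriorityRetrial.ConvergesAt S.Q S.r ∧ ∃ (C : ℝ) (HR HP : ℂ → ℂ),
      C = S.lam / S.l2 * ((S.r - 1) / (S.a S.τ - S.r) ^ 2 * S.ch * PriorityRetrial.val S.Q S.r) ∧
      (C : ℂ) ≠ 0 ∧ AnalyticAt ℂ HR 0 ∧ AnalyticAt ℂ HP 0 ∧
      HasDerivAt HR (-(C : ℂ)) 0 ∧ HasDerivAt HP (-(C : ℂ)) 0 ∧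
      (∀ᶠ z in 𝓝[ball 0 S.r] (S.r : ℂ), S.R z = HR (rt S.r z)) ∧
      ∀ᶠ z in 𝓝[ball 0 S.r] (S.r : ℂ), S.P2 z = HP (rt S.r z) := by
  obtain ⟨w, aw, w0, w', hF⟩ := S.exists_F1_sqrt ht
  let e : ℂ → ℂ := fun s => w s - S.r + s ^ 2
  have ae : AnalyticAt ℂ e 0 := (aw.sub analyticAt_const).add (analyticAt_id.pow 2)
  have e0 : e 0 = ((S.a S.τ - S.r : ℝ) : ℂ) := by simp [e, w0]
  have har : S.a S.τ - S.r ≠ 0 := by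
    intro h0
    have h1 := S.a_tau_sub_r ht
    rw [h0, mul_zero] at h1
    have h2 : 0 < S.τ - S.lam := sub_pos.2 S.lam_lt_tau'
    have h3 : S.lam * S.d S.τ - 1 < 0 := by linarith
    exact (mul_neg_of_pos_of_neg h2 h3).ne h1.symm
  have e0' : e 0 ≠ 0 := by rw [e0]; exact_mod_cast har
  have e' : HasDerivAt e (-(S.ch : ℂ)) 0 := by
    have h1 := (w'.sub_const (S.r : ℂ)).add ((hasDerivAt_id (0 : ℂ)).pow 2)
    refine h1.congr_deriv ?_
    simp
  let Φ : ℂ → ℂ := fun s => (1 - w s) / e s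
  have aΦ : AnalyticAt ℂ Φ 0 := (analyticAt_const.sub aw).div ae e0'
  have Φ' := (w'.const_sub 1).div e' e0'
  have hk : ∀ᶠ z in 𝓝[ball 0 S.r] (S.r : ℂ), S.F1 z = rt S.r z * Φ (rt S.r z) / rt S.r z := by
    filter_upwards [hF, self_mem_nhdsWithin] with z hz hzb
    have h2 := rt_ne_zero (ne_of_mem_slit (ball_subset_slit _ hzb))
    rw [hz, mul_div_cancel_left₀ _ h2]
  -- Here f₁ = Φ(s) is bounded, so k(s) = sΦ(s) vanishes at 0 and Q has no linear term in s. Its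
  -- contribution to the square root terms of R and P₂ is only the factor Q(r).
  obtain ⟨q, aq, q0, q', hq⟩ := S.exists_Q_sqrt (k := fun s => s * Φ s) (analyticAt_id.mul aΦ) hk
  obtain ⟨hQc, hQv⟩ := S.convergesAt_Q_of_sqrt aq hq
  have q'' : HasDerivAt q 0 0 := q'.congr_deriv (by simp)
  have hratio := S.ratio_pos
  refine ⟨hQc, _, fun s => (S.lam / S.l2 : ℝ) * (Φ s * q s),
    fun s => q s + (S.lam / S.l2 : ℝ) * (Φ s * q s), rfl, ?_,
    analyticAt_const.mul (aΦ.mul aq), aq.add (analyticAt_const.mul (aΦ.mul aq)), ?_, ?_, ?_, ?_⟩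
  · rw [Complex.ofReal_mul, Complex.ofReal_mul]
    refine mul_ne_zero (by exact_mod_cast hratio.ne') (mul_ne_zero ?_ (by rw [hQv]; exact q0))
    have h1 : 0 < S.r - 1 := sub_pos.2 S.one_lt_r
    have h2 := S.ch_pos
    have h3 : 0 < (S.a S.τ - S.r) ^ 2 := by positivity
    exact_mod_cast (by positivity : 0 < (S.r - 1) / (S.a S.τ - S.r) ^ 2 * S.ch).ne'
  all_goals
    have hR' : HasDerivAt (fun s => ((S.lam / S.l2 : ℝ) : ℂ) * (Φ s * q s))
        (-((S.lam / S.l2 * ((S.r - 1) / (S.a S.τ - S.r) ^ 2 * S.ch *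
          PriorityRetrial.val S.Q S.r) : ℝ) : ℂ)) 0 := by
      refine ((Φ'.mul q'').const_mul ((S.lam / S.l2 : ℝ) : ℂ)).congr_deriv ?_
      have har' : ((S.a S.τ : ℂ) - S.r) ≠ 0 := by exact_mod_cast har
      rw [e0, w0]
      push_cast
      rw [hQv]
      field_simp
      ring
    have hRev : ∀ᶠ z in 𝓝[ball 0 S.r] (S.r : ℂ),
        S.R z = ((S.lam / S.l2 : ℝ) : ℂ) * (Φ (rt S.r z) * q (rt S.r z)) := by
      filter_upwards [hF, hq] with z hz hz'
      rw [R, hz, hz']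
  · exact hR'
  · simpa using! q''.add hR'
  · exact hRev
  · filter_upwards [hRev, hq] with z hz hz'
    rw [P2, hz, hz']

/-- The expansions at `r = R_h` if `R_h` is a zero of `h(x) - x`. -/
theorem inv_sqrt_expansion (ht : S.t = S.τ) (hd : S.lam * S.d S.τ = 1) :
    PriorityRetrial.ConvergesAt S.Q S.r ∧ ∃ (C : ℝ) (mR mP : ℂ → ℂ),
      C = S.lam / S.l2 * ((S.r - 1) / S.ch * PriorityRetrial.val S.Q S.r) ∧
      (C : ℂ) ≠ 0 ∧ AnalyticAt ℂ mR 0 ∧ AnalyticAt ℂ mP 0 ∧ mR 0 = C ∧ mP 0 = C ∧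
      (∀ᶠ z in 𝓝[ball 0 S.r] (S.r : ℂ), S.R z = mR (rt S.r z) / rt S.r z) ∧
      ∀ᶠ z in 𝓝[ball 0 S.r] (S.r : ℂ), S.P2 z = mP (rt S.r z) / rt S.r z := by
  obtain ⟨w, aw, w0, w', hF⟩ := S.exists_F1_sqrt ht
  let e : ℂ → ℂ := fun s => w s - S.r + s ^ 2
  have ae : AnalyticAt ℂ e 0 := (aw.sub analyticAt_const).add (analyticAt_id.pow 2)
  have har : S.a S.τ = S.r := by
    have h1 := S.a_tau_sub_r ht
    rw [hd, sub_self, mul_zero] at h1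
    have := (mul_eq_zero.1 h1).resolve_left S.l2_pos.ne'
    linarith
  have e0 : e 0 = 0 := by simp [e, w0, har]
  have e' : HasDerivAt e (-(S.ch : ℂ)) 0 := by
    have h1 := (w'.sub_const (S.r : ℂ)).add ((hasDerivAt_id (0 : ℂ)).pow 2)
    refine h1.congr_deriv ?_
    simp
  -- h - z vanishes at s = 0 but has derivative -c_h ≠ 0 in s, so f₁ has a simple pole in s with
  -- coefficient (1 - r)/(-c_h).
  let e1 : ℂ → ℂ := dslope e 0
  have ae1 : AnalyticAt ℂ e1 0 := analyticAt_dslope ae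
  have e10 : e1 0 = -(S.ch : ℂ) := by simp only [e1]; rw [dslope_same, e'.deriv]
  have hch : (S.ch : ℂ) ≠ 0 := by exact_mod_cast S.ch_pos.ne'
  have e10' : e1 0 ≠ 0 := by rw [e10]; exact neg_ne_zero.2 hch
  have he1 : ∀ s, e s = s * e1 s := fun s => by
    have := eq_sub_mul_dslope e0 s
    rwa [sub_zero] at this
  let k : ℂ → ℂ := fun s => (1 - w s) / e1 s
  have ak : AnalyticAt ℂ k 0 := (analyticAt_const.sub aw).div ae1 e10'
  have k0 : k 0 = (((S.r - 1) / S.ch : ℝ) : ℂ) := by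
    simp only [k]
    rw [e10, w0, har]
    push_cast
    rw [← neg_div_neg_eq]
    congr 1 <;> ring
  have hk : ∀ᶠ z in 𝓝[ball 0 S.r] (S.r : ℂ), S.F1 z = k (rt S.r z) / rt S.r z := by
    filter_upwards [hF] with z hz
    have h1 := he1 (rt S.r z)
    simp only [e] at h1
    rw [hz, h1]
    simp only [k]
    rw [div_div, mul_comm]
  obtain ⟨q, aq, q0, q', hq⟩ := S.exists_Q_sqrt ak hk
  obtain ⟨hQc, hQv⟩ := S.convergesAt_Q_of_sqrt aq hq
  have hratio := S.ratio_pos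
  have amR : AnalyticAt ℂ (fun s => ((S.lam / S.l2 : ℝ) : ℂ) * (k s * q s)) 0 :=
    analyticAt_const.mul (ak.mul aq)
  have hC : ((S.lam / S.l2 : ℝ) : ℂ) * (k 0 * q 0) =
      ((S.lam / S.l2 * ((S.r - 1) / S.ch * PriorityRetrial.val S.Q S.r) : ℝ) : ℂ) := by
    rw [k0, ← hQv]
    push_cast
    ring
  have hRev : ∀ᶠ z in 𝓝[ball 0 S.r] (S.r : ℂ),
      S.R z = ((S.lam / S.l2 : ℝ) : ℂ) * (k (rt S.r z) * q (rt S.r z)) / rt S.r z := by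
    filter_upwards [hk, hq] with z hz hz'
    rw [R, hz, hz']
    ring
  -- In P₂ = Q + R the bounded function Q is written as s·q(s)/s, so it does not change the
  -- coefficient of 1/s.
  refine ⟨hQc, _, fun s => (S.lam / S.l2 : ℝ) * (k s * q s),
    fun s => s * q s + (S.lam / S.l2 : ℝ) * (k s * q s), rfl, ?_, amR,
    (analyticAt_id.mul aq).add amR, hC, ?_, hRev, ?_⟩
  · rw [← hC]
    refine mul_ne_zero (by exact_mod_cast hratio.ne') (mul_ne_zero ?_ q0)
    rw [k0]
    have h1 : 0 < S.r - 1 := sub_pos.2 S.one_lt_r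
    have h2 := S.ch_pos
    exact_mod_cast (by positivity : 0 < (S.r - 1) / S.ch).ne'
  · simp only [zero_mul, zero_add]
    exact hC
  · filter_upwards [hRev, hq, self_mem_nhdsWithin] with z hz hz' hzb
    have h2 := rt_ne_zero (ne_of_mem_slit (ball_subset_slit _ hzb))
    rw [P2, hz, hz']
    field_simp

end Stage

/-! ### A pole of `f₁` at `r < R_h` -/

/-- A product of an analytic function and a power of `R - z` gives a relation in a
Delta-domain. -/
theorem hasDeltaExpansion_of_cpow {f F m : ℂ → ℂ} {R : ℝ} {β : ℂ} (hR : 1 < R)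
    (hF : DifferentiableOn ℂ F (ball 0 R)) (hFf : ∀ z, ‖z‖ < 1 → F z = f z)
    (hζ : ∀ ζ : ℂ, ‖ζ‖ = R → ζ ≠ R → Continues F R ζ) (hm : AnalyticAt ℂ m R) (h0 : m R ≠ 0)
    (hFm : ∀ᶠ z in 𝓝[ball 0 R] (R : ℂ), F z = m z * ((R : ℂ) - z) ^ β) :
    PriorityRetrial.HasDeltaExpansion f R (fun z => m R * ((R : ℂ) - z) ^ β)
      (fun z => m R * ((R : ℂ) - z) ^ β) := by
  obtain ⟨ε₁, hε₁, h₁⟩ := Metric.eventually_nhds_iff_ball.1 hm.eventually_analyticAt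
  obtain ⟨ε₂, hε₂, h₂⟩ := Metric.eventually_nhds_iff_ball.1 (eventually_nhdsWithin_iff.1 hFm)
  refine hasDeltaExpansion_of_local (G₀ := fun z => m z * ((R : ℂ) - z) ^ β) (ε := min ε₁ ε₂) hR
    (lt_min hε₁ hε₂) hF hFf hζ ?_ ?_ ?_
  · intro z hz
    exact ((h₁ z (ball_subset_ball (min_le_left _ _) hz.1)).differentiableAt.mul
      (hasDerivAt_cpow_sub hz.2 β).differentiableAt).differentiableWithinAt
  · intro z hz hzR
    exact (h₂ z (ball_subset_ball (min_le_right _ _) hz) (mem_ball_zero_iff.2 hzR)).symm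
  · have h1 : (fun z => m z - m R) =o[𝓝[slit R] (R : ℂ)] fun _ => m R := by
      rw [isLittleO_const_iff h0]
      have : Tendsto (fun z => m z - m R) (𝓝 (R : ℂ)) (𝓝 0) := by
        simpa using hm.continuousAt.tendsto.sub_const (m R)
      exact this.mono_left nhdsWithin_le_nhds
    refine (h1.mul_isBigO (isBigO_refl (fun z : ℂ => ((R : ℂ) - z) ^ β) _)).congr_left fun z => ?_
    ring

namespace BusyKernel

variable (K : BusyKernel)

/-- d(x) is the mean of the increasing function A' over [λ, x]. The strict inequality makes the pole
of f₁ simple. -/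
theorem d_lt_a1 {x : ℝ} (hx : K.lam < x) (hxσ : x < K.σ) : K.d x < K.a1 x := by
  have hc : ∫ _ in (0 : ℝ)..1, K.a1 x = K.a1 x := by simp
  rw [← hc]
  refine intervalIntegral.integral_lt_integral_of_continuousOn_of_le_of_exists_lt zero_lt_one
    (K.continuousOn_a1_segment hxσ K.lam_lt_sigma) continuousOn_const (fun t ht => ?_)
    ⟨0, by simp, ?_⟩
  · have h0 : K.lam + t * (x - K.lam) ≤ x := by nlinarith [ht.2]
    exact K.strictMonoOn_a1.monotoneOn (h0.trans_lt hxσ) hxσ h0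
  · simpa using K.strictMonoOn_a1 K.lam_lt_sigma hxσ hx

/-- Obtained by differentiating (w - λ)D(w) = A(w) - 1. -/
theorem hasDerivAt_D {x : ℝ} (hx : K.lam < x) (hxσ : x < K.σ) :
    HasDerivAt K.D (((K.a1 x - K.d x) / (x - K.lam) : ℝ) : ℂ) x := by
  have hre : ((x : ℂ)).re < K.σ := by simpa using hxσ
  have h1 := (K.analyticAt_D hre).differentiableAt.hasDerivAt
  have h2 := ((hasDerivAt_id (x : ℂ)).sub_const (K.lam : ℂ)).mul h1
  have h3 : HasDerivAt (fun w => (w - K.lam) * K.D w) (deriv K.A x) x := by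
    have h4 : (fun w => (w - K.lam) * K.D w) = fun w => K.A w - 1 := funext K.sub_mul_D
    rw [h4]
    exact (K.hasDerivAt_A hre).sub_const 1
  have h5 := h2.unique h3
  rw [K.deriv_ofReal x hxσ, K.D_ofReal hxσ] at h5
  simp only [id, one_mul] at h5
  refine h1.congr_deriv ?_
  have h6 : (x : ℂ) - K.lam ≠ 0 := sub_ne_zero.2 (by exact_mod_cast hx.ne')
  push_cast
  rw [eq_div_iff h6]
  linear_combination h5

end BusyKernel

namespace Stage

variable (S : Stage)

/-- The residue constant `c_{f₁}^{(1)}`. -/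
noncomputable def cf : ℝ :=
  (1 - S.r) * (1 - S.l1 * S.a1 S.t) / (1 - S.lam * S.a1 S.t)

/-- The integrand of the constant `c_Q^{(1)}`. -/
noncomputable def integrand (x : ℝ) : ℝ :=
  (1 - PriorityRetrial.val S.hh x) / (PriorityRetrial.val S.hh x - x) - S.cf / (S.r - x)

/-- The constant `c_Q^{(1)}`. -/
noncomputable def cQ : ℝ :=
  S.q0 * (S.r - 1) ^ (S.c * S.cf) * Real.exp (-S.c * ∫ x in S.r..1, S.integrand x)

theorem one_lt_lam_mul_a1 (hd : S.lam * S.d S.t = 1) : 1 < S.lam * S.a1 S.t := by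
  rw [← hd]
  exact mul_lt_mul_of_pos_left (S.d_lt_a1 S.lam_lt_t S.t_lt_sigma) S.lam_pos

/-- Both 1 - r and the denominator 1 - λA'(t) are negative, while 1 - λ₁A'(t) > 0 because t < τ. -/
theorem cf_pos (ht : S.t < S.τ) (hd : S.lam * S.d S.t = 1) : 0 < S.cf := by
  have h1 := S.one_lt_lam_mul_a1 hd
  have h2 := S.l1_mul_a1_lt ht
  have h3 := S.one_lt_r
  rw [cf, ← neg_div_neg_eq]
  exact div_pos (by nlinarith) (by linarith)

theorem cQ_pos : 0 < S.cQ := by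
  have h1 : 0 < S.r - 1 := sub_pos.2 S.one_lt_r
  have h2 := S.q0_pos
  rw [cQ]
  positivity

theorem r_lt_Rh (ht : S.t < S.τ) : S.r < S.Rh :=
  S.strictMonoOn_psi ht.le (Set.mem_Iic.2 le_rfl) ht

/-- At a zero of h(x) - x one has h(r) = r, so t = u(r) = λ₁r + λ₂r. -/
theorem lam_mul_r (hd : S.lam * S.d S.t = 1) : S.lam * S.r = S.t ∧ S.a S.t = S.r := by
  have h1 := S.hh_sub (z := S.r) (S.norm_r.le.trans S.r_le)
  have h2 : S.hh S.r = S.a S.t := S.hh_ofReal S.lam_lt_t.le S.t_le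
  rw [h2, S.u_r, S.D_ofReal S.t_lt_sigma] at h1
  have h3 : S.l2 * (S.a S.t - S.r) = (S.t - S.lam) * (S.lam * S.d S.t - 1) := by
    exact_mod_cast h1
  rw [hd, sub_self, mul_zero] at h3
  have h4 : S.a S.t = S.r := by
    have := (mul_eq_zero.1 h3).resolve_left S.l2_pos.ne'
    linarith
  refine ⟨?_, h4⟩
  have h5 : S.l2 * S.r + S.l1 * S.a S.t = S.t := S.psi_mul S.t
  rw [h4] at h5
  rw [BusyKernel.lam]
  linarith

/-- The function `(r - z) f₁(z)`. -/
noncomputable def kap (z : ℂ) : ℂ :=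
  S.l2 * S.D (S.u z) / dslope (fun z => S.lam * S.D (S.u z)) S.r z

theorem analyticAt_lam_D {z : ℂ} (hz : ‖z‖ < S.Rh) :
    AnalyticAt ℂ (fun z => S.lam * S.D (S.u z)) z :=
  analyticAt_const.mul ((S.analyticAt_D (S.u_re_lt_sigma hz.le)).comp (S.analyticAt_u hz))

theorem sub_mul_dslope_lam_D (hd : S.lam * S.d S.t = 1) (z : ℂ) :
    (S.r - z) * dslope (fun z => S.lam * S.D (S.u z)) S.r z = 1 - S.lam * S.D (S.u z) := by
  have h := sub_smul_dslope (fun z => S.lam * S.D (S.u z)) S.r z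
  have h1 : (S.lam : ℂ) * S.D (S.u S.r) = 1 := by
    rw [S.u_r, S.D_ofReal S.t_lt_sigma]; exact_mod_cast hd
  rw [smul_eq_mul] at h
  simp only [h1] at h
  linear_combination -h

theorem kap_eq (hd : S.lam * S.d S.t = 1) {z : ℂ} (hz : z ≠ S.r) :
    S.F1 z = S.kap z / (S.r - z) := by
  have h1 : (S.r : ℂ) - z ≠ 0 := sub_ne_zero.2 hz.symm
  rw [BusyKernel.F1, kap, ← S.sub_mul_dslope_lam_D hd, div_div, mul_comm (_ - _)]

theorem analyticAt_kap_of_norm_lt (hd : S.lam * S.d S.t = 1) {z : ℂ} (hz : ‖z‖ < S.r) :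
    AnalyticAt ℂ S.kap z := by
  have h1 : AnalyticAt ℂ (fun z => (S.r - z) * S.F1 z) z :=
    (analyticAt_const.sub analyticAt_id).mul (S.analyticAt_F1 hz)
  refine h1.congr ?_
  filter_upwards [S.eventually_norm_lt hz] with w hw
  have h2 : (S.r : ℂ) - w ≠ 0 := sub_ne_zero.2 (S.ne_r hw).symm
  rw [S.kap_eq hd (S.ne_r hw)]
  field_simp

theorem deriv_lam_D (ht : S.t < S.τ) :
    deriv (fun z => S.lam * S.D (S.u z)) S.r =
      ((S.lam * ((S.a1 S.t - S.d S.t) / (S.t - S.lam) * (S.l2 / (1 - S.l1 * S.a1 S.t))) : ℝ) : ℂ) := by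
  have hr : ‖(S.r : ℂ)‖ < S.Rh := by rw [S.norm_r]; exact S.r_lt_Rh ht
  have h1 := S.hasDerivAt_u hr (by rw [S.u_r]; simpa using ht)
  rw [S.u_r, S.deriv_ofReal _ S.t_lt_sigma] at h1
  have h2 : HasDerivAt S.D (((S.a1 S.t - S.d S.t) / (S.t - S.lam) : ℝ) : ℂ) (S.u S.r) := by
    rw [S.u_r]
    exact S.hasDerivAt_D S.lam_lt_t S.t_lt_sigma
  have h3 := (h2.comp (S.r : ℂ) h1).const_mul (S.lam : ℂ)
  refine (HasDerivAt.deriv h3).trans ?_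
  push_cast
  rfl

/-- The derivative of λD(u(z)) at r is positive, since d(t) < A'(t) and u'(r) > 0, so f₁ has a
simple pole. The relations λd(t) = 1 and λr = t bring the coefficient to the stated form. -/
theorem analyticAt_kap_r (ht : S.t < S.τ) (hd : S.lam * S.d S.t = 1) :
    AnalyticAt ℂ S.kap S.r ∧ S.kap S.r = S.cf := by
  have hr : ‖(S.r : ℂ)‖ < S.Rh := by rw [S.norm_r]; exact S.r_lt_Rh ht
  have h1 : 0 < S.a1 S.t - S.d S.t := sub_pos.2 (S.d_lt_a1 S.lam_lt_t S.t_lt_sigma)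
  have h2 : 0 < 1 - S.l1 * S.a1 S.t := sub_pos.2 (S.l1_mul_a1_lt ht)
  have h3 : 0 < S.t - S.lam := sub_pos.2 S.lam_lt_t
  have h4 := S.l2_pos
  have h5 := S.lam_pos
  have h6 : dslope (fun z => S.lam * S.D (S.u z)) S.r S.r ≠ 0 := by
    rw [dslope_same, S.deriv_lam_D ht]
    exact_mod_cast (by positivity : 0 < S.lam * ((S.a1 S.t - S.d S.t) / (S.t - S.lam) *
      (S.l2 / (1 - S.l1 * S.a1 S.t)))).ne'
  refine ⟨AnalyticAt.div ?_ (analyticAt_dslope (S.analyticAt_lam_D hr)) h6, ?_⟩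
  · exact analyticAt_const.mul
      ((S.analyticAt_D (S.u_re_lt_sigma hr.le)).comp (S.analyticAt_u hr))
  · rw [kap, dslope_same, S.deriv_lam_D ht, S.u_r, S.D_ofReal S.t_lt_sigma, cf,
      ← Complex.ofReal_mul, ← Complex.ofReal_div]
    congr 1
    have h7 := S.one_lt_lam_mul_a1 hd
    have h8 := (S.lam_mul_r hd).1
    have h9 : 1 - S.lam * S.a1 S.t ≠ 0 := by linarith
    have h10 : S.lam * (1 - S.r) = -(S.t - S.lam) := by linarith
    have h11 : S.lam * (S.a1 S.t - S.d S.t) = -(1 - S.lam * S.a1 S.t) := by linarith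
    have e1 : S.l2 * S.d S.t / (S.lam * ((S.a1 S.t - S.d S.t) / (S.t - S.lam) *
        (S.l2 / (1 - S.l1 * S.a1 S.t)))) =
        S.d S.t * (S.t - S.lam) * (1 - S.l1 * S.a1 S.t) / (S.lam * (S.a1 S.t - S.d S.t)) := by
      field_simp
    rw [e1, h11, div_neg, ← neg_div]
    congr 1
    have e2 : S.t - S.lam = -(S.lam * (1 - S.r)) := by linarith
    rw [e2]
    linear_combination (1 - S.r) * (1 - S.l1 * S.a1 S.t) * hd

/-- The regular part of `f₁` at `r`. -/
noncomputable def reg (z : ℂ) : ℂ := -dslope S.kap S.r z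

theorem analyticAt_reg_r (ht : S.t < S.τ) (hd : S.lam * S.d S.t = 1) :
    AnalyticAt ℂ S.reg S.r :=
  (analyticAt_dslope (S.analyticAt_kap_r ht hd).1).neg

theorem differentiableAt_reg (hd : S.lam * S.d S.t = 1) {z : ℂ} (hz : ‖z‖ < S.r) :
    DifferentiableAt ℂ S.reg z :=
  ((differentiableAt_dslope_of_ne (S.ne_r hz)).2
    (S.analyticAt_kap_of_norm_lt hd hz).differentiableAt).neg

theorem F1_eq_reg (ht : S.t < S.τ) (hd : S.lam * S.d S.t = 1) {z : ℂ} (hz : z ≠ S.r) :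
    S.F1 z = S.cf / (S.r - z) + S.reg z := by
  have h1 : (S.r : ℂ) - z ≠ 0 := sub_ne_zero.2 hz.symm
  have h2 := sub_smul_dslope S.kap S.r z
  rw [(S.analyticAt_kap_r ht hd).2, smul_eq_mul] at h2
  rw [S.kap_eq hd hz, reg]
  rw [div_add' _ _ _ h1]
  congr 1
  linear_combination -h2

theorem continuousOn_reg (ht : S.t < S.τ) (hd : S.lam * S.d S.t = 1) :
    ContinuousOn (fun x : ℝ => S.reg x) (Set.Icc 1 S.r) := by
  intro x hx
  have h1 : ContinuousAt S.reg (x : ℂ) := by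
    rcases hx.2.eq_or_lt with h | h
    · rw [h]; exact (S.analyticAt_reg_r ht hd).continuousAt
    · refine (S.differentiableAt_reg hd ?_).continuousAt
      rwa [Complex.norm_real, Real.norm_of_nonneg (by linarith [hx.1])]
  exact (h1.comp Complex.continuous_ofReal.continuousAt).continuousWithinAt

/-- The endpoints are excluded: at x = 1 the quotient defining f₁ is 0/0, and at x = r the integrand
divides by zero. They form a null set. -/
theorem reg_ofReal (ht : S.t < S.τ) (hd : S.lam * S.d S.t = 1) {x : ℝ}
    (hx : x ∈ Set.Ioo 1 S.r) : S.reg x = S.integrand x := by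
  have hx0 : 0 ≤ x := by linarith [hx.1]
  have hxn : ‖(x : ℂ)‖ < S.r := by rw [Complex.norm_real, Real.norm_of_nonneg hx0]; exact hx.2
  have hx1 : (x : ℂ) ≠ 1 := by exact_mod_cast hx.1.ne'
  have hxR := hx.2.trans_le S.r_le
  have h1 := S.F1_eq_reg ht hd (S.ne_r hxn)
  rw [S.F1_eq (hxn.le.trans S.r_le) hx1 (S.one_sub_ne hxn.le (S.ne_r hxn)),
    eq_ofReal_of_nonnegCoeff S.differentiableOn_hh S.nonnegCoeff_hh hx0 hxR,
    ← val_eq_re S.differentiableOn_hh S.nonnegCoeff_hh hx0 hxR] at h1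
  rw [integrand]
  push_cast
  rw [h1]
  ring

theorem integrand_ae_eq (ht : S.t < S.τ) (hd : S.lam * S.d S.t = 1) :
    ∀ᵐ x : ℝ, x ∈ Set.uIoc 1 S.r → S.reg x = S.integrand x := by
  have h1 : ∀ᵐ x : ℝ, x ≠ S.r := by simp [ae_iff]
  filter_upwards [h1] with x hx hx'
  rw [Set.uIoc_of_le S.one_lt_r.le] at hx'
  exact S.reg_ofReal ht hd ⟨hx'.1, lt_of_le_of_ne hx'.2 hx⟩

theorem intervalIntegrable_integrand (ht : S.t < S.τ) (hd : S.lam * S.d S.t = 1) :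
    IntervalIntegrable S.integrand volume S.r 1 := by
  have h1 : IntervalIntegrable (fun x : ℝ => (S.reg x).re) volume 1 S.r :=
    (Complex.continuous_re.comp_continuousOn
      (S.continuousOn_reg ht hd)).intervalIntegrable_of_Icc S.one_lt_r.le
  refine (h1.congr_ae ?_).symm
  rw [Filter.EventuallyEq, ae_restrict_iff' measurableSet_uIoc]
  filter_upwards [S.integrand_ae_eq ht hd] with x hx hx'
  rw [hx hx', Complex.ofReal_re]

theorem integral_reg (ht : S.t < S.τ) (hd : S.lam * S.d S.t = 1) :
    ∫ x in (1 : ℝ)..S.r, S.reg x = ((-∫ x in S.r..1, S.integrand x : ℝ) : ℂ) := by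
  rw [← intervalIntegral.integral_symm, ← intervalIntegral.integral_ofReal]
  exact intervalIntegral.integral_congr_ae (S.integrand_ae_eq ht hd)

theorem hasDerivAt_log_sub {z : ℂ} (hz : z ∈ slit S.r) :
    HasDerivAt (fun z : ℂ => -(S.cf * Complex.log (S.r - z))) (S.cf / (S.r - z)) z := by
  have h1 : HasDerivAt (fun z : ℂ => (S.r : ℂ) - z) (-1) z := by
    simpa using (hasDerivAt_id z).const_sub (S.r : ℂ)
  refine ((h1.clog hz).const_mul (S.cf : ℂ)).neg.congr_deriv ?_
  ring

/-- The local form of `Q` at a pole of `f₁`. -/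
theorem exists_Q_cpow (ht : S.t < S.τ) (hd : S.lam * S.d S.t = 1) :
    ∃ M : ℂ → ℂ, AnalyticAt ℂ M S.r ∧ M S.r = S.cQ ∧ ∀ᶠ z in 𝓝[ball 0 S.r] (S.r : ℂ),
      S.Q z = M z * ((S.r : ℂ) - z) ^ (-(S.c * S.cf : ℝ) : ℂ) := by
  obtain ⟨ε, hε, hb⟩ := Metric.eventually_nhds_iff_ball.1
    (S.analyticAt_reg_r ht hd).eventually_analyticAt
  have hdiff : DifferentiableOn ℂ S.reg (ball (S.r : ℂ) ε) := fun z hz =>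
    (hb z hz).differentiableAt.differentiableWithinAt
  obtain ⟨Γ, hΓ⟩ := hdiff.isExactOn_ball
  have aΓ : AnalyticAt ℂ Γ S.r := by
    have : DifferentiableOn ℂ Γ (ball (S.r : ℂ) ε) := fun s hs =>
      (hΓ s hs).differentiableAt.differentiableWithinAt
    exact this.analyticAt (ball_mem_nhds _ hε)
  obtain ⟨C, hC⟩ := exists_primitive_eq_add_const (s := ball (S.r : ℂ) ε ∩ ball 0 S.r)
    (isOpen_ball.inter isOpen_ball) ((convex_ball _ _).inter (convex_ball _ _)).isPreconnected
    (P := S.P) (P' := fun z => -(S.cf * Complex.log (S.r - z)) + Γ z) (f := S.F1)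
    (fun z hz => S.hasDerivAt_P (mem_ball_zero_iff.1 hz.2)) (fun z hz => by
      rw [S.F1_eq_reg ht hd (S.ne_r (mem_ball_zero_iff.1 hz.2))]
      exact (S.hasDerivAt_log_sub (ball_subset_slit _ hz.2)).add (hΓ z hz.1))
  have hnear : ∀ᶠ z in 𝓝[ball 0 S.r] (S.r : ℂ),
      S.P z = -(S.cf * Complex.log (S.r - z)) + Γ z + C := by
    filter_upwards [self_mem_nhdsWithin, mem_nhdsWithin_of_mem_nhds (ball_mem_nhds _ hε)]
      with z hz hz'
    exact hC z ⟨hz', hz⟩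
  -- the constant of integration
  have hconst : Γ S.r + C - S.P 1 =
      S.cf * Complex.log (S.r - 1) + ((-∫ x in S.r..1, S.integrand x : ℝ) : ℂ) := by
    -- Removing the logarithm from P leaves a primitive of the regular part of f₁. Integrated from 1
    -- to r, with its limit Γ(r) + C at r, it determines C.
    let f : ℝ → ℂ := fun x => S.P x - -(S.cf * Complex.log (S.r - (x : ℂ)))
    have hfd : ∀ x : ℝ, 0 ≤ x → x < S.r → HasDerivAt f (S.reg x) x := by
      intro x hx0 hxr
      have hxn : ‖(x : ℂ)‖ < S.r := by rw [Complex.norm_real, Real.norm_of_nonneg hx0]; exact hxr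
      have h1 := ((S.hasDerivAt_P hxn).sub
        (S.hasDerivAt_log_sub (mem_slit_of_norm_lt hxn))).comp_ofReal
      refine h1.congr_deriv ?_
      rw [S.F1_eq_reg ht hd (S.ne_r hxn)]
      ring
    have h1 := intervalIntegral.integral_eq_sub_of_hasDerivAt_of_tendsto (f := f)
      (f' := fun x : ℝ => S.reg x) (fa := f 1) (fb := Γ S.r + C) S.one_lt_r
      (fun x hx => hfd x (by linarith [hx.1]) hx.2)
      ((S.continuousOn_reg ht hd).intervalIntegrable_of_Icc S.one_lt_r.le)
      ((hfd 1 zero_le_one S.one_lt_r).continuousAt.tendsto.mono_left nhdsWithin_le_nhds) (by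
        have h2 : Tendsto (fun x : ℝ => Γ x + C) (𝓝[<] S.r) (𝓝 (Γ S.r + C)) :=
          ((aΓ.continuousAt.tendsto.comp (Complex.continuous_ofReal.tendsto S.r)).add_const
            C).mono_left nhdsWithin_le_nhds
        refine h2.congr' ?_
        filter_upwards [(tendsto_ofReal_nhdsLT_nhdsWithin_ball S.r_pos).eventually hnear]
          with x hx
        simp only [f, hx]
        ring)
    rw [S.integral_reg ht hd] at h1
    rw [h1]
    simp only [f, Complex.ofReal_one]
    ring
  refine ⟨fun z => S.q0 * Complex.exp (S.c * (Γ z + C - S.P 1)), ?_, ?_, ?_⟩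
  · exact analyticAt_const.mul
      (analyticAt_const.mul ((aΓ.add analyticAt_const).sub analyticAt_const)).cexp
  · have h1 : 0 < S.r - 1 := sub_pos.2 S.one_lt_r
    simp only [hconst]
    have h2 : Complex.log (S.r - 1) = (Real.log (S.r - 1) : ℂ) := by
      rw [Complex.ofReal_log h1.le]; push_cast; rfl
    have h3 : (S.c : ℂ) * (S.cf * Complex.log (S.r - 1) +
        ((-∫ x in S.r..1, S.integrand x : ℝ) : ℂ)) =
        ((Real.log (S.r - 1) * (S.c * S.cf) + -S.c * ∫ x in S.r..1, S.integrand x : ℝ) : ℂ) := by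
      rw [h2]; push_cast; ring
    rw [h3, ← Complex.ofReal_exp, ← Complex.ofReal_mul, Real.exp_add, cQ,
      Real.rpow_def_of_pos h1, mul_assoc]
  · filter_upwards [hnear, self_mem_nhdsWithin] with z hz hzb
    have h0 : (S.r : ℂ) - z ≠ 0 :=
      Complex.slitPlane_ne_zero (ball_subset_slit _ hzb)
    rw [Q, hz, Complex.cpow_def_of_ne_zero h0, mul_assoc, ← Complex.exp_add]
    congr 2
    push_cast
    ring

/-- The local forms of `R` and `P₂` at a pole of `f₁`. -/
theorem cpow_expansion (ht : S.t < S.τ) (hd : S.lam * S.d S.t = 1) :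
    ∃ (C : ℝ) (mR mP : ℂ → ℂ), C = S.lam / S.l2 * S.cQ * S.cf ∧ (C : ℂ) ≠ 0 ∧
      AnalyticAt ℂ mR S.r ∧ AnalyticAt ℂ mP S.r ∧ mR S.r = C ∧ mP S.r = C ∧
      (∀ᶠ z in 𝓝[ball 0 S.r] (S.r : ℂ),
        S.R z = mR z * ((S.r : ℂ) - z) ^ ((-1 - S.c * S.cf : ℝ) : ℂ)) ∧
      ∀ᶠ z in 𝓝[ball 0 S.r] (S.r : ℂ),
        S.P2 z = mP z * ((S.r : ℂ) - z) ^ ((-1 - S.c * S.cf : ℝ) : ℂ) := by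
  obtain ⟨M, aM, hM, hQ⟩ := S.exists_Q_cpow ht hd
  obtain ⟨ak, hk⟩ := S.analyticAt_kap_r ht hd
  have amR : AnalyticAt ℂ (fun z => ((S.lam / S.l2 : ℝ) : ℂ) * (S.kap z * M z)) S.r :=
    analyticAt_const.mul (ak.mul aM)
  -- Q carries one factor r - z more than R, so it drops out of the leading coefficient of P₂.
  have hpow : ∀ z ∈ ball (0 : ℂ) S.r, ((S.r : ℂ) - z) ^ (-(S.c * S.cf : ℝ) : ℂ) =
      (S.r - z) * ((S.r : ℂ) - z) ^ ((-1 - S.c * S.cf : ℝ) : ℂ) := by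
    intro z hz
    have h0 : (S.r : ℂ) - z ≠ 0 := Complex.slitPlane_ne_zero (ball_subset_slit _ hz)
    have h1 : ((-1 - S.c * S.cf : ℝ) : ℂ) = (-(S.c * S.cf : ℝ) : ℂ) - 1 := by push_cast; ring
    rw [h1, Complex.cpow_sub _ _ h0, Complex.cpow_one]
    field_simp
  have hC : ((S.lam / S.l2 : ℝ) : ℂ) * (S.kap S.r * M S.r) =
      ((S.lam / S.l2 * S.cQ * S.cf : ℝ) : ℂ) := by
    rw [hk, hM]; push_cast; ring
  have hRev : ∀ᶠ z in 𝓝[ball 0 S.r] (S.r : ℂ), S.R z = ((S.lam / S.l2 : ℝ) : ℂ) *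
      (S.kap z * M z) * ((S.r : ℂ) - z) ^ ((-1 - S.c * S.cf : ℝ) : ℂ) := by
    filter_upwards [hQ, self_mem_nhdsWithin] with z hz hzb
    have h0 : (S.r : ℂ) - z ≠ 0 := Complex.slitPlane_ne_zero (ball_subset_slit _ hzb)
    rw [R, hz, S.kap_eq hd (S.ne_r (mem_ball_zero_iff.1 hzb)), hpow z hzb]
    field_simp
  refine ⟨_, fun z => (S.lam / S.l2 : ℝ) * (S.kap z * M z),
    fun z => (S.r - z) * M z + (S.lam / S.l2 : ℝ) * (S.kap z * M z), rfl, ?_, amR,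
    ((analyticAt_const.sub analyticAt_id).mul aM).add amR, hC, ?_, hRev, ?_⟩
  · have h1 := S.ratio_pos
    have h2 := S.cQ_pos
    have h3 := S.cf_pos ht hd
    exact_mod_cast (by positivity : 0 < S.lam / S.l2 * S.cQ * S.cf).ne'
  · simp only [sub_self, zero_mul, zero_add]
    exact hC
  · filter_upwards [hRev, hQ, self_mem_nhdsWithin] with z hz hz' hzb
    rw [P2, hz, hz', hpow z hzb]
    ring

end Stage

/-! ### Exponentially tilted moments and the kernel of a type-1 law -/

open PriorityRetrial (lstRadius lstReal lst IsType1 load)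

/-- The moments of the exponentially tilted law. -/
noncomputable def tiltedMoment (μ : Measure ℝ) (n : ℕ) (t : ℝ) : ℝ :=
  ∫ x, x ^ n * Real.exp (t * x) ∂μ

theorem tiltedMoment_zero (μ : Measure ℝ) (t : ℝ) : tiltedMoment μ 0 t = mgf id μ t := by
  simp [tiltedMoment, mgf]

section Moments

variable {μ : Measure ℝ}

theorem hasDerivAt_tiltedMoment {t : ℝ} (ht : t ∈ interior (integrableExpSet id μ)) (n : ℕ) :
    HasDerivAt (tiltedMoment μ n) (tiltedMoment μ (n + 1) t) t :=
  hasDerivAt_integral_pow_mul_exp_real ht n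

theorem integrable_tiltedMoment {t : ℝ} (ht : t ∈ interior (integrableExpSet id μ)) (n : ℕ) :
    Integrable (fun x => x ^ n * Real.exp (t * x)) μ :=
  integrable_pow_mul_exp_of_mem_interior_integrableExpSet ht n

theorem iteratedDeriv_complexMGF_ofReal {t : ℝ} (ht : t ∈ interior (integrableExpSet id μ))
    (n : ℕ) : iteratedDeriv n (complexMGF id μ) t = (tiltedMoment μ n t : ℂ) := by
  rw [iteratedDeriv_complexMGF (by simpa using ht), tiltedMoment, ← integral_complex_ofReal]
  simp

theorem norm_deriv_complexMGF_le (hμ : ∀ᵐ x ∂μ, 0 ≤ x) {u : ℂ}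
    (hu : u.re ∈ interior (integrableExpSet id μ)) :
    ‖deriv (complexMGF id μ) u‖ ≤ tiltedMoment μ 1 u.re := by
  rw [(hasDerivAt_complexMGF hu).deriv]
  refine (norm_integral_le_integral_norm _).trans_eq (integral_congr_ae ?_)
  filter_upwards [hμ] with x hx
  simp [Complex.norm_exp, abs_of_nonneg hx]

/-- For a law on [0, ∞), integrability of e^{sx} gives integrability of e^{yx} for all y < s, so
everything below the supremum is interior. -/
theorem mem_interior_of_lt_lstRadius (hμ : ∀ᵐ x ∂μ, 0 ≤ x) {t : ℝ}
    (ht : (t : EReal) < lstRadius μ) : t ∈ interior (integrableExpSet id μ) := by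
  obtain ⟨s, hs⟩ := lt_iSup_iff.1 ht
  obtain ⟨hsμ, hts⟩ := lt_iSup_iff.1 hs
  refine mem_interior.2 ⟨Set.Iio s, fun y hy => ?_, isOpen_Iio, EReal.coe_lt_coe_iff.1 hts⟩
  have hint : Integrable (fun x => Real.exp (s * id x)) μ := hsμ
  refine hint.mono' (by fun_prop) ?_
  filter_upwards [hμ] with x hx
  rw [Real.norm_of_nonneg (Real.exp_pos _).le]
  exact Real.exp_le_exp.2 (mul_le_mul_of_nonneg_right (le_of_lt hy) hx)

theorem exists_le_mgf (htype : IsType1 μ) (M : ℝ) :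
    ∃ t : ℝ, 0 < t ∧ (t : EReal) < lstRadius μ ∧ M ≤ mgf id μ t := by
  obtain ⟨U, hU, hUM⟩ := mem_comap.1 (htype.2.eventually_ge_atTop M)
  obtain ⟨l, hl, hlU⟩ := (mem_nhdsLT_iff_exists_Ioo_subset' htype.1).1 hU
  obtain ⟨t, ht, htR⟩ := EReal.lt_iff_exists_real_btwn.1 (max_lt htype.1 hl)
  refine ⟨t, by exact_mod_cast (le_max_left _ _).trans_lt ht, htR, ?_⟩
  have := hUM (hlU ⟨(le_max_right _ _).trans_lt ht, htR⟩ : (t : EReal) ∈ U)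
  simpa [lstReal] using this

/-- If the service time vanished almost surely, its transform would be identically 1 and would not
tend to infinity. -/
theorem measure_Ioi_pos [IsProbabilityMeasure μ] (hμ : ∀ᵐ x ∂μ, 0 ≤ x) (htype : IsType1 μ) :
    0 < μ (Set.Ioi 0) := by
  rw [pos_iff_ne_zero]
  intro h0
  obtain ⟨t, -, -, ht⟩ := exists_le_mgf htype 2
  have h1 : mgf id μ t = 1 := by
    have : ∀ᵐ x ∂μ, Real.exp (t * id x) = 1 := by
      filter_upwards [hμ, measure_eq_zero_iff_ae_notMem.1 h0] with x hx hx0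
      have : x = 0 := le_antisymm (not_lt.1 hx0) hx
      simp [this]
    rw [mgf, integral_congr_ae this]
    simp
  linarith

theorem tiltedMoment_pos [IsProbabilityMeasure μ] (hμ : ∀ᵐ x ∂μ, 0 ≤ x) (htype : IsType1 μ)
    {t : ℝ} (ht : t ∈ interior (integrableExpSet id μ)) (n : ℕ) : 0 < tiltedMoment μ n t := by
  refine (integral_pos_iff_support_of_nonneg_ae ?_ (integrable_tiltedMoment ht n)).2
    ((measure_Ioi_pos hμ htype).trans_le (measure_mono fun x hx => ?_))
  · filter_upwards [hμ] with x hx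
    positivity
  · have : 0 < x := hx
    exact (by positivity : x ^ n * Real.exp (t * x) ≠ 0)

/-- Write mₙ(t) for the tilted moments. If the radius is infinite, e^{tx} ≥ 1 + tx gives m₁(t) ≥
m₁(0) + t m₂(0), and t = 1/(l m₂(0)) suffices. If the radius T is finite, e^y ≤ 1 + ye^y gives m₀(t)
≤ 1 + t m₁(t); the type-1 condition provides t < T with m₀(t) ≥ 1 + (T + 1)/l, which makes l m₁(t)
exceed 1. -/
theorem exists_one_lt_mul_tiltedMoment [IsProbabilityMeasure μ] (hμ : ∀ᵐ x ∂μ, 0 ≤ x)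
    (htype : IsType1 μ) {l : ℝ} (hl : 0 < l) :
    ∃ t : ℝ, 0 < t ∧ (t : EReal) < lstRadius μ ∧ 1 < l * tiltedMoment μ 1 t := by
  have h0 : (0 : ℝ) ∈ interior (integrableExpSet id μ) :=
    mem_interior_of_lt_lstRadius hμ (by simpa using htype.1)
  by_cases hT : lstRadius μ = ⊤
  · have hlt (t : ℝ) : (t : EReal) < lstRadius μ := by rw [hT]; exact EReal.coe_lt_top t
    have m1 := tiltedMoment_pos hμ htype h0 1
    have m2 := tiltedMoment_pos hμ htype h0 2
    set t : ℝ := 1 / (l * tiltedMoment μ 2 0) with ht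
    have ht0 : 0 < t := by positivity
    refine ⟨t, ht0, hlt t, ?_⟩
    have h1 : tiltedMoment μ 1 0 + t * tiltedMoment μ 2 0 ≤ tiltedMoment μ 1 t := by
      have i1 := integrable_tiltedMoment h0 1
      have i2 := integrable_tiltedMoment h0 2
      rw [tiltedMoment, tiltedMoment, tiltedMoment, ← integral_const_mul,
        ← integral_add i1 (i2.const_mul t)]
      refine integral_mono_ae (i1.add (i2.const_mul t))
        (integrable_tiltedMoment (mem_interior_of_lt_lstRadius hμ (hlt t)) 1) ?_
      filter_upwards [hμ] with x hx
      have := mul_le_mul_of_nonneg_left (Real.add_one_le_exp (t * x)) hx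
      simp only [zero_mul, Real.exp_zero, pow_one]
      nlinarith
    have h2 : l * (t * tiltedMoment μ 2 0) = 1 := by
      rw [ht]
      field_simp
    nlinarith [mul_pos hl m1, mul_le_mul_of_nonneg_left h1 hl.le]
  · lift lstRadius μ to ℝ using ⟨hT, ne_bot_of_gt htype.1⟩ with T hTμ
    have hTpos : 0 < T := by
      have := htype.1
      rw [← hTμ] at this
      exact_mod_cast this
    obtain ⟨t, ht0, htT, htM⟩ := exists_le_mgf htype (1 + (T + 1) / l)
    rw [← hTμ] at htT
    refine ⟨t, ht0, htT, ?_⟩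
    have hti := mem_interior_of_lt_lstRadius hμ (hTμ ▸ htT)
    have h1 : tiltedMoment μ 0 t ≤ 1 + t * tiltedMoment μ 1 t := by
      have e : (1 : ℝ) = ∫ _, (1 : ℝ) ∂μ := by simp
      have i1 := (integrable_tiltedMoment hti 1).const_mul t
      rw [e, tiltedMoment, tiltedMoment, ← integral_const_mul,
        ← integral_add (integrable_const _) i1]
      refine integral_mono (integrable_tiltedMoment hti 0) ((integrable_const _).add i1)
        fun x => ?_
      have h2 := mul_le_mul_of_nonneg_right (Real.add_one_le_exp (-(t * x)))
        (Real.exp_pos (t * x)).le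
      rw [← Real.exp_add, neg_add_cancel, Real.exp_zero] at h2
      simp only [pow_zero, one_mul, pow_one]
      linarith
    rw [tiltedMoment_zero] at h1
    have htT' : t < T := EReal.coe_lt_coe_iff.1 htT
    have m1 := tiltedMoment_pos hμ htype hti 1
    have h3 : (T + 1) / l ≤ t * tiltedMoment μ 1 t := by linarith
    rw [div_le_iff₀ hl] at h3
    nlinarith [mul_lt_mul_of_pos_right htT' (mul_pos hl m1)]

/-- The intermediate value theorem. The extra point s beyond t leaves room to the right of the
critical point, and serves as a finite bound even when the radius is infinite. -/
theorem exists_mul_tiltedMoment_eq_one [IsProbabilityMeasure μ] (hμ : ∀ᵐ x ∂μ, 0 ≤ x)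
    (htype : IsType1 μ) {l : ℝ} (hl : 0 < l) (h0 : l * tiltedMoment μ 1 0 < 1) :
    ∃ t s : ℝ, 0 < t ∧ t < s ∧ (s : EReal) < lstRadius μ ∧ l * tiltedMoment μ 1 t = 1 := by
  obtain ⟨s, hs0, hsR, hs⟩ := exists_one_lt_mul_tiltedMoment hμ htype hl
  have hc : ContinuousOn (fun t => l * tiltedMoment μ 1 t) (Set.Icc 0 s) := fun t ht =>
    ((hasDerivAt_tiltedMoment (mem_interior_of_lt_lstRadius hμ
      ((EReal.coe_le_coe_iff.2 ht.2).trans_lt hsR)) 1).continuousAt.const_mul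
        l).continuousWithinAt
  obtain ⟨t, ht, hte⟩ := intermediate_value_Ioo hs0.le hc ⟨h0, hs⟩
  exact ⟨t, s, ht.1, ht.2, hsR, hte⟩

end Moments

/-- The kernel `K` is built from the transform of `μ`, with rates `l1` and `l2`. -/
structure BusyKernel.IsFor (K : BusyKernel) (μ : Measure ℝ) (l1 l2 : ℝ) : Prop where
  l1_eq : K.l1 = l1
  l2_eq : K.l2 = l2
  A_eq : ∀ u, K.A u = complexMGF id μ (u - ((l1 + l2 : ℝ) : ℂ))
  a_eq : ∀ x, K.a x = mgf id μ (x - (l1 + l2))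

theorem exists_isFor {μ : Measure ℝ} [IsProbabilityMeasure μ] (hμ : ∀ᵐ x ∂μ, 0 ≤ x)
    (htype : IsType1 μ) {l1 l2 : ℝ} (hl1 : 0 < l1) (hl2 : 0 < l2) (hload : load μ l1 l2 < 1) :
    ∃ K : BusyKernel, K.IsFor μ l1 l2 := by
  have hload' : (l1 + l2) * tiltedMoment μ 1 0 < 1 := by
    simpa [load, tiltedMoment] using hload
  have h0 : (0 : ℝ) ∈ interior (integrableExpSet id μ) :=
    mem_interior_of_lt_lstRadius hμ (by simpa using htype.1)
  obtain ⟨t, s, ht0, hts, hsR, hte⟩ := exists_mul_tiltedMoment_eq_one hμ htype hl1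
    (by nlinarith [tiltedMoment_pos hμ htype h0 1])
  set lam : ℝ := l1 + l2 with hlam
  have hmem {x : ℝ} (hx : x < lam + s) : x - lam ∈ interior (integrableExpSet id μ) :=
    mem_interior_of_lt_lstRadius hμ
      ((EReal.coe_lt_coe_iff.2 (by linarith : x - lam < s)).trans hsR)
  have hmem' {u : ℂ} (hu : u.re < lam + s) :
      (u - (lam : ℂ)).re ∈ interior (integrableExpSet id μ) := by
    simpa using hmem hu
  have hd (n : ℕ) {x : ℝ} (hx : x < lam + s) :
      HasDerivAt (fun x => tiltedMoment μ n (x - lam)) (tiltedMoment μ (n + 1) (x - lam)) x := by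
    simpa using (hasDerivAt_tiltedMoment (hmem hx) n).comp_sub_const x lam
  have hder (u : ℂ) : deriv (fun u : ℂ => complexMGF id μ (u - (lam : ℂ))) u =
      deriv (complexMGF id μ) (u - (lam : ℂ)) := deriv_comp_sub_const ..
  have hiter (n : ℕ) {x : ℝ} (hx : x < lam + s) :
      iteratedDeriv n (fun u : ℂ => complexMGF id μ (u - (lam : ℂ))) x =
        (tiltedMoment μ n (x - lam) : ℂ) := by
    rw [iteratedDeriv_comp_sub_const, ← iteratedDeriv_complexMGF_ofReal (hmem hx)]
    simp
  have hpos (n : ℕ) {x : ℝ} (hx : x < lam + s) := tiltedMoment_pos hμ htype (hmem hx) n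
  refine ⟨{ A := fun u => complexMGF id μ (u - (lam : ℂ))
            a := fun x => tiltedMoment μ 0 (x - lam)
            a1 := fun x => tiltedMoment μ 1 (x - lam)
            a2 := fun x => tiltedMoment μ 2 (x - lam)
            l1 := l1
            l2 := l2
            -- The shift by λ comes from A(u) = B*(λ - u), the moment generating function at u - λ.
            σ := lam + s
            τ := lam + t
            l1_pos := hl1
            l2_pos := hl2
            lam_lt_tau := by linarith
            tau_lt := by linarith
            diff := fun u hu => ?_
            iter_nonneg := fun n x hx => ?_
            ofReal := fun x hx => ?_
            deriv_ofReal := fun x hx => ?_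
            norm_le := fun u hu => ?_
            norm_deriv_le := fun u hu => ?_
            a_deriv := fun x hx => hd 0 hx
            a1_deriv := fun x hx => hd 1 hx
            a_pos := fun x hx => hpos 0 hx
            a1_pos := fun x hx => hpos 1 hx
            a2_pos := fun x hx => hpos 2 hx
            a_lam := ?_
            a1_lam := by simpa [hlam] using hload'
            a1_tau := by simpa using hte }, rfl, rfl, fun u => rfl,
    fun x => tiltedMoment_zero μ _⟩
  · exact ((hasDerivAt_complexMGF (hmem' hu)).comp_sub_const
      u (lam : ℂ)).differentiableAt.differentiableWithinAt
  · rw [hiter n hx]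
    exact Complex.zero_le_real.2 (hpos n hx).le
  · simpa using hiter 0 hx
  · simpa using hiter 1 hx
  · simpa [tiltedMoment_zero] using norm_complexMGF_le_mgf (X := id) (μ := μ) (z := u - (lam : ℂ))
  · simpa [hder] using norm_deriv_complexMGF_le hμ (hmem' hu)
  · simp [tiltedMoment_zero, ← hlam]

/-! ### Identification of the kernel functions with those of the theorem -/

theorem val_congr {f g : ℂ → ℂ} (h : ∀ z, ‖z‖ < 1 → f z = g z) :
    PriorityRetrial.val f = PriorityRetrial.val g := by
  have h' : f =ᶠ[𝓝 0] g := by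
    filter_upwards [ball_mem_nhds (0 : ℂ) one_pos] with z hz
    exact h z (mem_ball_zero_iff.1 hz)
  funext x
  simp only [PriorityRetrial.val, coeff_congr h']

theorem convergesAt_congr {f g : ℂ → ℂ} (h : ∀ z, ‖z‖ < 1 → f z = g z) {x : ℝ} :
    PriorityRetrial.ConvergesAt f x ↔ PriorityRetrial.ConvergesAt g x := by
  have h' : f =ᶠ[𝓝 0] g := by
    filter_upwards [ball_mem_nhds (0 : ℂ) one_pos] with z hz
    exact h z (mem_ball_zero_iff.1 hz)
  simp only [PriorityRetrial.ConvergesAt, coeff_congr h']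

namespace BusyKernel

theorem a_sub_psi (K : BusyKernel) {t : ℝ} (ht0 : K.lam ≤ t) (ht : t ≤ K.τ) :
    K.l2 * (K.a t - K.psi t) = (t - K.lam) * (K.lam * K.d t - 1) := by
  have h0 : 0 ≤ K.psi t := by
    rcases ht0.eq_or_lt with rfl | h
    · rw [K.psi_lam]; exact zero_le_one
    · exact zero_le_one.trans (K.one_lt_psi h ht).le
  have h1 := K.hh_sub (z := (K.psi t : ℂ)) (by
    rw [Complex.norm_real, Real.norm_of_nonneg h0]; exact K.psi_le_Rh ht)
  rw [K.hh_ofReal ht0 ht, K.u_psi ht0 ht, K.D_ofReal (ht.trans_lt K.tau_lt)] at h1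
  exact_mod_cast h1

variable {K : BusyKernel} {μ : Measure ℝ} {l1 l2 : ℝ}

namespace IsFor

theorem lam_eq (hK : K.IsFor μ l1 l2) : K.lam = l1 + l2 := by rw [lam, hK.l1_eq, hK.l2_eq]

theorem lst_eq (hK : K.IsFor μ l1 l2) (w z : ℂ) :
    lst μ ((l1 : ℂ) * (1 - w) + (l2 : ℂ) * (1 - z)) = K.A (K.l1 * w + K.l2 * z) := by
  rw [hK.A_eq, hK.l1_eq, hK.l2_eq, lst]
  congr 1
  push_cast
  ring

theorem h_eq (hK : K.IsFor μ l1 l2) {z : ℂ} (hz : ‖z‖ < 1) :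
    PriorityRetrial.h μ l1 l2 z = K.hh z := by
  have h := Classical.epsilon_spec (p := fun w : ℂ =>
    ‖w‖ < 1 ∧ w = lst μ ((l1 : ℂ) * (1 - w) + (l2 : ℂ) * (1 - z)))
    ⟨K.hh z, K.norm_hh_lt_one hz, by rw [hK.lst_eq]; exact K.hh_fixed hz⟩
  exact K.eq_hh_of_fixed hz h.1 (h.2.trans (hK.lst_eq _ _))

theorem f1_eq (hK : K.IsFor μ l1 l2) {z : ℂ} (hz : ‖z‖ < 1) :
    PriorityRetrial.f1 μ l1 l2 z = K.F1 z := by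
  rw [PriorityRetrial.f1, hK.h_eq hz, K.F1_eq_of_lt_one hz]

theorem val_h (hK : K.IsFor μ l1 l2) :
    PriorityRetrial.val (PriorityRetrial.h μ l1 l2) = PriorityRetrial.val K.hh :=
  val_congr fun _ hz => hK.h_eq hz

theorem lstReal_eq (hK : K.IsFor μ l1 l2) : lstReal μ = fun s => K.a (l1 + l2 - s) := by
  funext s
  rw [hK.a_eq, lstReal]
  congr 1
  ring

theorem deriv_lstReal (hK : K.IsFor μ l1 l2) {x : ℝ} (hx : x < K.σ) :
    deriv (lstReal μ) (l1 + l2 - x) = -K.a1 x := by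
  rw [hK.lstReal_eq, deriv_comp_const_sub, sub_sub_cancel, (K.a_deriv x hx).deriv]

theorem iteratedDeriv_lstReal (hK : K.IsFor μ l1 l2) {x : ℝ} (hx : x < K.σ) :
    iteratedDeriv 2 (lstReal μ) (l1 + l2 - x) = K.a2 x := by
  rw [hK.lstReal_eq, iteratedDeriv_comp_const_sub]
  have h1 : deriv K.a =ᶠ[𝓝 x] K.a1 := by
    filter_upwards [gt_mem_nhds hx] with y hy using (K.a_deriv y hy).deriv
  simp [iteratedDeriv_succ', h1.deriv_eq, (K.a1_deriv x hx).deriv]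

theorem ch_eq (hK : K.IsFor μ l1 l2) : PriorityRetrial.ch μ l1 l2 K.Rh = K.ch := by
  have h1 : PriorityRetrial.val K.hh K.Rh = K.a K.τ := K.val_hh K.lam_lt_tau'.le le_rfl
  have h2 : l1 * (1 - K.a K.τ) + l2 * (1 - K.Rh) = l1 + l2 - K.τ := by
    have := K.psi_mul K.τ
    rw [Rh, ← hK.l1_eq, ← hK.l2_eq]
    linarith
  rw [PriorityRetrial.ch, hK.val_h, h1, h2, hK.iteratedDeriv_lstReal K.tau_lt, ch, hK.l1_eq,
    hK.l2_eq]

/-- Every x in (1, R_h] is ψ(t) for some t in (λ, τ], and λ₂(h(x) - x) = (t - λ)(λd(t) - 1) with t -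
λ > 0. -/
theorem mem_zerosAboveOne_iff (hK : K.IsFor μ l1 l2) {x : ℝ} :
    x ∈ PriorityRetrial.zerosAboveOne μ l1 l2 K.Rh ↔
      ∃ t, K.lam < t ∧ t ≤ K.τ ∧ K.lam * K.d t = 1 ∧ x = K.psi t := by
  have key {t : ℝ} (ht0 : K.lam < t) (ht : t ≤ K.τ) :
      PriorityRetrial.val K.hh (K.psi t) - K.psi t = 0 ↔ K.lam * K.d t = 1 := by
    have h1 := K.a_sub_psi ht0.le ht
    rw [K.val_hh ht0.le ht]
    constructor
    · intro h
      rw [h, mul_zero, eq_comm, mul_eq_zero] at h1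
      linarith [h1.resolve_left (by linarith)]
    · intro h
      rw [h, sub_self, mul_zero, mul_eq_zero] at h1
      exact h1.resolve_left K.l2_pos.ne'
  rw [PriorityRetrial.zerosAboveOne, Set.mem_ofPred_eq, hK.val_h]
  constructor
  · rintro ⟨h1, h2, h3⟩
    obtain ⟨t, -, ht, rfl, -⟩ := K.exists_u_ofReal (zero_le_one.trans h1.le) h2
    have ht0 : K.lam < t := by
      by_contra h
      have := K.strictMonoOn_psi.monotoneOn ht K.lam_lt_tau'.le (not_lt.1 h)
      rw [K.psi_lam] at this
      linarith
    exact ⟨t, ht0, ht, (key ht0 ht).1 h3, rfl⟩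
  · rintro ⟨t, ht0, ht, h, rfl⟩
    exact ⟨K.one_lt_psi ht0 ht, K.psi_le_Rh ht, (key ht0 ht).2 h⟩

theorem zerosAboveOne_eq_empty (hK : K.IsFor μ l1 l2) (hd : K.lam * K.d K.τ < 1) :
    PriorityRetrial.zerosAboveOne μ l1 l2 K.Rh = ∅ := by
  refine Set.eq_empty_of_forall_notMem fun x hx => ?_
  obtain ⟨t, -, ht, h, -⟩ := hK.mem_zerosAboveOne_iff.1 hx
  have := mul_le_mul_of_nonneg_left
    (K.strictMonoOn_d.monotoneOn (ht.trans_lt K.tau_lt) K.tau_lt ht) K.lam_pos.le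
  linarith

/-- d is strictly increasing, so the zero is unique and therefore the least. -/
theorem isLeast_zerosAboveOne (hK : K.IsFor μ l1 l2) {t : ℝ} (ht0 : K.lam < t) (ht : t ≤ K.τ)
    (hd : K.lam * K.d t = 1) :
    IsLeast (PriorityRetrial.zerosAboveOne μ l1 l2 K.Rh) (K.psi t) := by
  refine ⟨hK.mem_zerosAboveOne_iff.2 ⟨t, ht0, ht, hd, rfl⟩, fun x hx => ?_⟩
  obtain ⟨s, -, hs, hds, rfl⟩ := hK.mem_zerosAboveOne_iff.1 hx
  have h1 : K.d s = K.d t := mul_left_cancel₀ K.lam_pos.ne' (hds.trans hd.symm)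
  rw [K.strictMonoOn_d.injOn (hs.trans_lt K.tau_lt) (ht.trans_lt K.tau_lt) h1]

theorem isDominantSingularity_h (hK : K.IsFor μ l1 l2) :
    PriorityRetrial.IsDominantSingularity (PriorityRetrial.h μ l1 l2) K.Rh :=
  isDominantSingularity_of_continues K.Rh_pos K.differentiableOn_hh
    (fun _ hz => (hK.h_eq hz).symm) (fun _ => K.continues_hh) K.not_continues_hh

theorem convergesAt_h (hK : K.IsFor μ l1 l2) :
    PriorityRetrial.ConvergesAt (PriorityRetrial.h μ l1 l2) K.Rh :=
  (convergesAt_congr fun _ hz => hK.h_eq hz).2 K.hasSum_hh_Rh.1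

end IsFor

end BusyKernel

/-- The stage `S` is built from the transform of `μ`, with rates `l1`, `l2` and `nu`. -/
structure Stage.IsFor (S : Stage) (μ : Measure ℝ) (l1 l2 nu : ℝ) : Prop
    extends S.toBusyKernel.IsFor μ l1 l2 where
  c_eq : S.c = (l1 + l2) / nu
  q0_eq : S.q0 = 1 - load μ l1 l2

/-! ### The three cases for the functions of the theorem -/

namespace Stage.IsFor

variable {S : Stage} {μ : Measure ℝ} {l1 l2 nu : ℝ}

theorem Q_eq (hS : S.IsFor μ l1 l2 nu) {z : ℂ} (hz : ‖z‖ < 1) :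
    PriorityRetrial.Q μ l1 l2 nu z = S.Q z := by
  have hn {t : ℝ} (ht : t ∈ Set.Icc (0 : ℝ) 1) :
      ‖z + (t : ℂ) * (1 - z)‖ ≤ (1 - t) * ‖z‖ + t := by
    have e : z + (t : ℂ) * (1 - z) = ((1 - t : ℝ) : ℂ) * z + t := by push_cast; ring
    rw [e]
    refine (norm_add_le _ _).trans_eq ?_
    rw [norm_mul, Complex.norm_real, Complex.norm_real, Real.norm_of_nonneg ht.1,
      Real.norm_of_nonneg (sub_nonneg.2 ht.2)]
  have hr {t : ℝ} (ht : t ∈ Set.Icc (0 : ℝ) 1) : ‖z + t • (1 - z)‖ < S.r := by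
    have h1 := mul_le_mul_of_nonneg_left hz.le (sub_nonneg.2 ht.2)
    have h2 := hn ht
    rw [Complex.real_smul]
    linarith [S.one_lt_r]
  have h1 := intervalIntegral.integral_unitInterval_deriv_eq_sub (f := S.P) (f' := S.F1)
    (z₀ := z) (z₁ := 1 - z)
    (fun t ht => ((S.analyticAt_F1 (hr ht)).continuousAt.comp (f := fun t : ℝ => z + t • (1 - z))
      (by fun_prop)).continuousWithinAt)
    fun t ht => S.hasDerivAt_P (hr ht)
  have h2 : ∫ t in (0 : ℝ)..1, PriorityRetrial.f1 μ l1 l2 (z + (t : ℂ) * (1 - z)) * (1 - z) =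
      S.P 1 - S.P z := by
    rw [add_sub_cancel, smul_eq_mul, mul_comm, ← intervalIntegral.integral_mul_const] at h1
    rw [← h1]
    refine intervalIntegral.integral_congr_ae ?_
    -- The endpoint t = 1 is discarded: there the path reaches the point 1, outside the open disk on
    -- which h is determined.
    filter_upwards [compl_mem_ae_iff.2 (measure_singleton (1 : ℝ))] with t ht1 ht
    rw [Set.uIoc_of_le zero_le_one] at ht
    have ht' : t < 1 := lt_of_le_of_ne ht.2 ht1
    rw [hS.f1_eq, Complex.real_smul]
    refine (hn ⟨ht.1.le, ht.2⟩).trans_lt ?_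
    have := mul_lt_mul_of_pos_left hz (sub_pos.2 ht')
    linarith
  rw [PriorityRetrial.Q, h2, Stage.Q, hS.c_eq, hS.q0_eq]
  push_cast
  congr 2
  ring

theorem R_eq (hS : S.IsFor μ l1 l2 nu) {z : ℂ} (hz : ‖z‖ < 1) :
    PriorityRetrial.R μ l1 l2 nu z = S.R z := by
  rw [PriorityRetrial.R, hS.Q_eq hz, hS.f1_eq hz, Stage.R, hS.lam_eq, hS.l2_eq]
  ring

theorem P2_eq (hS : S.IsFor μ l1 l2 nu) {z : ℂ} (hz : ‖z‖ < 1) :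
    PriorityRetrial.P2 μ l1 l2 nu z = S.P2 z := by
  rw [PriorityRetrial.P2, hS.Q_eq hz, hS.R_eq hz, Stage.P2]

/-- λ(1 - r) = λ - t because λr = t, and the derivative of B* at λ - t is -A'(t). -/
theorem cf1_eq (hS : S.IsFor μ l1 l2 nu) (hd : S.lam * S.d S.t = 1) :
    PriorityRetrial.cf1 μ l1 l2 S.r = S.cf := by
  have h1 : (l1 + l2) * (1 - S.r) = l1 + l2 - S.t := by
    rw [← (S.lam_mul_r hd).1, hS.lam_eq]
    ring
  rw [PriorityRetrial.cf1, h1, hS.deriv_lstReal S.t_lt_sigma, Stage.cf, hS.lam_eq, hS.l1_eq]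
  ring

theorem cQ1Integrand_eq (hS : S.IsFor μ l1 l2 nu) (hd : S.lam * S.d S.t = 1) :
    PriorityRetrial.cQ1Integrand μ l1 l2 S.r = S.integrand := by
  funext x
  rw [PriorityRetrial.cQ1Integrand, PriorityRetrial.f1Real, hS.cf1_eq hd, hS.val_h,
    Stage.integrand]

theorem cQ1_eq (hS : S.IsFor μ l1 l2 nu) (hd : S.lam * S.d S.t = 1) :
    PriorityRetrial.cQ1 μ l1 l2 nu S.r = S.cQ := by
  rw [PriorityRetrial.cQ1, hS.cQ1Integrand_eq hd, hS.cf1_eq hd, Stage.cQ, hS.c_eq, hS.q0_eq]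

theorem isDominantSingularity_R (hS : S.IsFor μ l1 l2 nu) (h : ¬ Continues S.R S.r S.r) :
    PriorityRetrial.IsDominantSingularity (PriorityRetrial.R μ l1 l2 nu) S.r :=
  isDominantSingularity_of_continues S.r_pos S.differentiableOn_R
    (fun _ hz => (hS.R_eq hz).symm) (fun _ => S.continues_R) h

theorem isDominantSingularity_P2 (hS : S.IsFor μ l1 l2 nu) (h : ¬ Continues S.P2 S.r S.r) :
    PriorityRetrial.IsDominantSingularity (PriorityRetrial.P2 μ l1 l2 nu) S.r :=
  isDominantSingularity_of_continues S.r_pos S.differentiableOn_P2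
    (fun _ hz => (hS.P2_eq hz).symm) (fun _ => S.continues_P2) h

/-- The dominant singularities at a zero of `h(x) - x`. -/
theorem isDominantSingularity_of_zero (hS : S.IsFor μ l1 l2 nu) (hd : S.lam * S.d S.t = 1) :
    PriorityRetrial.IsDominantSingularity (PriorityRetrial.R μ l1 l2 nu) S.r ∧
      PriorityRetrial.IsDominantSingularity (PriorityRetrial.P2 μ l1 l2 nu) S.r :=
  ⟨hS.isDominantSingularity_R (not_continues_of_tendsto_norm_atTop S.r_pos (S.tendsto_norm_R hd)),
    hS.isDominantSingularity_P2
      (not_continues_of_tendsto_norm_atTop S.r_pos (S.tendsto_norm_P2 hd))⟩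

theorem pole_case (hS : S.IsFor μ l1 l2 nu) (ht : S.t < S.τ) (hd : S.lam * S.d S.t = 1) :
    IntervalIntegrable (PriorityRetrial.cQ1Integrand μ l1 l2 S.r) volume S.r 1 ∧
      PriorityRetrial.DeltaEquivalent (PriorityRetrial.R μ l1 l2 nu) S.r
        (PriorityRetrial.term1 μ l1 l2 nu S.r) ∧
      PriorityRetrial.DeltaEquivalent (PriorityRetrial.P2 μ l1 l2 nu) S.r
        (PriorityRetrial.term1 μ l1 l2 nu S.r) := by
  obtain ⟨C, mR, mP, hC, hC0, aR, aP, hR, hP, eR, eP⟩ := S.cpow_expansion ht hd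
  have hterm : PriorityRetrial.term1 μ l1 l2 nu S.r =
      fun z => (C : ℂ) * ((S.r : ℂ) - z) ^ ((-1 - S.c * S.cf : ℝ) : ℂ) := by
    funext z
    rw [PriorityRetrial.term1, hS.cQ1_eq hd, hS.cf1_eq hd, hC, hS.lam_eq, hS.l2_eq, hS.c_eq]
  refine ⟨hS.cQ1Integrand_eq hd ▸ S.intervalIntegrable_integrand ht hd, ?_, ?_⟩
  · have := hasDeltaExpansion_of_cpow S.one_lt_r S.differentiableOn_R
      (fun _ hz => (hS.R_eq hz).symm) (fun _ => S.continues_R) aR (by rwa [hR]) eR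
    rwa [hR, ← hterm] at this
  · have := hasDeltaExpansion_of_cpow S.one_lt_r S.differentiableOn_P2
      (fun _ hz => (hS.P2_eq hz).symm) (fun _ => S.continues_P2) aP (by rwa [hP]) eP
    rwa [hP, ← hterm] at this

theorem val_Q (hS : S.IsFor μ l1 l2 nu) :
    PriorityRetrial.val (PriorityRetrial.Q μ l1 l2 nu) = PriorityRetrial.val S.Q :=
  val_congr fun _ hz => hS.Q_eq hz

/-- An expansion at a square root singularity, with the value of the Taylor series. -/
theorem _root_.RetrialAnalysis.hasDeltaExpansion_val_of_sqrt {f F H : ℂ → ℂ} {R C : ℝ}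
    (hR : 1 < R) (hF : DifferentiableOn ℂ F (ball 0 R)) (hFf : ∀ z, ‖z‖ < 1 → F z = f z)
    (hζ : ∀ ζ : ℂ, ‖ζ‖ = R → ζ ≠ R → Continues F R ζ) (hpos : ∀ N, NonnegCoeff F N)
    (aH : AnalyticAt ℂ H 0) (hC : (C : ℂ) ≠ 0) (hH : HasDerivAt H (-(C : ℂ)) 0)
    (hFH : ∀ᶠ z in 𝓝[ball 0 R] (R : ℂ), F z = H (rt R z)) :
    PriorityRetrial.ConvergesAt f R ∧
      PriorityRetrial.HasDeltaExpansion f R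
        (fun z => (PriorityRetrial.val f R : ℂ) - C * ((R : ℂ) - z) ^ (1 / 2 : ℂ))
        (fun z => C * ((R : ℂ) - z) ^ (1 / 2 : ℂ)) := by
  have h1 := convergesAt_of_tendsto (zero_lt_one.trans hR) hF hpos
    (tendsto_of_sqrt (zero_lt_one.trans hR) aH.continuousAt hFH)
  have hfF : ∀ z, ‖z‖ < 1 → f z = F z := fun z hz => (hFf z hz).symm
  refine ⟨(convergesAt_congr hfF).2 h1.1, ?_⟩
  rw [val_congr hfF, h1.2]
  exact hasDeltaExpansion_of_sqrt hR hF hFf hζ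
    (aH.eventually_analyticAt.filter_mono nhdsWithin_le_nhds) hFH (isLittleO_sub_linear hC hH)

theorem sqrt_case (hS : S.IsFor μ l1 l2 nu) (ht : S.t = S.τ) (hd : S.lam * S.d S.τ < 1) :
    (PriorityRetrial.IsDominantSingularity (PriorityRetrial.R μ l1 l2 nu) S.r ∧
      PriorityRetrial.IsDominantSingularity (PriorityRetrial.P2 μ l1 l2 nu) S.r) ∧
    PriorityRetrial.ConvergesAt (PriorityRetrial.Q μ l1 l2 nu) S.r ∧
    PriorityRetrial.ConvergesAt (PriorityRetrial.R μ l1 l2 nu) S.r ∧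
    PriorityRetrial.ConvergesAt (PriorityRetrial.P2 μ l1 l2 nu) S.r ∧
    PriorityRetrial.HasDeltaExpansion (PriorityRetrial.R μ l1 l2 nu) S.r
      (fun z => (PriorityRetrial.val (PriorityRetrial.R μ l1 l2 nu) S.r : ℂ)
        - PriorityRetrial.term2 μ l1 l2 nu S.r z)
      (PriorityRetrial.term2 μ l1 l2 nu S.r) ∧
    PriorityRetrial.HasDeltaExpansion (PriorityRetrial.P2 μ l1 l2 nu) S.r
      (fun z => (PriorityRetrial.val (PriorityRetrial.P2 μ l1 l2 nu) S.r : ℂ)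
        - PriorityRetrial.term2 μ l1 l2 nu S.r z)
      (PriorityRetrial.term2 μ l1 l2 nu S.r) := by
  obtain ⟨cvQ, C, HR, HP, hC, hC0, aR, aP, dR, dP, eR, eP⟩ := S.sqrt_expansion ht hd
  have hterm : PriorityRetrial.term2 μ l1 l2 nu S.r =
      fun z => (C : ℂ) * ((S.r : ℂ) - z) ^ (1 / 2 : ℂ) := by
    funext z
    have h1 : PriorityRetrial.val S.hh S.r = S.a S.τ := by
      rw [← ht]; exact S.val_hh S.lam_lt_t.le S.t_le
    rw [PriorityRetrial.term2, PriorityRetrial.cf2, hS.val_h, h1, hS.val_Q, hC, hS.lam_eq,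
      hS.l2_eq, ← hS.ch_eq, ← S.r_eq ht, mul_assoc ((l1 + l2) / l2)]
  have hR := hasDeltaExpansion_val_of_sqrt S.one_lt_r S.differentiableOn_R
    (fun _ hz => (hS.R_eq hz).symm) (fun _ => S.continues_R) S.nonnegCoeff_R aR hC0 dR eR
  have hP := hasDeltaExpansion_val_of_sqrt S.one_lt_r S.differentiableOn_P2
    (fun _ hz => (hS.P2_eq hz).symm) (fun _ => S.continues_P2) S.nonnegCoeff_P2 aP hC0 dP eP
  rw [hterm]
  exact ⟨⟨hS.isDominantSingularity_R (not_continues_of_sqrt S.r_pos (neg_ne_zero.2 hC0) dR eR),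
      hS.isDominantSingularity_P2 (not_continues_of_sqrt S.r_pos (neg_ne_zero.2 hC0) dP eP)⟩,
    (convergesAt_congr fun _ hz => hS.Q_eq hz).2 cvQ, hR.1, hP.1, hR.2, hP.2⟩

theorem inv_sqrt_case (hS : S.IsFor μ l1 l2 nu) (ht : S.t = S.τ) (hd : S.lam * S.d S.τ = 1) :
    PriorityRetrial.ConvergesAt (PriorityRetrial.Q μ l1 l2 nu) S.r ∧
    PriorityRetrial.DeltaEquivalent (PriorityRetrial.R μ l1 l2 nu) S.r
      (PriorityRetrial.term3 μ l1 l2 nu S.r) ∧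
    PriorityRetrial.DeltaEquivalent (PriorityRetrial.P2 μ l1 l2 nu) S.r
      (PriorityRetrial.term3 μ l1 l2 nu S.r) := by
  obtain ⟨cvQ, C, mR, mP, hC, hC0, aR, aP, hR, hP, eR, eP⟩ := S.inv_sqrt_expansion ht hd
  have hterm : PriorityRetrial.term3 μ l1 l2 nu S.r = fun z => (C : ℂ) / rt S.r z := by
    funext z
    rw [PriorityRetrial.term3, PriorityRetrial.cf3, hS.val_Q, hC, hS.lam_eq, hS.l2_eq,
      ← hS.ch_eq, ← S.r_eq ht, rt]
  have han {m : ℂ → ℂ} (am : AnalyticAt ℂ m 0) :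
      ∀ᶠ s in 𝓝[≠] (0 : ℂ), AnalyticAt ℂ (fun s => m s / s) s := by
    filter_upwards [am.eventually_analyticAt.filter_mono nhdsWithin_le_nhds,
      self_mem_nhdsWithin] with s hs hs0
    exact hs.div analyticAt_id hs0
  refine ⟨(convergesAt_congr fun _ hz => hS.Q_eq hz).2 cvQ, ?_, ?_⟩
  · rw [hterm, ← hR]
    exact hasDeltaExpansion_of_sqrt (H := fun s => mR s / s) S.one_lt_r S.differentiableOn_R
      (fun _ hz => (hS.R_eq hz).symm) (fun _ => S.continues_R) (han aR) eR
      (isLittleO_div_sub aR.continuousAt (by rwa [hR]))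
  · rw [hterm, ← hP]
    exact hasDeltaExpansion_of_sqrt (H := fun s => mP s / s) S.one_lt_r S.differentiableOn_P2
      (fun _ hz => (hS.P2_eq hz).symm) (fun _ => S.continues_P2) (han aP) eP
      (isLittleO_div_sub aP.continuousAt (by rwa [hP]))

end Stage.IsFor

theorem BusyKernel.IsFor.exists_stage {K : BusyKernel} {μ : Measure ℝ} {l1 l2 nu t : ℝ}
    (hK : K.IsFor μ l1 l2) (hnu : 0 < nu) (hload : load μ l1 l2 < 1) (ht0 : K.lam < t)
    (ht : t ≤ K.τ) (hd : K.lam * K.d t ≤ 1) :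
    ∃ S : Stage, S.toBusyKernel = K ∧ S.t = t ∧ S.IsFor μ l1 l2 nu := by
  refine ⟨{ toBusyKernel := K
            t := t
            c := (l1 + l2) / nu
            q0 := 1 - load μ l1 l2
            lam_lt_t := ht0
            t_le := ht
            d_le := hd
            c_pos := div_pos (hK.lam_eq ▸ K.lam_pos) hnu
            q0_pos := sub_pos.2 hload }, rfl, rfl, hK, rfl, rfl⟩

/-- λd is continuous, below 1 at λ by stability and above 1 at τ. -/
theorem BusyKernel.exists_lam_mul_d_eq_one (K : BusyKernel) (h : 1 < K.lam * K.d K.τ) :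
    ∃ t, K.lam < t ∧ t < K.τ ∧ K.lam * K.d t = 1 := by
  have hc : ContinuousOn (fun t => K.lam * K.d t) (Set.Icc K.lam K.τ) :=
    (K.continuousOn_d.mono fun t ht => ht.2.trans_lt K.tau_lt).const_mul K.lam
  obtain ⟨t, ht, hd⟩ := intermediate_value_Ioo K.lam_lt_tau'.le hc ⟨K.lam_mul_d_lam, h⟩
  exact ⟨t, ht.1, ht.2, hd⟩

end RetrialAnalysis
-- Assembly of the theorem
theorem mainTheorem5 (μ : Measure ℝ) [IsProbabilityMeasure μ] (hμ : ∀ᵐ x ∂μ, 0 ≤ x)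
    (htype : PriorityRetrial.IsType1 μ) (l1 l2 nu : ℝ) (hl1 : 0 < l1) (hl2 : 0 < l2)
    (hnu : 0 < nu) (hload : PriorityRetrial.load μ l1 l2 < 1) :
    ∃ Rh RR : ℝ,
      PriorityRetrial.IsDominantSingularity (PriorityRetrial.h μ l1 l2) Rh ∧
      PriorityRetrial.ConvergesAt (PriorityRetrial.h μ l1 l2) Rh ∧
      PriorityRetrial.IsDominantSingularity (PriorityRetrial.R μ l1 l2 nu) RR ∧
      PriorityRetrial.IsDominantSingularity (PriorityRetrial.P2 μ l1 l2 nu) RR ∧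
      1 < RR ∧
      -- the three cases are exhaustive
      ((IsLeast (PriorityRetrial.zerosAboveOne μ l1 l2 Rh) RR ∧ RR < Rh) ∨
        (PriorityRetrial.zerosAboveOne μ l1 l2 Rh = ∅ ∧ RR = Rh) ∨
        (IsLeast (PriorityRetrial.zerosAboveOne μ l1 l2 Rh) RR ∧ RR = Rh)) ∧
      -- first case
      (IsLeast (PriorityRetrial.zerosAboveOne μ l1 l2 Rh) RR → RR < Rh →
        IntervalIntegrable (PriorityRetrial.cQ1Integrand μ l1 l2 RR) volume RR 1 ∧
        PriorityRetrial.DeltaEquivalent (PriorityRetrial.R μ l1 l2 nu) RR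
          (PriorityRetrial.term1 μ l1 l2 nu RR) ∧
        PriorityRetrial.DeltaEquivalent (PriorityRetrial.P2 μ l1 l2 nu) RR
          (PriorityRetrial.term1 μ l1 l2 nu RR)) ∧
      -- second case
      (PriorityRetrial.zerosAboveOne μ l1 l2 Rh = ∅ → RR = Rh →
        PriorityRetrial.ConvergesAt (PriorityRetrial.Q μ l1 l2 nu) RR ∧
        PriorityRetrial.ConvergesAt (PriorityRetrial.R μ l1 l2 nu) RR ∧
        PriorityRetrial.ConvergesAt (PriorityRetrial.P2 μ l1 l2 nu) RR ∧
        PriorityRetrial.HasDeltaExpansion (PriorityRetrial.R μ l1 l2 nu) RR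
          (fun z => (PriorityRetrial.val (PriorityRetrial.R μ l1 l2 nu) RR : ℂ)
            - PriorityRetrial.term2 μ l1 l2 nu RR z)
          (PriorityRetrial.term2 μ l1 l2 nu RR) ∧
        PriorityRetrial.HasDeltaExpansion (PriorityRetrial.P2 μ l1 l2 nu) RR
          (fun z => (PriorityRetrial.val (PriorityRetrial.P2 μ l1 l2 nu) RR : ℂ)
            - PriorityRetrial.term2 μ l1 l2 nu RR z)
          (PriorityRetrial.term2 μ l1 l2 nu RR)) ∧
      -- third case
      (IsLeast (PriorityRetrial.zerosAboveOne μ l1 l2 Rh) RR → RR = Rh →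
        PriorityRetrial.ConvergesAt (PriorityRetrial.Q μ l1 l2 nu) RR ∧
        PriorityRetrial.DeltaEquivalent (PriorityRetrial.R μ l1 l2 nu) RR
          (PriorityRetrial.term3 μ l1 l2 nu RR) ∧
        PriorityRetrial.DeltaEquivalent (PriorityRetrial.P2 μ l1 l2 nu) RR
          (PriorityRetrial.term3 μ l1 l2 nu RR)) := by
  obtain ⟨K, hK⟩ := RetrialAnalysis.exists_isFor hμ htype hl1 hl2 hload
  -- Below 1 there is no zero of h(x) - x up to R_h; equality puts the zero at R_h; above 1 it lies
  -- strictly before R_h. In each branch the clauses for the other two cases hold because their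
  -- hypotheses are contradictory.
  rcases lt_trichotomy (K.lam * K.d K.τ) 1 with hd | hd | hd
  · obtain ⟨S, rfl, ht, hS⟩ := hK.exists_stage hnu hload K.lam_lt_tau' le_rfl hd.le
    have h0 := hK.zerosAboveOne_eq_empty hd
    obtain ⟨⟨hR, hP⟩, hcase⟩ := hS.sqrt_case ht hd
    exact ⟨S.Rh, S.r, hK.isDominantSingularity_h, hK.convergesAt_h, hR, hP, S.one_lt_r,
      Or.inr (Or.inl ⟨h0, S.r_eq ht⟩), fun _ hlt => absurd (S.r_eq ht) hlt.ne,
      fun _ _ => hcase, fun hl => by simpa [h0] using hl.1⟩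
  · obtain ⟨S, rfl, ht, hS⟩ := hK.exists_stage hnu hload K.lam_lt_tau' le_rfl hd.le
    have hl := hK.isLeast_zerosAboveOne S.lam_lt_t S.t_le (ht ▸ hd)
    obtain ⟨hR, hP⟩ := hS.isDominantSingularity_of_zero (ht ▸ hd)
    exact ⟨S.Rh, S.r, hK.isDominantSingularity_h, hK.convergesAt_h, hR, hP, S.one_lt_r,
      Or.inr (Or.inr ⟨hl, S.r_eq ht⟩), fun _ hlt => absurd (S.r_eq ht) hlt.ne,
      fun h0 => by simpa [h0] using hl.1, fun _ _ => hS.inv_sqrt_case ht hd⟩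
  · obtain ⟨t, ht0, htτ, hdt⟩ := K.exists_lam_mul_d_eq_one hd
    obtain ⟨S, rfl, rfl, hS⟩ := hK.exists_stage hnu hload ht0 htτ.le hdt.le
    have hl := hK.isLeast_zerosAboveOne S.lam_lt_t S.t_le hdt
    obtain ⟨hR, hP⟩ := hS.isDominantSingularity_of_zero hdt
    have hlt := S.r_lt_Rh htτ
    exact ⟨S.Rh, S.r, hK.isDominantSingularity_h, hK.convergesAt_h, hR, hP, S.one_lt_r,
      Or.inl ⟨hl, hlt⟩, fun _ _ => hS.pole_case htτ hdt,
      fun _ he => absurd he hlt.ne, fun _ he => absurd he hlt.ne⟩
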